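/- Let $d\in\{2,3\}$, let $D\subset\mathbb R^d$ be bounded and open, $T>0$, $\rho>0$. Let $f:[0,\infty)\to\mathbb R$ be smooth (up to $0$), concave, positive on $(0,\infty)$, with $\lim_{r\to0^+}f(r)/r=f'(0)$ and $\lim_{r\to\infty}f(r)<\infty$; let $J$ be measurable with $0\le J\le M$ on $[0,1]$ for some $M$ and $J(r)=0$ for $r>1$. Write $e_\xi=\xi/|\xi|$ and let $\omega_d$ be the volume of the unit ball. For $\epsilon>0$ and $w:\mathbb R^d\to\mathbb R^d$ put $S(y,x;w)=\frac{w(y)-w(x)}{|y-x|}\cdot e_{y-x}$ and $$-\boldsymbol\nabla PD^\epsilon(w)(x)=\frac{4}{\epsilon^{d+1}\omega_d}\int_{|y-x|<\epsilon}J\!\left(\tfrac{|y-x|}{\epsilon}\right)f'\!\left(|y-x|\,S(y,x;w)^2\right)S(y,x;w)\,e_{y-x}\,dy .$$ Let $\mathcal Ew=(\nabla w+\nabla w^T)/2$ and $$\bar{\mathbb C}=\frac{2f'(0)}{\omega_d}\int_{|\xi|<1}J(|\xi|)\,e_\xi\otimes e_\xi\otimes e_\xi\otimes e_\xi\,|\xi|\,d\xi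 .$$ Let $b:[0,T]\times D\to\mathbb R^d$, let $D'\subset D$ with $\operatorname{dist}(\partial D',\partial D)>0$, and let $u_0,v_0:\mathbb R^d\to\mathbb R^d$ vanish outside $D'$. Let $u$, of class $C^2$ on $[0,T]\times\overline D$, satisfy $\rho\ddot u=\nabla\cdot\bar{\mathbb C}\mathcal Eu+b$ in $[0,T]\times D$, $u=0$ on $[0,T]\times\partial D$, and $u(0,\cdot)=u_0$, $\dot u(0,\cdot)=v_0$ in $D$. For every $C_1$ there are constants $C_2,C_3>0$ such that the following holds for every $\epsilon$ with $0<\epsilon<\operatorname{dist}(\partial D',\partial D)$. Let $u^\epsilon$ be $C^2$ in time on $[0,T]$ at each point of $D$ and satisfy $u^\epsilon(t,x)=0$ whenever $t\in[0,T]$ and $\operatorname{dist}(x,\partial D)\le\epsilon$, $\rho\ddot u^\epsilon=-\boldsymbol\nabla PD^\epsilon(u^\epsilon)+b$ for $t\in[0,T]$ and $x\in D$ with $\operatorname{dist}(x,\partial D)>\epsilon$, and $u^\epsilon(0,\cdot)=u_0$, $\dot u^\epsilon(0,\cdot)=v_0$ in $D$. Suppose $u^\epsilon(t)\in C^4(D;\mathbb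 R^d)$ for all $t\in[0,T]$ and $|\nabla^4u^\epsilon(t,x)|\le C_1$ on $[0,T]\times D$. Then $e^\epsilon:=u^\epsilon-u$ satisfies (all integrands being integrable) $$\sup_{t\in[0,T]}\left\{\int_D\rho|\dot e^\epsilon(t,x)|^2dx+\int_D\mathcal Ee^\epsilon(t,x)\cdot\bar{\mathbb C}\,\mathcal Ee^\epsilon(t,x)\,dx\right\}\le C_2\epsilon^2$$ and $$\sup_{t\in[0,T]}\|e^\epsilon(t)\|_{H^1(D;\mathbb R^d)}\le C_3\,\epsilon .$$ -/

import Mathlib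

open MeasureTheory Set Filter Topology
open scoped ContDiff

noncomputable section

namespace Peridynamics

/-- Euclidean space `ℝ^d`. -/
abbrev Vec (d : ℕ) : Type := EuclideanSpace ℝ (Fin d)

/-- The derivative `f'` of a function given on `[0, ∞)` (one-sided at `0`). -/
def halfLineDeriv (f : ℝ → ℝ) (r : ℝ) : ℝ := derivWithin f (Ici 0) r

/-- Admissible potential functions `f : [0, ∞) → ℝ`: smooth up to `0`, positive, concave,
with `f(r)/r → f'(0)` as `r → 0⁺` and a finite limit at infinity. -/
structure IsPotential (f : ℝ → ℝ) : Prop where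
  smooth : ContDiffOn ℝ ∞ f (Ici 0)
  pos : ∀ r, 0 < r → 0 < f r
  concave : ConcaveOn ℝ (Ici 0) f
  slope_zero : Tendsto (fun r => f r / r) (𝓝[>] 0) (𝓝 (halfLineDeriv f 0))
  limit_infty : ∃ fInf : ℝ, Tendsto f atTop (𝓝 fInf)

/-- Influence functions `J`: measurable, `0 ≤ J ≤ M` on `[0, 1]`, zero beyond `1`. -/
structure IsInfluence (J : ℝ → ℝ) : Prop where
  measurable : Measurable J
  bounded : ∃ M : ℝ, ∀ r ∈ Icc (0 : ℝ) 1, 0 ≤ J r ∧ J r ≤ M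
  zero_outside : ∀ r, 1 < r → J r = 0

/-- The volume `ω_d` of the unit ball of `ℝ^d`. -/
def unitBallVolume (d : ℕ) : ℝ := (volume (Metric.ball (0 : Vec d) 1)).toReal

/-- The unit vector `e_ξ = ξ / |ξ|`. -/
def unitDir {d : ℕ} (ξ : Vec d) : Vec d := ‖ξ‖⁻¹ • ξ

/-- The bond strain `S(y, x; u) = (u(y) - u(x)) / |y - x| · e_{y - x}`. -/
def bondStrain {d : ℕ} (u : Vec d → Vec d) (y x : Vec d) : ℝ :=
  inner ℝ (u y - u x) (unitDir (y - x)) / ‖y - x‖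

/-- The nonlinear nonlocal force `-∇PD^ε(u)(x)`. -/
def nonlocalForce {d : ℕ} (f J : ℝ → ℝ) (ε : ℝ) (u : Vec d → Vec d) (x : Vec d) : Vec d :=
  (4 / (ε ^ (d + 1) * unitBallVolume d)) •
    ∫ y in Metric.ball x ε,
      (J (‖y - x‖ / ε) * halfLineDeriv f (‖y - x‖ * bondStrain u y x ^ 2) *
        bondStrain u y x) • unitDir (y - x)

/-- The elasticity tensor
`C̄ = (2 f'(0) / ω_d) ∫_{|ξ| < 1} J(|ξ|) e_ξ ⊗ e_ξ ⊗ e_ξ ⊗ e_ξ |ξ| dξ`. -/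
def elasticTensor (d : ℕ) (f J : ℝ → ℝ) (i j k l : Fin d) : ℝ :=
  2 * halfLineDeriv f 0 / unitBallVolume d *
    ∫ ξ in Metric.ball (0 : Vec d) 1,
      J ‖ξ‖ * (unitDir ξ i * unitDir ξ j * unitDir ξ k * unitDir ξ l) * ‖ξ‖

/-- The `j`-th partial derivative of a map on `ℝ^d`. -/
def partialDeriv {d : ℕ} {F : Type*} [NormedAddCommGroup F] [NormedSpace ℝ F]
    (j : Fin d) (w : Vec d → F) (x : Vec d) : F :=
  fderiv ℝ w x (EuclideanSpace.single j 1)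

/-- The strain tensor `𝓔w = (∇w + ∇wᵀ) / 2`. -/
def strain {d : ℕ} (w : Vec d → Vec d) (x : Vec d) (i j : Fin d) : ℝ :=
  (partialDeriv j w x i + partialDeriv i w x j) / 2

/-- The stress `C̄ 𝓔w`. -/
def stress {d : ℕ} (f J : ℝ → ℝ) (w : Vec d → Vec d) (x : Vec d) (i j : Fin d) : ℝ :=
  ∑ k, ∑ l, elasticTensor d f J i j k l * strain w x k l

/-- The local elastic force `∇ · C̄ 𝓔w`. -/
def elasticForce {d : ℕ} (f J : ℝ → ℝ) (w : Vec d → Vec d) (x : Vec d) : Vec d :=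
  WithLp.toLp 2 fun i => ∑ j, partialDeriv j (fun z => stress f J w z i j) x

/-- The elastic energy density `𝓔w · C̄ 𝓔w`. -/
def elasticDensity {d : ℕ} (f J : ℝ → ℝ) (w : Vec d → Vec d) (x : Vec d) : ℝ :=
  ∑ i, ∑ j, strain w x i j * stress f J w x i j

/-- The squared Euclidean (Frobenius) norm `|∇w|²`. -/
def gradSq {d : ℕ} (w : Vec d → Vec d) (x : Vec d) : ℝ :=
  ∑ j, ‖partialDeriv j w x‖ ^ 2

/-- The `H¹(D; ℝ^d)` norm. -/
def hOneNorm {d : ℕ} (D : Set (Vec d)) (w : Vec d → Vec d) : ℝ :=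
  Real.sqrt ((∫ x in D, ‖w x‖ ^ 2) + ∫ x in D, gradSq w x)

/-- The velocity `∂_t w(t, x)` of a field given for times in `[0, T]`. -/
def velocity {d : ℕ} (T : ℝ) (w : ℝ → Vec d → Vec d) (t : ℝ) (x : Vec d) : Vec d :=
  derivWithin (fun s => w s x) (Icc 0 T) t

/-- The acceleration `∂_t² w(t, x)` of a field given for times in `[0, T]`. -/
def acceleration {d : ℕ} (T : ℝ) (w : ℝ → Vec d → Vec d) (t : ℝ) (x : Vec d) : Vec d :=
  derivWithin (fun s => velocity T w s x) (Icc 0 T) t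

/-- The distance of two sets, in `[0, ∞]`. -/
def setDist {d : ℕ} (A B : Set (Vec d)) : ENNReal :=
  ⨅ x ∈ A, ⨅ y ∈ B, edist x y

/-- `u` is a classical solution, of class `C²` on `[0, T] × D̄`, of
`ρ ∂_t² u = ∇ · C̄ 𝓔u + b` in `[0, T] × D` with `u = 0` on `∂D` and initial data `u₀`, `v₀`. -/
structure IsElastodynamicSolution {d : ℕ} (f J : ℝ → ℝ) (D : Set (Vec d)) (T ρ : ℝ)
    (b : ℝ → Vec d → Vec d) (u₀ v₀ : Vec d → Vec d) (u : ℝ → Vec d → Vec d) : Prop where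
  regular : ContDiffOn ℝ 2 (fun p : ℝ × Vec d => u p.1 p.2) (Icc 0 T ×ˢ closure D)
  equation : ∀ t ∈ Icc 0 T, ∀ x ∈ D,
    ρ • acceleration T u t x = elasticForce f J (u t) x + b t x
  boundary : ∀ t ∈ Icc 0 T, ∀ x ∈ frontier D, u t x = 0
  initial : ∀ x ∈ D, u 0 x = u₀ x
  initial_velocity : ∀ x ∈ D, velocity T u 0 x = v₀ x

/-- `w` is a solution, twice continuously differentiable in time, of
`ρ ∂_t² w = -∇PD^ε(w) + b` with the nonlocal boundary condition `w = 0` on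
`{x : dist(x, ∂D) ≤ ε}` and initial data `u₀`, `v₀`.  The equation is required only at the
points of `D` at which `w` is not prescribed by the boundary condition. -/
structure IsPeridynamicSolution {d : ℕ} (f J : ℝ → ℝ) (D : Set (Vec d)) (T ρ ε : ℝ)
    (b : ℝ → Vec d → Vec d) (u₀ v₀ : Vec d → Vec d) (w : ℝ → Vec d → Vec d) : Prop where
  regular : ∀ x ∈ D, ContDiffOn ℝ 2 (fun t => w t x) (Icc 0 T)
  equation : ∀ t ∈ Icc 0 T, ∀ x ∈ D, ε < Metric.infDist x (frontier D) →
    ρ • acceleration T w t x = nonlocalForce f J ε (w t) x + b t x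
  boundary : ∀ t ∈ Icc 0 T, ∀ x, Metric.infDist x (frontier D) ≤ ε → w t x = 0
  initial : ∀ x ∈ D, w 0 x = u₀ x
  initial_velocity : ∀ x ∈ D, velocity T w 0 x = v₀ x

end Peridynamics

end

/-
Extended by zero, the error is Lipschitz on the whole space, so integration by parts and Korn's
inequality hold without any regularity of `∂D`. By isotropy the elasticity tensor is
`β (δᵢⱼ δₖₗ + δᵢₖ δⱼₗ + δᵢₗ δⱼₖ)`, with `β = 0` only if `J = 0` almost everywhere.

A field that vanishes near `∂D` and has bounded fourth derivatives has all lower derivatives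
bounded in terms of `D`, so Taylor expansion compares the nonlocal and the elastic force up to
`O(ε)` outside the collar `{dist(x, ∂D) ≤ ε}`. The equation is not imposed in the collar, where the
residual is only `O(1)`; but there the velocity of the error is `-∂ₜu`, and the energy identity
with Grönwall's lemma bounds the energy of the error by a multiple of `ε² + sup |∂ₜu|`, the
supremum being over the collar. If approximations exist for arbitrarily small `ε`, letting `ε → 0`
forces `|u| ≤ C dist(x, ∂D)⁴`, and Landau's interpolation inequality then gives `|∂ₜu| = O(ε²)` and
`|∇u| = O(ε)` in the collar; if not, `ε` is bounded below and these bounds are trivial. Either way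
the energy is `O(ε²)`. For `β > 0` Korn's inequality bounds the gradient; for `β = 0` the error
vanishes outside the collar and its gradient is `O(ε)` inside.
-/

namespace Peridynamics

section ZeroExtension

variable {E F : Type*} [NormedAddCommGroup E] [NormedSpace ℝ E]
  [NormedAddCommGroup F] [NormedSpace ℝ F] {g : E → F} {D : Set E}

lemma norm_le_mul_norm_sub_of_eq_zero_off {M : ℝ} (hD : IsOpen D) (hc : Continuous g)
    (h0 : ∀ x ∉ D, g x = 0) (hd : DifferentiableOn ℝ g D) (hM : ∀ x ∈ D, ‖fderiv ℝ g x‖ ≤ M)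
    {x y : E} (hx : x ∈ D) (hy : y ∉ D) : ‖g x‖ ≤ M * ‖y - x‖ := by
  have hM0 : 0 ≤ M := (norm_nonneg _).trans (hM x hx)
  let γ : ℝ → E := fun s => x + s • (y - x)
  have hγ : Continuous γ := by fun_prop
  have hK : IsCompact (Icc (0 : ℝ) 1 ∩ γ ⁻¹' Dᶜ) :=
    isCompact_Icc.inter_right (hD.isClosed_compl.preimage hγ)
  -- `s₀` is the first time at which the segment from `x` to `y` leaves `D`
  obtain ⟨s₀, ⟨hs₀, hs₀D⟩, hmin⟩ := hK.exists_isLeast ⟨1, by simp, by simpa [γ] using hy⟩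
  have hin : ∀ s ∈ Ico (0 : ℝ) s₀, γ s ∈ D := by
    intro s hs
    by_contra hns
    exact absurd (hmin ⟨⟨hs.1, hs.2.le.trans hs₀.2⟩, hns⟩) (not_le.2 hs.2)
  have hγ' : ∀ s, HasDerivAt γ (y - x) s := fun s => by
    simpa [γ] using ((hasDerivAt_id s).smul_const (y - x)).const_add x
  have hmean : ‖(g ∘ γ) s₀ - (g ∘ γ) 0‖ ≤ M * ‖y - x‖ * (s₀ - 0) :=
    norm_image_sub_le_of_norm_deriv_right_le_segment (hc.comp hγ).continuousOn
      (fun s hs => ((hd.differentiableAt (hD.mem_nhds (hin s hs))).hasFDerivAt.comp_hasDerivAt s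
        (hγ' s)).hasDerivWithinAt)
      (fun s hs => (fderiv ℝ g (γ s)).le_of_opNorm_le (hM _ (hin s hs)) _) s₀ ⟨hs₀.1, le_rfl⟩
  have hstart : γ 0 = x := by simp [γ]
  rw [Function.comp_apply, Function.comp_apply, h0 _ hs₀D, hstart, zero_sub, norm_neg,
    sub_zero] at hmean
  exact hmean.trans (mul_le_of_le_one_right (by positivity) hs₀.2)

lemma lipschitzWith_of_eq_zero_off {M : NNReal} (hD : IsOpen D) (hc : Continuous g)
    (h0 : ∀ x ∉ D, g x = 0) (hd : DifferentiableOn ℝ g D) (hM : ∀ x ∈ D, ‖fderiv ℝ g x‖ ≤ M) :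
    LipschitzWith M g := by
  refine LipschitzWith.of_dist_le_mul fun x y => ?_
  rw [dist_eq_norm, dist_eq_norm]
  have hout : ∀ {x y}, x ∈ D → y ∉ D → ‖g x‖ ≤ M * ‖y - x‖ :=
    norm_le_mul_norm_sub_of_eq_zero_off hD hc h0 hd hM
  by_cases hx : x ∈ D <;> by_cases hy : y ∈ D
  · by_cases hseg : segment ℝ x y ⊆ D
    · exact (convex_segment x y).norm_image_sub_le_of_norm_fderiv_le (𝕜 := ℝ)
        (fun z hz => hd.differentiableAt (hD.mem_nhds (hseg hz))) (fun z hz => hM z (hseg hz))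
        (right_mem_segment ℝ x y) (left_mem_segment ℝ x y)
    · obtain ⟨z, hz, hzD⟩ := not_subset.1 hseg
      have hadd : ‖z - x‖ + ‖z - y‖ = ‖x - y‖ := by
        simpa [dist_eq_norm, norm_sub_rev] using dist_add_dist_of_mem_segment hz
      calc ‖g x - g y‖ ≤ ‖g x‖ + ‖g y‖ := norm_sub_le _ _
        _ ≤ M * ‖z - x‖ + M * ‖z - y‖ := add_le_add (hout hx hzD) (hout hy hzD)
        _ = M * ‖x - y‖ := by rw [← mul_add, hadd]
  · rw [h0 y hy, sub_zero, norm_sub_rev]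
    exact hout hx hy
  · rw [h0 x hx, zero_sub, norm_neg]
    exact hout hy hx
  · rw [h0 x hx, h0 y hy, sub_zero, norm_zero]
    positivity

end ZeroExtension

lemma continuous_mul_of_eq_zero_off {X : Type*} [TopologicalSpace X] {φ σ : X → ℝ} {D : Set X}
    {M : ℝ} (hD : IsOpen D) (hφ : Continuous φ) (h0 : ∀ x ∉ D, φ x = 0) (hσ : ContinuousOn σ D)
    (hM : ∀ x ∈ D, ‖σ x‖ ≤ M) : Continuous fun x => φ x * σ x := by
  rw [continuous_iff_continuousAt]
  intro x
  by_cases hx : x ∈ D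
  · exact hφ.continuousAt.mul (hσ.continuousAt (hD.mem_nhds hx))
  · have hbound : ∀ y, ‖φ y * σ y‖ ≤ ‖φ y‖ * M := by
      intro y
      by_cases hy : y ∈ D
      · rw [norm_mul]
        exact mul_le_mul_of_nonneg_left (hM y hy) (norm_nonneg _)
      · simp [h0 y hy]
    have hlim : Tendsto (fun y => ‖φ y‖ * M) (𝓝 x) (𝓝 0) := by
      simpa [h0 x hx] using (hφ.norm.tendsto x).mul_const M
    simpa only [ContinuousAt, h0 x hx, zero_mul] using squeeze_zero_norm hbound hlim

lemma integrableOn_of_forall_norm_le {E F : Type*} [PseudoMetricSpace E] [ProperSpace E]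
    [MeasurableSpace E] [OpensMeasurableSpace E] {μ : Measure E} [IsFiniteMeasureOnCompacts μ]
    [NormedAddCommGroup F] {D : Set E} {g : E → F} {M : ℝ} (hD : IsOpen D)
    (hDb : Bornology.IsBounded D) (hg : AEStronglyMeasurable g (μ.restrict D))
    (hM : ∀ x ∈ D, ‖g x‖ ≤ M) : IntegrableOn g D μ :=
  IntegrableOn.of_bound hDb.measure_lt_top hg M (ae_restrict_of_forall_mem hD.measurableSet hM)

section IntegrationByParts

variable {E : Type*} [NormedAddCommGroup E] [NormedSpace ℝ E] [FiniteDimensional ℝ E]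
  [MeasurableSpace E] [BorelSpace E] {μ : Measure E} [μ.IsAddHaarMeasure]

lemma ae_restrict_fderiv_eq_zero {g : E → ℝ} {s : Set E} (hs : MeasurableSet s)
    (h0 : ∀ x ∈ s, g x = 0) : ∀ᵐ x ∂(μ.restrict s), fderiv ℝ g x = 0 := by
  rcases subsingleton_or_nontrivial E with _ | _
  · exact Eventually.of_forall fun x => Subsingleton.elim _ _
  obtain ⟨e, he⟩ := exists_ne (0 : E)
  set N : Set E := {x | DifferentiableAt ℝ g x}
  have hN : MeasurableSet N := measurableSet_of_differentiableAt ℝ g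
  -- `ApproximatesLinearOn.norm_fderiv_sub_le` concerns maps from `E` to itself
  have happ : ApproximatesLinearOn (fun x => g x • e) (0 : E →L[ℝ] E) (s ∩ N) 0 := by
    intro x hx y hy
    simp [h0 x hx.1, h0 y hy.1]
  have hder := happ.norm_fderiv_sub_le μ (hs.inter hN) (fun x => (fderiv ℝ g x).smulRight e)
    fun x hx => (hx.2.hasFDerivAt.smul_const e).hasFDerivWithinAt
  rw [ae_restrict_iff' (hs.inter hN)] at hder
  rw [ae_restrict_iff' hs]
  filter_upwards [hder] with x hx hxs
  by_cases hxN : x ∈ N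
  · have hzero := hx ⟨hxs, hxN⟩
    rw [sub_zero, nonpos_iff_eq_zero, nnnorm_eq_zero] at hzero
    ext v
    simpa [he] using congrArg (fun A : E →L[ℝ] E => A v) hzero
  · exact fderiv_zero_of_not_differentiableAt hxN

variable {D : Set E}

lemma setIntegral_fderiv_eq_zero {g : E → ℝ} {M : ℝ} (hD : IsOpen D)
    (hDb : Bornology.IsBounded D) (hc : Continuous g) (h0 : ∀ x ∉ D, g x = 0)
    (hd : DifferentiableOn ℝ g D) (hM : ∀ x ∈ D, ‖fderiv ℝ g x‖ ≤ M) (v : E) :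
    ∫ x in D, fderiv ℝ g x v ∂μ = 0 := by
  have hlip : LipschitzWith (max M 0).toNNReal g :=
    lipschitzWith_of_eq_zero_off hD hc h0 hd fun x hx => by
      rw [Real.coe_toNNReal _ (le_max_right _ _)]
      exact (hM x hx).trans (le_max_left _ _)
  have hcs : HasCompactSupport g :=
    HasCompactSupport.intro hDb.isCompact_closure fun x hx => h0 x fun hxD =>
      hx (subset_closure hxD)
  have hline : ∫ x, lineDeriv ℝ g x v ∂μ = 0 := by
    simpa [lineDeriv] using (LipschitzWith.integral_lineDeriv_mul_eq (μ := μ) (C := 0)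
      (LipschitzWith.const' (1 : ℝ)) hlip hcs (-v)).symm
  have hae : (fun x => lineDeriv ℝ g x v) =ᵐ[μ] D.indicator fun x => fderiv ℝ g x v := by
    have hout := ae_restrict_fderiv_eq_zero (μ := μ) hD.measurableSet.compl h0
    rw [ae_restrict_iff' hD.measurableSet.compl] at hout
    filter_upwards [hout, hlip.ae_differentiableAt] with x hx hdx
    rw [hdx.lineDeriv_eq_fderiv]
    by_cases hxD : x ∈ D
    · rw [indicator_of_mem hxD]
    · rw [indicator_of_notMem hxD, hx hxD, zero_apply]
  rwa [integral_congr_ae hae, integral_indicator hD.measurableSet] at hline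

lemma integrableOn_fderiv_mul {p q : E → ℝ} {M A : ℝ} (hD : IsOpen D)
    (hDb : Bornology.IsBounded D) (hp : ContDiffOn ℝ 1 p D) (hq : ContinuousOn q D)
    (hp' : ∀ x ∈ D, ‖fderiv ℝ p x‖ ≤ M) (hqb : ∀ x ∈ D, ‖q x‖ ≤ A) (v : E) :
    IntegrableOn (fun x => fderiv ℝ p x v * q x) D μ := by
  refine integrableOn_of_forall_norm_le (M := M * ‖v‖ * A) hD hDb
    ((((hp.continuousOn_fderiv_of_isOpen hD le_rfl).clm_apply continuousOn_const).mul
      hq).aestronglyMeasurable hD.measurableSet) fun x hx => ?_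
  rw [norm_mul]
  exact mul_le_mul ((fderiv ℝ p x).le_of_opNorm_le (hp' x hx) v) (hqb x hx) (norm_nonneg _)
    (mul_nonneg ((norm_nonneg _).trans (hp' x hx)) (norm_nonneg _))

lemma setIntegral_fderiv_mul_eq_neg {φ σ : E → ℝ} {M : ℝ} (hD : IsOpen D)
    (hDb : Bornology.IsBounded D) (hφc : Continuous φ) (hφ0 : ∀ x ∉ D, φ x = 0)
    (hφ : ContDiffOn ℝ 1 φ D) (hσ : ContDiffOn ℝ 1 σ D)
    (hφ' : ∀ x ∈ D, ‖fderiv ℝ φ x‖ ≤ M) (hσb : ∀ x ∈ D, ‖σ x‖ ≤ M)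
    (hσ' : ∀ x ∈ D, ‖fderiv ℝ σ x‖ ≤ M) (v : E) :
    ∫ x in D, fderiv ℝ φ x v * σ x ∂μ = -∫ x in D, φ x * fderiv ℝ σ x v ∂μ := by
  obtain ⟨B, hB⟩ : ∃ B, ∀ x ∈ D, ‖φ x‖ ≤ B := by
    obtain ⟨B, hB⟩ := (hDb.isCompact_closure.image hφc).isBounded.exists_norm_le
    exact ⟨B, fun x hx => hB _ ⟨x, subset_closure hx, rfl⟩⟩
  have hφd : ∀ x ∈ D, DifferentiableAt ℝ φ x := fun x hx =>
    (hφ.differentiableOn one_ne_zero).differentiableAt (hD.mem_nhds hx)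
  have hσd : ∀ x ∈ D, DifferentiableAt ℝ σ x := fun x hx =>
    (hσ.differentiableOn one_ne_zero).differentiableAt (hD.mem_nhds hx)
  have hleib : ∀ x ∈ D, fderiv ℝ (fun x => φ x * σ x) x
      = φ x • fderiv ℝ σ x + σ x • fderiv ℝ φ x := fun x hx =>
    fderiv_fun_mul (hφd x hx) (hσd x hx)
  have hleib_bound : ∀ x ∈ D, ‖fderiv ℝ (fun x => φ x * σ x) x‖ ≤ B * M + M * M := by
    intro x hx
    rw [hleib x hx]
    refine (norm_add_le _ _).trans ?_
    rw [norm_smul, norm_smul]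
    gcongr
    exacts [(norm_nonneg _).trans (hB x hx), hB x hx, hσ' x hx,
      (norm_nonneg _).trans (hφ' x hx), hσb x hx, hφ' x hx]
  have hzero := setIntegral_fderiv_eq_zero (μ := μ) hD hDb
    (continuous_mul_of_eq_zero_off hD hφc hφ0 hσ.continuousOn hσb)
    (fun x hx => by rw [hφ0 x hx, zero_mul])
    (fun x hx => ((hφd x hx).mul (hσd x hx)).differentiableWithinAt) hleib_bound v
  have hsum : ∀ x ∈ D, fderiv ℝ (fun x => φ x * σ x) x v
      = fderiv ℝ φ x v * σ x + fderiv ℝ σ x v * φ x := by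
    intro x hx
    rw [hleib x hx]
    simp only [add_apply, smul_apply, smul_eq_mul]
    ring
  rw [setIntegral_congr_fun hD.measurableSet hsum,
    integral_add (integrableOn_fderiv_mul hD hDb hφ hσ.continuousOn hφ' hσb v)
      (integrableOn_fderiv_mul hD hDb hσ hφ.continuousOn hσ' hB v)] at hzero
  simp only [mul_comm (φ _)]
  linarith

end IntegrationByParts

lemma IsPotential.apply_zero {f : ℝ → ℝ} (hf : IsPotential f) : f 0 = 0 := by
  have h1 : Tendsto f (𝓝[>] 0) (𝓝 (f 0)) :=
    (hf.smooth.continuousOn 0 self_mem_Ici).mono_left (nhdsWithin_mono _ Ioi_subset_Ici_self)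
  have h2 : Tendsto (fun r => f r / r * r) (𝓝[>] 0) (𝓝 (halfLineDeriv f 0 * 0)) :=
    hf.slope_zero.mul (tendsto_id.mono_left nhdsWithin_le_nhds)
  rw [mul_zero] at h2
  refine tendsto_nhds_unique h1 (h2.congr' ?_)
  filter_upwards [self_mem_nhdsWithin] with r hr
  exact div_mul_cancel₀ _ (ne_of_gt hr)

lemma IsPotential.halfLineDeriv_zero_pos {f : ℝ → ℝ} (hf : IsPotential f) :
    0 < halfLineDeriv f 0 := by
  refine (hf.pos 1 one_pos).trans_le (ge_of_tendsto hf.slope_zero ?_)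
  filter_upwards [Ioc_mem_nhdsGT (zero_lt_one' ℝ)] with r hr
  have hconc := hf.concave.2 (show (0 : ℝ) ∈ Ici 0 from self_mem_Ici)
    (show (1 : ℝ) ∈ Ici 0 from zero_le_one (α := ℝ)) (sub_nonneg.2 hr.2) hr.1.le
    (sub_add_cancel 1 r)
  simp only [hf.apply_zero, smul_eq_mul, mul_zero, mul_one, zero_add] at hconc
  rw [le_div_iff₀ hr.1]
  linarith

section Isotropy

variable {d : ℕ}

lemma measurable_unitDir : Measurable (unitDir : Vec d → Vec d) := by
  unfold unitDir
  fun_prop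

lemma norm_unitDir_le (ξ : Vec d) : ‖unitDir ξ‖ ≤ 1 := by
  rw [unitDir, norm_smul, norm_inv, norm_norm]
  exact inv_mul_le_one

lemma norm_unitDir {ξ : Vec d} (h : ξ ≠ 0) : ‖unitDir ξ‖ = 1 := by
  rw [unitDir, norm_smul, norm_inv, norm_norm, inv_mul_cancel₀ (norm_ne_zero_iff.2 h)]

lemma unitDir_neg (ξ : Vec d) : unitDir (-ξ) = -unitDir ξ := by
  simp [unitDir]

lemma unitDir_smul {r : ℝ} (hr : 0 < r) (ξ : Vec d) : unitDir (r • ξ) = unitDir ξ := by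
  simp only [unitDir, norm_smul, Real.norm_eq_abs, abs_of_pos hr, smul_smul]
  congr 1
  field_simp

lemma norm_smul_unitDir (ξ : Vec d) : ‖ξ‖ • unitDir ξ = ξ := by
  by_cases h : ξ = 0
  · simp [h]
  · rw [unitDir, smul_smul, mul_inv_cancel₀ (norm_ne_zero_iff.2 h), one_smul]

lemma unitDir_linearIsometryEquiv (R : Vec d ≃ₗᵢ[ℝ] Vec d) (ξ : Vec d) :
    unitDir (R ξ) = R (unitDir ξ) := by
  simp [unitDir]

lemma abs_inner_unitDir_le (ξ v : Vec d) : |inner ℝ (unitDir ξ) v| ≤ ‖v‖ :=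
  (abs_real_inner_le_norm _ _).trans
    (mul_le_of_le_one_left (norm_nonneg _) (norm_unitDir_le ξ))

variable {J : ℝ → ℝ}

lemma IsInfluence.exists_bound (hJ : IsInfluence J) :
    ∃ M : ℝ, 0 ≤ M ∧ ∀ r, 0 ≤ r → 0 ≤ J r ∧ J r ≤ M := by
  obtain ⟨M, hM⟩ := hJ.bounded
  refine ⟨max M 0, le_max_right _ _, fun r hr => ?_⟩
  rcases le_or_gt r 1 with h | h
  · exact ⟨(hM r ⟨hr, h⟩).1, (hM r ⟨hr, h⟩).2.trans (le_max_left _ _)⟩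
  · rw [hJ.zero_outside r h]
    exact ⟨le_rfl, le_max_right _ _⟩

/-- The quartic moment `∫ J(|ξ|) |ξ| (e_ξ · v)⁴ dξ` over the unit ball; by polarization it
determines the elasticity tensor. -/
noncomputable def quarticMoment (J : ℝ → ℝ) (v : Vec d) : ℝ :=
  ∫ ξ in Metric.ball (0 : Vec d) 1, J ‖ξ‖ * inner ℝ (unitDir ξ) v ^ 4 * ‖ξ‖

lemma integrableOn_quarticMoment (hJ : IsInfluence J) (v : Vec d) :
    IntegrableOn (fun ξ : Vec d => J ‖ξ‖ * inner ℝ (unitDir ξ) v ^ 4 * ‖ξ‖)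
      (Metric.ball 0 1) := by
  obtain ⟨M, hM0, hM⟩ := hJ.exists_bound
  have hmeas : Measurable fun ξ : Vec d => J ‖ξ‖ * inner ℝ (unitDir ξ) v ^ 4 * ‖ξ‖ :=
    ((hJ.measurable.comp measurable_norm).mul
      ((measurable_unitDir.inner measurable_const).pow_const 4)).mul measurable_norm
  refine integrableOn_of_forall_norm_le (M := M * ‖v‖ ^ 4 * 1) Metric.isOpen_ball
    Metric.isBounded_ball hmeas.aestronglyMeasurable fun ξ hξ => ?_
  rw [norm_mul, norm_mul, norm_pow, norm_norm, Real.norm_eq_abs, Real.norm_eq_abs,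
    abs_of_nonneg (hM _ (norm_nonneg _)).1]
  gcongr
  exacts [(hM ‖ξ‖ (norm_nonneg _)).2, abs_inner_unitDir_le ξ v, (mem_ball_zero_iff.1 hξ).le]

lemma quarticMoment_integrand_nonneg (hJ : IsInfluence J) (v ξ : Vec d) :
    0 ≤ J ‖ξ‖ * inner ℝ (unitDir ξ) v ^ 4 * ‖ξ‖ := by
  obtain ⟨M, -, hM⟩ := hJ.exists_bound
  have := (hM ‖ξ‖ (norm_nonneg _)).1
  positivity

lemma quarticMoment_nonneg (hJ : IsInfluence J) (v : Vec d) : 0 ≤ quarticMoment J v :=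
  integral_nonneg (quarticMoment_integrand_nonneg hJ v)

lemma quarticMoment_smul (J : ℝ → ℝ) (c : ℝ) (v : Vec d) :
    quarticMoment J (c • v) = quarticMoment J v * c ^ 4 := by
  simp only [quarticMoment, inner_smul_right, ← integral_mul_const]
  congr 1 with ξ
  ring

lemma quarticMoment_linearIsometryEquiv (J : ℝ → ℝ) (R : Vec d ≃ₗᵢ[ℝ] Vec d) (v : Vec d) :
    quarticMoment J (R v) = quarticMoment J v := by
  have hball : R ⁻¹' Metric.ball 0 1 = Metric.ball 0 1 := by
    ext ξ
    simp
  rw [quarticMoment, ← R.measurePreserving.setIntegral_preimage_emb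
    R.toHomeomorph.measurableEmbedding, hball]
  simp only [quarticMoment, unitDir_linearIsometryEquiv, LinearIsometryEquiv.norm_map,
    LinearIsometryEquiv.inner_map_map]

lemma quarticMoment_eq_mul_norm_pow (J : ℝ → ℝ) {e : Vec d} (he : ‖e‖ = 1) (v : Vec d) :
    quarticMoment J v = quarticMoment J e * ‖v‖ ^ 4 := by
  have hn : ‖‖v‖ • e‖ = ‖v‖ := by rw [norm_smul, he, norm_norm, mul_one]
  -- a reflection carries `‖v‖ • e` to `v`
  rw [← Submodule.reflection_sub hn, quarticMoment_linearIsometryEquiv, quarticMoment_smul,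
    LinearIsometryEquiv.norm_map, hn]

lemma ae_eq_zero_of_quarticMoment_eq_zero (hJ : IsInfluence J)
    (h0 : ∀ v : Vec d, quarticMoment J v = 0) :
    ∀ᵐ ξ : Vec d ∂(volume.restrict (Metric.ball 0 1)), ξ ≠ 0 → J ‖ξ‖ = 0 := by
  have hcoord : ∀ i : Fin d, ∀ᵐ ξ : Vec d ∂(volume.restrict (Metric.ball 0 1)),
      J ‖ξ‖ * inner ℝ (unitDir ξ) (EuclideanSpace.single i (1 : ℝ) : Vec d) ^ 4 * ‖ξ‖ = 0 :=
    fun i => (integral_eq_zero_iff_of_nonneg (quarticMoment_integrand_nonneg hJ _)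
      (integrableOn_quarticMoment hJ _)).1 (h0 _)
  filter_upwards [ae_all_iff.2 hcoord] with ξ hξ hξ0
  by_contra hJξ
  have hdir : unitDir ξ = 0 := by
    ext i
    have hi := hξ i
    simp only [mul_eq_zero, hJξ, norm_eq_zero, hξ0, or_false, false_or] at hi
    simpa [EuclideanSpace.inner_single_right] using hi
  have hnorm := norm_unitDir hξ0
  rw [hdir, norm_zero] at hnorm
  exact zero_ne_one hnorm

lemma sum_sign_mul_pow_four (x y z w : ℝ) :
    ∑ s : ℤˣ, ∑ t : ℤˣ, ∑ r : ℤˣ, (s * t * r : ℝ) * (x + s * y + t * z + r * w) ^ 4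
      = 192 * (x * y * z * w) := by
  simp only [UnitsInt.univ, Finset.sum_pair (show (1 : ℤˣ) ≠ -1 by decide), Units.val_one,
    Units.val_neg, Int.cast_one, Int.cast_neg]
  ring

lemma sum_sign_mul_norm_pow_four {V : Type*} [NormedAddCommGroup V] [InnerProductSpace ℝ V]
    (x y z w : V) :
    ∑ s : ℤˣ, ∑ t : ℤˣ, ∑ r : ℤˣ,
        (s * t * r : ℝ) * ‖x + (s : ℝ) • y + (t : ℝ) • z + (r : ℝ) • w‖ ^ 4
      = 64 * (inner ℝ x y * inner ℝ z w + inner ℝ x z * inner ℝ y w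
        + inner ℝ x w * inner ℝ y z) := by
  have hsq : ∀ s t r : ℝ, ‖x + s • y + t • z + r • w‖ ^ 2 = ‖x‖ ^ 2 + s ^ 2 * ‖y‖ ^ 2
      + t ^ 2 * ‖z‖ ^ 2 + r ^ 2 * ‖w‖ ^ 2 + 2 * (s * inner ℝ x y + t * inner ℝ x z
      + r * inner ℝ x w + s * t * inner ℝ y z + s * r * inner ℝ y w + t * r * inner ℝ z w) := by
    intro s t r
    simp only [norm_add_sq_real, inner_add_left, inner_smul_left, inner_smul_right, norm_smul,
      conj_trivial, mul_pow, Real.norm_eq_abs, sq_abs]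
    ring
  have hpow : ∀ u : V, ‖u‖ ^ 4 = (‖u‖ ^ 2) ^ 2 := fun u => by rw [← pow_mul]
  simp only [hpow, hsq, UnitsInt.univ, Finset.sum_pair (show (1 : ℤˣ) ≠ -1 by decide),
    Units.val_one, Units.val_neg, Int.cast_one, Int.cast_neg]
  ring

lemma integral_inner_unitDir_mul (hJ : IsInfluence J) (a b c g : Vec d) :
    192 * ∫ ξ in Metric.ball (0 : Vec d) 1, J ‖ξ‖ * (inner ℝ (unitDir ξ) a *
        inner ℝ (unitDir ξ) b * inner ℝ (unitDir ξ) c * inner ℝ (unitDir ξ) g) * ‖ξ‖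
      = ∑ s : ℤˣ, ∑ t : ℤˣ, ∑ r : ℤˣ,
        (s * t * r : ℝ) * quarticMoment J (a + (s : ℝ) • b + (t : ℝ) • c + (r : ℝ) • g) := by
  have hI : ∀ (q : ℝ) (v : Vec d), IntegrableOn
      (fun ξ : Vec d => q * (J ‖ξ‖ * inner ℝ (unitDir ξ) v ^ 4 * ‖ξ‖)) (Metric.ball 0 1) :=
    fun q v => (integrableOn_quarticMoment hJ v).const_mul q
  simp only [quarticMoment, ← integral_const_mul]
  simp only [← integral_finsetSum _ fun _ _ => hI _ _,
    ← integral_finsetSum _ fun _ _ => integrable_finsetSum _ fun _ _ => hI _ _,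
    ← integral_finsetSum _ fun _ _ => integrable_finsetSum _ fun _ _ =>
      integrable_finsetSum _ fun _ _ => hI _ _]
  congr 1 with ξ
  have hpol := sum_sign_mul_pow_four (inner ℝ (unitDir ξ) a) (inner ℝ (unitDir ξ) b)
    (inner ℝ (unitDir ξ) c) (inner ℝ (unitDir ξ) g)
  simp only [inner_add_right, inner_smul_right]
  calc 192 * (J ‖ξ‖ * (inner ℝ (unitDir ξ) a * inner ℝ (unitDir ξ) b * inner ℝ (unitDir ξ) c *
        inner ℝ (unitDir ξ) g) * ‖ξ‖) = J ‖ξ‖ * ‖ξ‖ * (192 * (inner ℝ (unitDir ξ) a *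
        inner ℝ (unitDir ξ) b * inner ℝ (unitDir ξ) c * inner ℝ (unitDir ξ) g)) := by ring
    _ = _ := by
      simp only [← hpol, Finset.mul_sum]
      refine Finset.sum_congr rfl fun s _ => Finset.sum_congr rfl fun t _ =>
        Finset.sum_congr rfl fun r _ => ?_
      ring

lemma integral_inner_unitDir_mul_eq (hJ : IsInfluence J) {e : Vec d} (he : ‖e‖ = 1)
    (a b c g : Vec d) :
    ∫ ξ in Metric.ball (0 : Vec d) 1, J ‖ξ‖ * (inner ℝ (unitDir ξ) a * inner ℝ (unitDir ξ) b *
        inner ℝ (unitDir ξ) c * inner ℝ (unitDir ξ) g) * ‖ξ‖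
      = quarticMoment J e / 3 * (inner ℝ a b * inner ℝ c g + inner ℝ a c * inner ℝ b g
        + inner ℝ a g * inner ℝ b c) := by
  have hpol := integral_inner_unitDir_mul hJ a b c g
  simp only [quarticMoment_eq_mul_norm_pow J he (_ + _), mul_left_comm _ (quarticMoment J e),
    ← Finset.mul_sum, sum_sign_mul_norm_pow_four] at hpol
  linarith

/-- The elasticity tensor is isotropic with both Lamé constants equal to `β`. -/
def IsIsotropic (d : ℕ) (f J : ℝ → ℝ) (β : ℝ) : Prop :=
  ∀ i j k l : Fin d, elasticTensor d f J i j k l =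
    β * ((if i = j then 1 else 0) * (if k = l then 1 else 0)
      + (if i = k then 1 else 0) * (if j = l then 1 else 0)
      + (if i = l then 1 else 0) * (if j = k then 1 else 0))

lemma isIsotropic_of_quarticMoment (f : ℝ → ℝ) (hJ : IsInfluence J) {e : Vec d} (he : ‖e‖ = 1) :
    IsIsotropic d f J (2 * halfLineDeriv f 0 / unitBallVolume d * (quarticMoment J e / 3)) := by
  intro i j k l
  have hmoment := integral_inner_unitDir_mul_eq hJ he (EuclideanSpace.single i 1)
    (EuclideanSpace.single j 1) (EuclideanSpace.single k 1) (EuclideanSpace.single l 1)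
  simp only [EuclideanSpace.inner_single_right, PiLp.single_apply, conj_trivial, one_mul,
    @eq_comm (Fin d) j i, @eq_comm (Fin d) l k, @eq_comm (Fin d) k i, @eq_comm (Fin d) l j,
    @eq_comm (Fin d) l i, @eq_comm (Fin d) k j] at hmoment
  rw [elasticTensor, hmoment, mul_assoc]

lemma unitBallVolume_pos (d : ℕ) : 0 < unitBallVolume d :=
  ENNReal.toReal_pos (Metric.measure_ball_pos volume _ one_pos).ne' measure_ball_lt_top.ne

lemma exists_isIsotropic (hd : 0 < d) {f : ℝ → ℝ} (hf0 : 0 < halfLineDeriv f 0)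
    (hJ : IsInfluence J) :
    ∃ β : ℝ, 0 ≤ β ∧ IsIsotropic d f J β ∧
      (β = 0 → ∀ᵐ ξ : Vec d ∂(volume.restrict (Metric.ball 0 1)), ξ ≠ 0 → J ‖ξ‖ = 0) := by
  have he : ‖(EuclideanSpace.single ⟨0, hd⟩ 1 : Vec d)‖ = 1 := by simp
  have hω := unitBallVolume_pos d
  have hκ := quarticMoment_nonneg hJ (EuclideanSpace.single ⟨0, hd⟩ 1 : Vec d)
  refine ⟨_, by positivity, isIsotropic_of_quarticMoment f hJ he, fun h0 => ?_⟩
  have hκ0 : quarticMoment J (EuclideanSpace.single ⟨0, hd⟩ 1 : Vec d) = 0 := by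
    simpa [hf0.ne', hω.ne'] using h0
  exact ae_eq_zero_of_quarticMoment_eq_zero hJ fun v => by
    rw [quarticMoment_eq_mul_norm_pow J he, hκ0, zero_mul]

end Isotropy

section Elasticity

variable {d : ℕ} {v w : Vec d → Vec d} {x : Vec d}

/-- The `k`-th component of `∂_a ∂_b v`. -/
noncomputable def secondPartial (a b : Fin d) (v : Vec d → Vec d) (x : Vec d) (k : Fin d) : ℝ :=
  fderiv ℝ (fderiv ℝ v) x (EuclideanSpace.single a 1) (EuclideanSpace.single b 1) k

lemma norm_apply_single_le {F : Type*} [NormedAddCommGroup F] [NormedSpace ℝ F]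
    (A : Vec d →L[ℝ] F) (j : Fin d) : ‖A (EuclideanSpace.single j 1)‖ ≤ ‖A‖ := by
  simpa using A.le_opNorm (EuclideanSpace.single j 1)

lemma norm_partialDeriv_apply_le (v : Vec d → Vec d) (x : Vec d) (j i : Fin d) :
    ‖partialDeriv j v x i‖ ≤ ‖fderiv ℝ v x‖ :=
  (PiLp.norm_apply_le _ i).trans (norm_apply_single_le _ j)

lemma norm_secondPartial_le (v : Vec d → Vec d) (x : Vec d) (a b k : Fin d) :
    ‖secondPartial a b v x k‖ ≤ ‖fderiv ℝ (fderiv ℝ v) x‖ :=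
  (PiLp.norm_apply_le _ k).trans ((norm_apply_single_le _ b).trans (norm_apply_single_le _ a))

lemma secondPartial_comm (hv : ContDiffAt ℝ 2 v x) (a b k : Fin d) :
    secondPartial a b v x k = secondPartial b a v x k := by
  rw [secondPartial, (hv.isSymmSndFDerivAt (by simp)).eq, secondPartial]

lemma differentiableAt_fderiv_of_contDiffAt {E F : Type*} [NormedAddCommGroup E]
    [NormedSpace ℝ E] [NormedAddCommGroup F] [NormedSpace ℝ F] {v : E → F} {x : E}
    (hv : ContDiffAt ℝ 2 v x) : DifferentiableAt ℝ (fderiv ℝ v) x :=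
  (hv.fderiv_right (m := 1) (by norm_num)).differentiableAt one_ne_zero

lemma hasFDerivAt_partialDeriv (hv : ContDiffAt ℝ 2 v x) (l k : Fin d) :
    HasFDerivAt (fun z => partialDeriv l v z k)
      ((EuclideanSpace.proj k : Vec d →L[ℝ] ℝ).comp
        ((fderiv ℝ (fderiv ℝ v) x).flip (EuclideanSpace.single l 1))) x := by
  have hpartial : HasFDerivAt (fun z => fderiv ℝ v z (EuclideanSpace.single l 1))
      ((fderiv ℝ (fderiv ℝ v) x).flip (EuclideanSpace.single l 1)) x := by
    simpa using (differentiableAt_fderiv_of_contDiffAt hv).hasFDerivAt.clm_apply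
      (hasFDerivAt_const (EuclideanSpace.single l (1 : ℝ) : Vec d) x)
  exact (EuclideanSpace.proj k : Vec d →L[ℝ] ℝ).hasFDerivAt.comp x hpartial

lemma hasFDerivAt_strain (hv : ContDiffAt ℝ 2 v x) (k l : Fin d) :
    HasFDerivAt (fun z => strain v z k l)
      ((2 : ℝ)⁻¹ • ((EuclideanSpace.proj k : Vec d →L[ℝ] ℝ).comp
        ((fderiv ℝ (fderiv ℝ v) x).flip (EuclideanSpace.single l 1)) +
        (EuclideanSpace.proj l : Vec d →L[ℝ] ℝ).comp
        ((fderiv ℝ (fderiv ℝ v) x).flip (EuclideanSpace.single k 1)))) x :=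
  ((hasFDerivAt_partialDeriv hv l k).add (hasFDerivAt_partialDeriv hv k l)).mul_const (2 : ℝ)⁻¹

lemma partialDeriv_strain (hv : ContDiffAt ℝ 2 v x) (j k l : Fin d) :
    partialDeriv j (fun z => strain v z k l) x
      = (secondPartial j l v x k + secondPartial j k v x l) / 2 := by
  rw [partialDeriv, (hasFDerivAt_strain hv k l).fderiv]
  simp [secondPartial, div_eq_inv_mul, mul_add]

lemma elasticTensor_swap (f J : ℝ → ℝ) (i j k l : Fin d) :
    elasticTensor d f J i j k l = elasticTensor d f J i j l k := by
  simp only [elasticTensor, mul_right_comm _ (unitDir _ k) (unitDir _ l)]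

lemma elasticForce_apply (f J : ℝ → ℝ) (hv : ContDiffAt ℝ 2 v x) (i : Fin d) :
    elasticForce f J v x i =
      ∑ j, ∑ k, ∑ l, elasticTensor d f J i j k l * secondPartial j l v x k := by
  simp only [elasticForce]
  refine Finset.sum_congr rfl fun j _ => ?_
  have hterm : ∀ k l, HasFDerivAt (fun z => elasticTensor d f J i j k l * strain v z k l)
      (elasticTensor d f J i j k l • fderiv ℝ (fun z => strain v z k l) x) x := fun k l =>
    (hasFDerivAt_strain hv k l).differentiableAt.hasFDerivAt.const_mul _
  have hstress : HasFDerivAt (fun z => stress f J v z i j)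
      (∑ k, ∑ l, elasticTensor d f J i j k l • fderiv ℝ (fun z => strain v z k l) x) x :=
    HasFDerivAt.fun_sum fun k _ => HasFDerivAt.fun_sum fun l _ => hterm k l
  have hhalf : ∀ k l, elasticTensor d f J i j k l * partialDeriv j (fun z => strain v z k l) x
      = elasticTensor d f J i j k l * secondPartial j l v x k / 2
        + elasticTensor d f J i j l k * secondPartial j k v x l / 2 := by
    intro k l
    rw [partialDeriv_strain hv, elasticTensor_swap f J i j l k]
    ring
  calc partialDeriv j (fun z => stress f J v z i j) x
      = ∑ k, ∑ l, elasticTensor d f J i j k l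
          * partialDeriv j (fun z => strain v z k l) x := by
        simp only [partialDeriv, hstress.fderiv, sum_apply, smul_apply, smul_eq_mul]
    _ = _ := by
        simp only [hhalf, Finset.sum_add_distrib]
        rw [Finset.sum_comm (f := fun k l => elasticTensor d f J i j l k *
          secondPartial j k v x l / 2), ← Finset.sum_add_distrib]
        simp only [← Finset.sum_add_distrib, add_halves]

variable {f J : ℝ → ℝ} {β : ℝ}

lemma IsIsotropic.sum_mul (hC : IsIsotropic d f J β) (A : Fin d → Fin d → ℝ) (i j : Fin d) :
    ∑ k, ∑ l, elasticTensor d f J i j k l * A k l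
      = β * ((if i = j then ∑ k, A k k else 0) + A i j + A j i) := by
  simp only [hC i j, mul_assoc, ← Finset.mul_sum]
  congr 1
  simp only [add_mul, Finset.sum_add_distrib, ite_mul, one_mul, zero_mul,
    Finset.sum_ite_eq, Finset.mem_univ, if_true, Finset.sum_ite_irrel, Finset.sum_const_zero]

lemma IsIsotropic.elasticForce_apply (hC : IsIsotropic d f J β) (hv : ContDiffAt ℝ 2 v x)
    (i : Fin d) :
    elasticForce f J v x i = β * ∑ j, (secondPartial i j v x j + secondPartial j j v x i
      + secondPartial j i v x j) := by
  rw [Peridynamics.elasticForce_apply f J hv i]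
  simp only [fun j => hC.sum_mul (fun k l => secondPartial j l v x k) i j, ← Finset.mul_sum,
    Finset.sum_add_distrib, Finset.sum_ite_eq, Finset.mem_univ, if_true]

/-- The density `(div v)(div w) + ∇v : ∇w + ∇v : ∇wᵀ`; multiplied by the Lamé constant it is the
polarization of the elastic energy density. -/
noncomputable def energyPairing (v w : Vec d → Vec d) (x : Vec d) : ℝ :=
  ∑ i, ∑ j, (partialDeriv j w x j * partialDeriv i v x i
    + partialDeriv j w x i * partialDeriv j v x i + partialDeriv j w x i * partialDeriv i v x j)

lemma energyPairing_comm (v w : Vec d → Vec d) (x : Vec d) :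
    energyPairing v w x = energyPairing w v x := by
  simp only [energyPairing, Finset.sum_add_distrib]
  congr 1
  · congr 1
    · rw [Finset.sum_comm]
      simp only [mul_comm]
    · simp only [mul_comm]
  · rw [Finset.sum_comm]
    simp only [mul_comm]

lemma energyPairing_self (v : Vec d → Vec d) (x : Vec d) :
    energyPairing v v x = (∑ i, partialDeriv i v x i) ^ 2
      + 2 * ∑ i, ∑ j, strain v x i j ^ 2 := by
  have hsq : ∀ i j, strain v x i j ^ 2 = 4⁻¹ * (partialDeriv j v x i * partialDeriv j v x i
      + partialDeriv i v x j * partialDeriv i v x j)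
      + 2⁻¹ * (partialDeriv j v x i * partialDeriv i v x j) := by
    intro i j
    rw [strain]
    ring
  simp only [hsq, energyPairing, Finset.sum_add_distrib, ← Finset.mul_sum]
  rw [Finset.sum_comm (f := fun i j => partialDeriv i v x j * partialDeriv i v x j), sq,
    Finset.sum_mul_sum]
  simp only [mul_comm (partialDeriv _ v x _) (partialDeriv _ v x _)]
  ring

lemma energyPairing_self_nonneg (v : Vec d → Vec d) (x : Vec d) : 0 ≤ energyPairing v v x := by
  rw [energyPairing_self]
  positivity

lemma IsIsotropic.elasticDensity_eq (hC : IsIsotropic d f J β) (v : Vec d → Vec d) (x : Vec d) :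
    elasticDensity f J v x = β * energyPairing v v x := by
  have hstress : ∀ i j, strain v x i j * stress f J v x i j
      = β * ((if i = j then strain v x i i * ∑ k, strain v x k k else 0)
        + 2 * strain v x i j ^ 2) := by
    intro i j
    have hsymm : strain v x j i = strain v x i j := by rw [strain, strain, add_comm]
    rw [stress, hC.sum_mul, hsymm]
    split_ifs with hij
    · subst hij
      ring
    · ring
  have htrace : ∀ i, strain v x i i = partialDeriv i v x i := fun i => add_self_div_two _
  simp only [elasticDensity, hstress, energyPairing_self, ← Finset.mul_sum,
    Finset.sum_add_distrib, Finset.sum_ite_eq, Finset.mem_univ, if_true, htrace]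
  rw [sq, Finset.sum_mul]

end Elasticity

section Dirichlet

variable {d : ℕ} {D : Set (Vec d)} {v w : Vec d → Vec d}

/-- The fields to which Green's formula and Korn's inequality apply without any regularity of
`∂D`: continuous on the whole space, zero off the open set `D`, and `C²` with bounded
derivatives in `D`. -/
structure IsDirichletField (D : Set (Vec d)) (v : Vec d → Vec d) : Prop where
  continuous : Continuous v
  zero_off : ∀ x, x ∉ D → v x = 0
  contDiffOn : ContDiffOn ℝ 2 v D
  bound : ∃ M, ∀ x ∈ D, ‖fderiv ℝ v x‖ ≤ M ∧ ‖fderiv ℝ (fderiv ℝ v) x‖ ≤ M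

lemma IsDirichletField.contDiffAt (hv : IsDirichletField D v) (hD : IsOpen D) {x : Vec d}
    (hx : x ∈ D) : ContDiffAt ℝ 2 v x :=
  hv.contDiffOn.contDiffAt (hD.mem_nhds hx)

lemma IsDirichletField.exists_bound (hv : IsDirichletField D v) (hDb : Bornology.IsBounded D) :
    ∃ M, 0 ≤ M ∧ ∀ x ∈ D, ‖v x‖ ≤ M ∧ ‖fderiv ℝ v x‖ ≤ M ∧ ‖fderiv ℝ (fderiv ℝ v) x‖ ≤ M := by
  obtain ⟨M, hM⟩ := hv.bound
  obtain ⟨B, hB⟩ := (hDb.isCompact_closure.image hv.continuous).isBounded.exists_norm_le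
  have hMB : M ≤ max (max M B) 0 := (le_max_left _ _).trans (le_max_left _ _)
  have hBM : B ≤ max (max M B) 0 := (le_max_right _ _).trans (le_max_left _ _)
  exact ⟨max (max M B) 0, le_max_right _ _, fun x hx =>
    ⟨(hB _ ⟨x, subset_closure hx, rfl⟩).trans hBM, (hM x hx).1.trans hMB, (hM x hx).2.trans hMB⟩⟩

lemma continuousOn_fderiv_fderiv {E F : Type*} [NormedAddCommGroup E] [NormedSpace ℝ E]
    [NormedAddCommGroup F] [NormedSpace ℝ F] {D : Set E} {v : E → F} (hD : IsOpen D)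
    (hv : ContDiffOn ℝ 2 v D) : ContinuousOn (fderiv ℝ (fderiv ℝ v)) D :=
  (hv.fderiv_of_isOpen hD (m := 1) (by norm_num)).continuousOn_fderiv_of_isOpen hD le_rfl

lemma contDiffOn_partialDeriv (hD : IsOpen D) (hv : ContDiffOn ℝ 2 v D) (j i : Fin d) :
    ContDiffOn ℝ 1 (fun x => partialDeriv j v x i) D :=
  (EuclideanSpace.proj i : Vec d →L[ℝ] ℝ).contDiff.comp_contDiffOn
    ((hv.fderiv_of_isOpen hD (m := 1) (by norm_num)).clm_apply contDiffOn_const)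

lemma continuousOn_secondPartial (hD : IsOpen D) (hv : ContDiffOn ℝ 2 v D) (a b k : Fin d) :
    ContinuousOn (fun x => secondPartial a b v x k) D :=
  (EuclideanSpace.proj k : Vec d →L[ℝ] ℝ).continuous.comp_continuousOn
    (((continuousOn_fderiv_fderiv hD hv).clm_apply continuousOn_const).clm_apply
      continuousOn_const)

lemma integrableOn_partialDeriv_mul (hD : IsOpen D) (hDb : Bornology.IsBounded D)
    (hv : IsDirichletField D v) (hw : IsDirichletField D w) (a b k l : Fin d) :
    IntegrableOn (fun x => partialDeriv a w x k * partialDeriv b v x l) D := by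
  obtain ⟨M, -, hM⟩ := hv.exists_bound hDb
  obtain ⟨N, hN0, hN⟩ := hw.exists_bound hDb
  refine integrableOn_of_forall_norm_le (M := N * M) hD hDb
    (((contDiffOn_partialDeriv hD hw.contDiffOn a k).continuousOn.mul
      (contDiffOn_partialDeriv hD hv.contDiffOn b l).continuousOn).aestronglyMeasurable
      hD.measurableSet) fun x hx => ?_
  rw [norm_mul]
  exact mul_le_mul ((norm_partialDeriv_apply_le w x a k).trans (hN x hx).2.1)
    ((norm_partialDeriv_apply_le v x b l).trans (hM x hx).2.1) (norm_nonneg _) hN0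

lemma integrableOn_mul_secondPartial (hD : IsOpen D) (hDb : Bornology.IsBounded D)
    (hv : IsDirichletField D v) (hw : IsDirichletField D w) (a b k l : Fin d) :
    IntegrableOn (fun x => w x k * secondPartial a b v x l) D := by
  obtain ⟨M, -, hM⟩ := hv.exists_bound hDb
  obtain ⟨N, hN0, hN⟩ := hw.exists_bound hDb
  refine integrableOn_of_forall_norm_le (M := N * M) hD hDb
    ((((EuclideanSpace.proj k : Vec d →L[ℝ] ℝ).continuous.comp hw.continuous).continuousOn.mul
      (continuousOn_secondPartial hD hv.contDiffOn a b l)).aestronglyMeasurable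
      hD.measurableSet) fun x hx => ?_
  rw [norm_mul]
  exact mul_le_mul ((PiLp.norm_apply_le _ k).trans (hN x hx).1)
    ((norm_secondPartial_le v x a b l).trans (hM x hx).2.2) (norm_nonneg _) hN0

lemma norm_proj_comp_le {E : Type*} [NormedAddCommGroup E] [NormedSpace ℝ E]
    (A : E →L[ℝ] Vec d) (k : Fin d) :
    ‖(EuclideanSpace.proj k : Vec d →L[ℝ] ℝ).comp A‖ ≤ ‖A‖ :=
  ContinuousLinearMap.opNorm_le_bound _ (norm_nonneg _) fun y =>
    (PiLp.norm_apply_le _ k).trans (A.le_opNorm y)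

lemma setIntegral_partialDeriv_mul_eq_neg (hD : IsOpen D) (hDb : Bornology.IsBounded D)
    (hv : IsDirichletField D v) (hw : IsDirichletField D w) (a b k l : Fin d) :
    ∫ x in D, partialDeriv a w x k * partialDeriv b v x l
      = -∫ x in D, w x k * secondPartial a b v x l := by
  obtain ⟨M, -, hM⟩ := hv.exists_bound hDb
  obtain ⟨N, -, hN⟩ := hw.exists_bound hDb
  let π : Fin d → Vec d →L[ℝ] ℝ := fun i => EuclideanSpace.proj i
  have hwd : ∀ x ∈ D, fderiv ℝ (fun z => w z k) x = (π k).comp (fderiv ℝ w x) := fun x hx =>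
    ((π k).hasFDerivAt.comp x
      ((hw.contDiffAt hD hx).differentiableAt two_ne_zero).hasFDerivAt).fderiv
  have hvd : ∀ x ∈ D, fderiv ℝ (fun z => partialDeriv b v z l) x
      = (π l).comp ((fderiv ℝ (fderiv ℝ v) x).flip (EuclideanSpace.single b 1)) := fun x hx =>
    (hasFDerivAt_partialDeriv (hv.contDiffAt hD hx) b l).fderiv
  have hibp := setIntegral_fderiv_mul_eq_neg (μ := volume) (φ := fun z => w z k)
    (σ := fun z => partialDeriv b v z l) (M := max M N) hD hDb
    ((π k).continuous.comp hw.continuous) (fun x hx => by simp [hw.zero_off x hx])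
    ((π k).contDiff.comp_contDiffOn (hw.contDiffOn.of_le (by norm_num)))
    (contDiffOn_partialDeriv hD hv.contDiffOn b l)
    (fun x hx => by
      rw [hwd x hx]
      exact (norm_proj_comp_le _ k).trans ((hN x hx).2.1.trans (le_max_right _ _)))
    (fun x hx => (norm_partialDeriv_apply_le v x b l).trans
      ((hM x hx).2.1.trans (le_max_left _ _)))
    (fun x hx => by
      rw [hvd x hx]
      refine (norm_proj_comp_le _ l).trans ((norm_apply_single_le _ b).trans ?_)
      rw [ContinuousLinearMap.opNorm_flip]
      exact (hM x hx).2.2.trans (le_max_left _ _))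
    (EuclideanSpace.single a 1)
  calc ∫ x in D, partialDeriv a w x k * partialDeriv b v x l
      = ∫ x in D, fderiv ℝ (fun z => w z k) x (EuclideanSpace.single a 1)
          * partialDeriv b v x l :=
        setIntegral_congr_fun hD.measurableSet fun x hx => by simp only [hwd x hx]; rfl
    _ = _ := hibp
    _ = -∫ x in D, w x k * secondPartial a b v x l :=
        congrArg Neg.neg <| setIntegral_congr_fun hD.measurableSet fun x hx => by
          simp only [hvd x hx]; rfl

lemma integral_sum_sum {X : Type*} [MeasurableSpace X] {μ : Measure X} {ι κ : Type*}
    {s : Finset ι} {t : Finset κ} {F : ι → κ → X → ℝ} (hF : ∀ i j, Integrable (F i j) μ) :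
    ∫ x, ∑ i ∈ s, ∑ j ∈ t, F i j x ∂μ = ∑ i ∈ s, ∑ j ∈ t, ∫ x, F i j x ∂μ := by
  rw [integral_finsetSum _ fun i _ => integrable_finsetSum _ fun j _ => hF i j]
  exact Finset.sum_congr rfl fun i _ => integral_finsetSum _ fun j _ => hF i j

lemma integral_sum_sum_add_add {X : Type*} [MeasurableSpace X] {μ : Measure X} {ι κ : Type*}
    {s : Finset ι} {t : Finset κ} {F G H : ι → κ → X → ℝ} (hF : ∀ i j, Integrable (F i j) μ)
    (hG : ∀ i j, Integrable (G i j) μ) (hH : ∀ i j, Integrable (H i j) μ) :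
    ∫ x, ∑ i ∈ s, ∑ j ∈ t, (F i j x + G i j x + H i j x) ∂μ = ∑ i ∈ s, ∑ j ∈ t,
      ((∫ x, F i j x ∂μ) + (∫ x, G i j x ∂μ) + ∫ x, H i j x ∂μ) := by
  have hFG : ∀ i j, Integrable (fun x => F i j x + G i j x) μ := fun i j => (hF i j).add (hG i j)
  rw [integral_sum_sum (F := fun i j x => F i j x + G i j x + H i j x)
    fun i j => (hFG i j).add (hH i j)]
  refine Finset.sum_congr rfl fun i _ => Finset.sum_congr rfl fun j _ => ?_
  rw [integral_add (hFG i j) (hH i j), integral_add (hF i j) (hG i j)]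

lemma integrableOn_energyPairing (hD : IsOpen D) (hDb : Bornology.IsBounded D)
    (hv : IsDirichletField D v) (hw : IsDirichletField D w) :
    IntegrableOn (energyPairing v w) D := by
  have hI := integrableOn_partialDeriv_mul hD hDb hv hw
  exact integrable_finsetSum _ fun i _ => integrable_finsetSum _ fun j _ =>
    ((hI j i j i).add (hI j j i i)).add (hI j i i j)

lemma integral_energyPairing (hD : IsOpen D) (hDb : Bornology.IsBounded D)
    (hv : IsDirichletField D v) (hw : IsDirichletField D w) :
    ∫ x in D, energyPairing v w x = -∑ i, ∑ j, ((∫ x in D, w x i * secondPartial i j v x j)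
      + (∫ x in D, w x i * secondPartial j j v x i)
      + ∫ x in D, w x i * secondPartial j i v x j) := by
  have hI := integrableOn_partialDeriv_mul hD hDb hv hw
  simp only [energyPairing]
  rw [integral_sum_sum_add_add (fun i j => hI j i j i) (fun i j => hI j j i i)
    (fun i j => hI j i i j)]
  simp only [setIntegral_partialDeriv_mul_eq_neg hD hDb hv hw, Finset.sum_add_distrib,
    Finset.sum_neg_distrib]
  rw [Finset.sum_comm (f := fun i j => ∫ x in D, w x j * secondPartial j i v x i)]
  ring

lemma IsIsotropic.mul_integral_energyPairing {f J : ℝ → ℝ} {β : ℝ} (hC : IsIsotropic d f J β)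
    (hD : IsOpen D) (hDb : Bornology.IsBounded D)
    (hv : IsDirichletField D v) (hw : IsDirichletField D w) :
    β * ∫ x in D, energyPairing v w x = -∫ x in D, inner ℝ (elasticForce f J v x) (w x) := by
  have hK := integrableOn_mul_secondPartial hD hDb hv hw
  have hforce : ∀ x ∈ D, inner ℝ (elasticForce f J v x) (w x)
      = β * ∑ i, ∑ j, (w x i * secondPartial i j v x j + w x i * secondPartial j j v x i
        + w x i * secondPartial j i v x j) := by
    intro x hx
    simp only [PiLp.inner_apply, hC.elasticForce_apply (hv.contDiffAt hD hx),
      RCLike.inner_apply, conj_trivial, Finset.mul_sum]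
    refine Finset.sum_congr rfl fun i _ => Finset.sum_congr rfl fun j _ => ?_
    ring
  rw [setIntegral_congr_fun hD.measurableSet hforce, integral_const_mul,
    integral_energyPairing hD hDb hv hw, integral_sum_sum_add_add (fun i j => hK i j i j)
      (fun i j => hK j j i i) (fun i j => hK j i i j), mul_neg]

lemma gradSq_eq (v : Vec d → Vec d) (x : Vec d) :
    gradSq v x = ∑ i, ∑ j, partialDeriv j v x i * partialDeriv j v x i := by
  rw [Finset.sum_comm]
  simp only [gradSq, EuclideanSpace.real_norm_sq_eq]
  simp only [sq]

lemma integrableOn_gradSq (hD : IsOpen D) (hDb : Bornology.IsBounded D)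
    (hv : IsDirichletField D v) : IntegrableOn (gradSq v) D := by
  have hI := integrableOn_partialDeriv_mul hD hDb hv hv
  rw [show gradSq v = _ from funext (gradSq_eq v)]
  exact integrable_finsetSum _ fun i _ => integrable_finsetSum _ fun j _ => hI j j i i

lemma integral_partialDeriv_mul_swap (hD : IsOpen D) (hDb : Bornology.IsBounded D)
    (hv : IsDirichletField D v) (i j : Fin d) :
    ∫ x in D, partialDeriv j v x i * partialDeriv i v x j
      = ∫ x in D, partialDeriv j v x j * partialDeriv i v x i := by
  simp only [mul_comm (partialDeriv j v _ j)]
  rw [setIntegral_partialDeriv_mul_eq_neg hD hDb hv hv,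
    setIntegral_partialDeriv_mul_eq_neg hD hDb hv hv]
  congr 1
  exact setIntegral_congr_fun hD.measurableSet fun x hx => by
    simp only [secondPartial_comm (hv.contDiffAt hD hx) i j]

/-- Korn's inequality. Integrating by parts twice turns `∫ ∇v : ∇vᵀ` into `∫ (div v)²`. -/
lemma integral_gradSq_le (hD : IsOpen D) (hDb : Bornology.IsBounded D)
    (hv : IsDirichletField D v) : ∫ x in D, gradSq v x ≤ ∫ x in D, energyPairing v v x := by
  have hI := integrableOn_partialDeriv_mul hD hDb hv hv
  have hdiv : ∀ x, (∑ i, partialDeriv i v x i) ^ 2 =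
      ∑ i, ∑ j, partialDeriv j v x j * partialDeriv i v x i := fun x => by
    rw [sq, Finset.sum_mul_sum, Finset.sum_comm]
  have hkorn : ∫ x in D, energyPairing v v x = (∫ x in D, gradSq v x) +
      2 * ∫ x in D, (∑ i, partialDeriv i v x i) ^ 2 := by
    simp only [hdiv, gradSq_eq, energyPairing]
    rw [integral_sum_sum fun i j => hI j j i i, integral_sum_sum fun i j => hI j i j i,
      integral_sum_sum_add_add (fun i j => hI j i j i) (fun i j => hI j j i i)
        (fun i j => hI j i i j)]
    simp only [Finset.sum_add_distrib]
    rw [Finset.sum_congr rfl fun i _ => Finset.sum_congr rfl fun j _ =>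
      integral_partialDeriv_mul_swap hD hDb hv i j]
    ring
  have hdiv_nonneg : 0 ≤ ∫ x in D, (∑ i, partialDeriv i v x i) ^ 2 :=
    integral_nonneg fun x => sq_nonneg _
  linarith

end Dirichlet

section Taylor

variable {E F : Type*} [NormedAddCommGroup E] [NormedSpace ℝ E]
  [NormedAddCommGroup F] [NormedSpace ℝ F] {B : ℝ}

lemma norm_image_add_sub_sub_fderiv_le {g : E → F} (hB : 0 ≤ B) (hg : Differentiable ℝ g)
    (hlip : ∀ y y', ‖fderiv ℝ g y - fderiv ℝ g y'‖ ≤ B * ‖y - y'‖) (x z : E) :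
    ‖g (x + z) - g x - fderiv ℝ g x z‖ ≤ B * ‖z‖ ^ 2 := by
  have hball : ∀ y ∈ Metric.closedBall x ‖z‖, ‖fderiv ℝ g y - fderiv ℝ g x‖ ≤ B * ‖z‖ :=
    fun y hy => (hlip y x).trans (mul_le_mul_of_nonneg_left (mem_closedBall_iff_norm.1 hy) hB)
  have h := (convex_closedBall x ‖z‖).norm_image_sub_le_of_norm_fderiv_le' (𝕜 := ℝ)
    (fun y _ => hg y) hball (Metric.mem_closedBall_self (norm_nonneg z))
    (y := x + z) (by simp)
  rw [add_sub_cancel_left] at h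
  linarith

lemma norm_image_add_sub_image_sub_sub_fderiv_le {g : E → F} (hB : 0 ≤ B)
    (hg : Differentiable ℝ g)
    (hlip : ∀ y y', ‖fderiv ℝ g y - fderiv ℝ g y'‖ ≤ B * ‖y - y'‖) (x z : E) :
    ‖g (x + z) - g (x - z) - (2 : ℝ) • fderiv ℝ g x z‖ ≤ 2 * B * ‖z‖ ^ 2 := by
  have hpos := norm_image_add_sub_sub_fderiv_le hB hg hlip x z
  have hneg := norm_image_add_sub_sub_fderiv_le hB hg hlip x (-z)
  rw [norm_neg, map_neg, ← sub_eq_add_neg] at hneg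
  have hsplit : g (x + z) - g (x - z) - (2 : ℝ) • fderiv ℝ g x z
      = (g (x + z) - g x - fderiv ℝ g x z) - (g (x - z) - g x - -fderiv ℝ g x z) := by
    rw [two_smul]; abel
  rw [hsplit]
  exact (norm_sub_le _ _).trans (by linarith)

lemma hasDerivAt_secondDifference {w : E → F} (hw : Differentiable ℝ w) (x z : E) (h : F)
    (s : ℝ) :
    HasDerivAt (fun s : ℝ => w (x + s • z) + w (x - s • z) - (2 : ℝ) • w x - s ^ 2 • h)
      (fderiv ℝ w (x + s • z) z - fderiv ℝ w (x - s • z) z - (2 * s) • h) s := by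
  have hsmul : HasDerivAt (fun s : ℝ => s • z) z s := by
    simpa using (hasDerivAt_id s).smul_const z
  have hpos := (hw (x + s • z)).hasFDerivAt.comp_hasDerivAt s (hsmul.const_add x)
  have hneg := (hw (x - s • z)).hasFDerivAt.comp_hasDerivAt s (hsmul.const_sub x)
  refine (((hpos.add hneg).sub_const ((2 : ℝ) • w x)).sub
    ((hasDerivAt_pow 2 s).smul_const h)).congr_deriv ?_
  simp [sub_eq_add_neg]

lemma norm_secondDifference_sub_le {w : E → F} (hB : 0 ≤ B) (hw : ContDiff ℝ 2 w)
    (hlip : ∀ y y', ‖fderiv ℝ (fderiv ℝ w) y - fderiv ℝ (fderiv ℝ w) y'‖ ≤ B * ‖y - y'‖)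
    (x z : E) :
    ‖w (x + z) + w (x - z) - (2 : ℝ) • w x - fderiv ℝ (fderiv ℝ w) x z z‖ ≤ 2 * B * ‖z‖ ^ 3 := by
  have hw' : Differentiable ℝ (fderiv ℝ w) :=
    (hw.fderiv_right (m := 1) (by norm_num)).differentiable one_ne_zero
  set H := fderiv ℝ (fderiv ℝ w) x
  have hderiv : ∀ s ∈ Ico (0 : ℝ) 1,
      ‖fderiv ℝ w (x + s • z) z - fderiv ℝ w (x - s • z) z - (2 * s) • H z z‖
        ≤ 2 * B * ‖z‖ ^ 3 := fun s hs => by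
    have hsz : ‖s • z‖ ≤ ‖z‖ := by
      rw [norm_smul, Real.norm_of_nonneg hs.1]
      exact mul_le_of_le_one_left (norm_nonneg _) hs.2.le
    calc ‖fderiv ℝ w (x + s • z) z - fderiv ℝ w (x - s • z) z - (2 * s) • H z z‖
        = ‖(fderiv ℝ w (x + s • z) - fderiv ℝ w (x - s • z) - (2 : ℝ) • H (s • z)) z‖ := by
          simp [smul_smul]
      _ ≤ 2 * B * ‖s • z‖ ^ 2 * ‖z‖ :=
          ContinuousLinearMap.le_of_opNorm_le _
            (norm_image_add_sub_image_sub_sub_fderiv_le hB hw' hlip x (s • z)) z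
      _ ≤ 2 * B * ‖z‖ ^ 2 * ‖z‖ := by gcongr
      _ = 2 * B * ‖z‖ ^ 3 := by ring
  have h := norm_image_sub_le_of_norm_deriv_le_segment_01'
    (fun s _ => (hasDerivAt_secondDifference (hw.differentiable two_ne_zero) x z (H z z)
      s).hasDerivWithinAt) hderiv
  simpa [two_smul] using h

end Taylor

section ElasticForce

variable {d : ℕ} {f J : ℝ → ℝ}

lemma contDiffOn_halfLineDeriv (hf : ContDiffOn ℝ 2 f (Ici 0)) :
    ContDiffOn ℝ 1 (halfLineDeriv f) (Ici 0) :=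
  hf.derivWithin (uniqueDiffOn_Ici 0) (by norm_num)

lemma exists_lipschitz_halfLineDeriv (hf : ContDiffOn ℝ 2 f (Ici 0)) (A : ℝ) :
    ∃ L, 0 ≤ L ∧ ∀ a ∈ Icc 0 A, ∀ b ∈ Icc 0 A,
      |halfLineDeriv f a - halfLineDeriv f b| ≤ L * |a - b| := by
  rcases le_or_gt A 0 with hA | hA
  · refine ⟨0, le_rfl, fun a ha b hb => ?_⟩
    have hab : a = b := by linarith [ha.1, ha.2, hb.1, hb.2]
    simp [hab]
  have hderiv : ContDiffOn ℝ 1 (halfLineDeriv f) (Icc 0 A) :=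
    (contDiffOn_halfLineDeriv hf).mono Icc_subset_Ici_self
  obtain ⟨L, hL⟩ := isCompact_Icc.exists_bound_of_continuousOn
    (hderiv.continuousOn_derivWithin (uniqueDiffOn_Icc hA) le_rfl)
  refine ⟨L, (norm_nonneg _).trans (hL 0 ⟨le_rfl, hA.le⟩), fun a ha b hb => ?_⟩
  exact (convex_Icc 0 A).norm_image_sub_le_of_norm_derivWithin_le
    (hderiv.differentiableOn one_ne_zero) hL hb ha

/-- The cubic form `e ↦ D²w(x)(e, e) · e`: to leading order, the difference of the strains of the
two bonds from `x` in the directions `e` and `-e`, per unit length. -/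
noncomputable def strainGradient (w : Vec d → Vec d) (x e : Vec d) : ℝ :=
  inner ℝ (fderiv ℝ (fderiv ℝ w) x e e) e

lemma strainGradient_eq_sum (w : Vec d → Vec d) (x e : Vec d) :
    strainGradient w x e = ∑ j, ∑ k, ∑ l, e j * e k * e l * secondPartial j l w x k := by
  have hbasis : e = ∑ j, e j • (EuclideanSpace.single j (1 : ℝ) : Vec d) := by
    ext i; simp [Finset.sum_apply, Pi.single_apply]
  have hH : fderiv ℝ (fderiv ℝ w) x e e = ∑ j, ∑ l, (e j * e l) •
      fderiv ℝ (fderiv ℝ w) x (EuclideanSpace.single j 1) (EuclideanSpace.single l 1) := by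
    conv_lhs => rw [hbasis]
    simp only [map_sum, map_smul, sum_apply, smul_apply, Finset.smul_sum, smul_smul]
    rw [Finset.sum_comm]
    exact Finset.sum_congr rfl fun j _ => Finset.sum_congr rfl fun l _ => by rw [mul_comm]
  rw [strainGradient, hH]
  simp only [PiLp.inner_apply, WithLp.ofLp_sum, Finset.sum_apply, PiLp.smul_apply, smul_eq_mul,
    RCLike.inner_apply, conj_trivial, Finset.mul_sum]
  rw [Finset.sum_comm]
  refine Finset.sum_congr rfl fun j _ => Finset.sum_congr rfl fun k _ =>
    Finset.sum_congr rfl fun l _ => ?_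
  rw [secondPartial]
  ring

lemma abs_strainGradient_unitDir_le (w : Vec d → Vec d) (x ξ : Vec d) :
    |strainGradient w x (unitDir ξ)| ≤ ‖fderiv ℝ (fderiv ℝ w) x‖ := by
  have hξ := norm_unitDir_le ξ
  calc |strainGradient w x (unitDir ξ)|
      ≤ ‖fderiv ℝ (fderiv ℝ w) x (unitDir ξ) (unitDir ξ)‖ * ‖unitDir ξ‖ :=
        abs_real_inner_le_norm _ _
    _ ≤ ‖fderiv ℝ (fderiv ℝ w) x‖ * ‖unitDir ξ‖ * ‖unitDir ξ‖ * ‖unitDir ξ‖ := by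
        gcongr; exact ContinuousLinearMap.le_opNorm₂ _ _ _
    _ ≤ ‖fderiv ℝ (fderiv ℝ w) x‖ * 1 * 1 * 1 := by gcongr
    _ = ‖fderiv ℝ (fderiv ℝ w) x‖ := by ring

lemma measurable_strainGradient_unitDir (w : Vec d → Vec d) (x : Vec d) :
    Measurable fun ξ => strainGradient w x (unitDir ξ) := by
  have hcont : Continuous (strainGradient w x) := by unfold strainGradient; fun_prop
  exact hcont.measurable.comp measurable_unitDir

lemma IsInfluence.integrableOn_smul (hJ : IsInfluence J) {F : Type*} [NormedAddCommGroup F]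
    [NormedSpace ℝ F] {G : Vec d → F} {C : ℝ}
    (hG : AEStronglyMeasurable G (volume.restrict (Metric.ball 0 1)))
    (hC : ∀ ξ ∈ Metric.ball (0 : Vec d) 1, ‖G ξ‖ ≤ C) :
    IntegrableOn (fun ξ : Vec d => J ‖ξ‖ • G ξ) (Metric.ball 0 1) := by
  obtain ⟨M, hM0, hM⟩ := hJ.exists_bound
  refine IntegrableOn.of_bound (C := M * C) measure_ball_lt_top
    ((hJ.measurable.comp measurable_norm).aestronglyMeasurable.smul hG)
    ((ae_restrict_iff' measurableSet_ball).2 (Eventually.of_forall fun ξ hξ => ?_))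
  obtain ⟨hJ0, hJM⟩ := hM ‖ξ‖ (norm_nonneg _)
  rw [norm_smul, Real.norm_of_nonneg hJ0]
  exact mul_le_mul hJM (hC ξ hξ) (norm_nonneg _) hM0

lemma IsInfluence.integrableOn_smul_strainGradient (hJ : IsInfluence J) (w : Vec d → Vec d)
    (x : Vec d) :
    IntegrableOn (fun ξ : Vec d => J ‖ξ‖ • (‖ξ‖ * strainGradient w x (unitDir ξ)) • unitDir ξ)
      (Metric.ball 0 1) := by
  refine hJ.integrableOn_smul (C := 1 * ‖fderiv ℝ (fderiv ℝ w) x‖ * 1)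
    (Measurable.aestronglyMeasurable ((measurable_norm.mul
      (measurable_strainGradient_unitDir w x)).smul measurable_unitDir)) fun ξ hξ => ?_
  have hξ₁ : ‖ξ‖ ≤ 1 := (mem_ball_zero_iff.1 hξ).le
  rw [norm_smul, norm_mul, norm_norm, Real.norm_eq_abs]
  exact mul_le_mul (mul_le_mul hξ₁ (abs_strainGradient_unitDir_le w x ξ) (abs_nonneg _)
    zero_le_one) (norm_unitDir_le ξ) (norm_nonneg _) (by positivity)

lemma IsInfluence.integrableOn_elasticTensor (hJ : IsInfluence J) (i j k l : Fin d) :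
    IntegrableOn (fun ξ : Vec d =>
      J ‖ξ‖ * (unitDir ξ i * unitDir ξ j * unitDir ξ k * unitDir ξ l) * ‖ξ‖)
      (Metric.ball 0 1) := by
  have hmeas : ∀ i : Fin d, Measurable fun ξ : Vec d => unitDir ξ i := fun i =>
    (EuclideanSpace.proj i : Vec d →L[ℝ] ℝ).continuous.measurable.comp measurable_unitDir
  have hle : ∀ (ξ : Vec d) (i : Fin d), ‖unitDir ξ i‖ ≤ 1 := fun ξ i =>
    (PiLp.norm_apply_le _ i).trans (norm_unitDir_le ξ)
  simp only [mul_assoc (J _)]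
  refine hJ.integrableOn_smul (C := 1 * 1 * 1 * 1 * 1) (Measurable.aestronglyMeasurable
    (((((hmeas i).mul (hmeas j)).mul (hmeas k)).mul (hmeas l)).mul measurable_norm)) fun ξ hξ => ?_
  have hξ₁ : ‖ξ‖ ≤ 1 := (mem_ball_zero_iff.1 hξ).le
  simp only [norm_mul, norm_norm]
  gcongr <;> exact hle ξ _

lemma elasticForce_eq_integral (f : ℝ → ℝ) (hJ : IsInfluence J) {w : Vec d → Vec d} {x : Vec d}
    (hw : ContDiffAt ℝ 2 w x) :
    elasticForce f J w x = (2 * halfLineDeriv f 0 / unitBallVolume d) •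
      ∫ ξ in Metric.ball (0 : Vec d) 1,
        J ‖ξ‖ • (‖ξ‖ * strainGradient w x (unitDir ξ)) • unitDir ξ := by
  ext i
  have hsum : ∀ ξ : Vec d, (EuclideanSpace.proj i : Vec d →L[ℝ] ℝ)
      (J ‖ξ‖ • (‖ξ‖ * strainGradient w x (unitDir ξ)) • unitDir ξ)
      = ∑ j, ∑ k, ∑ l, J ‖ξ‖ * (unitDir ξ i * unitDir ξ j * unitDir ξ k * unitDir ξ l) * ‖ξ‖
        * secondPartial j l w x k := fun ξ => by
    simp only [PiLp.proj_apply, strainGradient_eq_sum, PiLp.smul_apply, smul_eq_mul,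
      Finset.mul_sum, Finset.sum_mul]
    refine Finset.sum_congr rfl fun j _ => Finset.sum_congr rfl fun k _ =>
      Finset.sum_congr rfl fun l _ => ?_
    ring
  have hint : ∀ j k l, IntegrableOn (fun ξ : Vec d =>
      J ‖ξ‖ * (unitDir ξ i * unitDir ξ j * unitDir ξ k * unitDir ξ l) * ‖ξ‖
        * secondPartial j l w x k) (Metric.ball 0 1) := fun j k l =>
    (hJ.integrableOn_elasticTensor i j k l).mul_const _
  rw [elasticForce_apply f J hw i, PiLp.smul_apply, smul_eq_mul, ← PiLp.proj_apply (𝕜 := ℝ),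
    ← ContinuousLinearMap.integral_comp_comm _ (hJ.integrableOn_smul_strainGradient w x)]
  simp only [hsum, elasticTensor]
  rw [integral_finsetSum _ fun j _ => integrable_finsetSum _ fun k _ =>
    integrable_finsetSum _ fun l _ => hint j k l]
  simp_rw [integral_finsetSum _ fun k _ => integrable_finsetSum _ fun l _ => hint _ k l,
    integral_finsetSum _ fun l _ => hint _ _ l, integral_mul_const, Finset.mul_sum, mul_assoc]

end ElasticForce

section BondForce

variable {d : ℕ} {f J : ℝ → ℝ} {B ε : ℝ} {w : Vec d → Vec d}

/-- The integrand of the nonlocal force after the substitution `y = x + ε ξ`, so that `ξ` ranges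
over the unit ball. -/
noncomputable def bondForce (f J : ℝ → ℝ) (ε : ℝ) (w : Vec d → Vec d) (x ξ : Vec d) : Vec d :=
  (J ‖ξ‖ * halfLineDeriv f (ε * ‖ξ‖ * bondStrain w (x + ε • ξ) x ^ 2) *
    bondStrain w (x + ε • ξ) x) • unitDir ξ

lemma setIntegral_ball_eq_smul_integral_unitBall {F : Type*} [NormedAddCommGroup F]
    [NormedSpace ℝ F] (h : Vec d → F) (x : Vec d) (hε : 0 < ε) :
    ∫ y in Metric.ball x ε, h y = ε ^ d • ∫ ξ in Metric.ball (0 : Vec d) 1, h (x + ε • ξ) := by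
  have hball : (fun z => x + z) ⁻¹' Metric.ball x ε = Metric.ball 0 ε := by
    ext z; simp [dist_eq_norm]
  rw [← (measurePreserving_add_left volume x).setIntegral_preimage_emb
      (measurableEmbedding_addLeft x) h (Metric.ball x ε), hball,
    Measure.setIntegral_comp_smul_of_pos volume (fun z => h (x + z)) _ hε,
    smul_unitBall_of_pos hε, smul_smul, finrank_euclideanSpace_fin,
    mul_inv_cancel₀ (by positivity), one_smul]

lemma nonlocalForce_eq_integral_bondForce (f J : ℝ → ℝ) (hε : 0 < ε) (w : Vec d → Vec d)
    (x : Vec d) :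
    nonlocalForce f J ε w x = (4 / (ε * unitBallVolume d)) •
      ∫ ξ in Metric.ball (0 : Vec d) 1, bondForce f J ε w x ξ := by
  have hscale : ∀ ξ : Vec d, ‖ε • ξ‖ = ε * ‖ξ‖ := fun ξ => by
    rw [norm_smul, Real.norm_of_nonneg hε.le]
  have hω := unitBallVolume_pos d
  rw [nonlocalForce, setIntegral_ball_eq_smul_integral_unitBall _ x hε, smul_smul]
  simp only [add_sub_cancel_left, hscale, mul_div_cancel_left₀ _ hε.ne', unitDir_smul hε,
    bondForce]
  congr 1
  rw [pow_succ]
  field_simp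

lemma nonlocalForce_eq_zero (f : ℝ → ℝ) (hε : 0 < ε)
    (hJ : ∀ᵐ ξ : Vec d ∂(volume.restrict (Metric.ball 0 1)), ξ ≠ 0 → J ‖ξ‖ = 0)
    (w : Vec d → Vec d) (x : Vec d) : nonlocalForce f J ε w x = 0 := by
  rw [nonlocalForce_eq_integral_bondForce f J hε, integral_eq_zero_of_ae, smul_zero]
  filter_upwards [hJ] with ξ hξ
  rcases eq_or_ne ξ 0 with rfl | h0
  · simp [bondForce, unitDir]
  · simp [bondForce, hξ h0]

/-- Fields with first and second derivatives bounded by `B` and second derivative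
`B`-Lipschitz. -/
structure HasBoundedDerivs (B : ℝ) (w : Vec d → Vec d) : Prop where
  contDiff : ContDiff ℝ 2 w
  fderiv_le : ∀ x, ‖fderiv ℝ w x‖ ≤ B
  fderiv_fderiv_le : ∀ x, ‖fderiv ℝ (fderiv ℝ w) x‖ ≤ B
  lipschitz : ∀ y y', ‖fderiv ℝ (fderiv ℝ w) y - fderiv ℝ (fderiv ℝ w) y'‖ ≤ B * ‖y - y'‖

lemma HasBoundedDerivs.nonneg (hw : HasBoundedDerivs B w) : 0 ≤ B :=
  (norm_nonneg _).trans (hw.fderiv_le 0)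

lemma bondStrain_add (w : Vec d → Vec d) (x z : Vec d) :
    bondStrain w (x + z) x = inner ℝ (w (x + z) - w x) (unitDir z) / ‖z‖ := by
  rw [bondStrain, add_sub_cancel_left]

lemma HasBoundedDerivs.abs_bondStrain_le (hw : HasBoundedDerivs B w) (x z : Vec d) :
    |bondStrain w (x + z) x| ≤ B := by
  have hlip : ‖w (x + z) - w x‖ ≤ B * ‖z‖ := by
    simpa using convex_univ.norm_image_sub_le_of_norm_fderiv_le (𝕜 := ℝ)
      (fun y _ => hw.contDiff.differentiable two_ne_zero y) (fun y _ => hw.fderiv_le y)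
      (mem_univ x) (mem_univ (x + z))
  rw [bondStrain_add, abs_div, abs_norm, real_inner_comm]
  exact div_le_of_le_mul₀ (norm_nonneg _) hw.nonneg ((abs_inner_unitDir_le _ _).trans hlip)

lemma HasBoundedDerivs.abs_strainGradient_le (hw : HasBoundedDerivs B w) (x ξ : Vec d) :
    |strainGradient w x (unitDir ξ)| ≤ B :=
  (abs_strainGradient_unitDir_le w x ξ).trans (hw.fderiv_fderiv_le x)

lemma HasBoundedDerivs.abs_bondStrain_sub_sub_le (hw : HasBoundedDerivs B w) (x : Vec d)
    {z : Vec d} (hz : z ≠ 0) :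
    |bondStrain w (x + z) x - bondStrain w (x + -z) x - ‖z‖ * strainGradient w x (unitDir z)|
      ≤ 2 * B * ‖z‖ ^ 2 := by
  have hn : 0 < ‖z‖ := norm_pos_iff.2 hz
  have hH : fderiv ℝ (fderiv ℝ w) x z z
      = (‖z‖ * ‖z‖) • fderiv ℝ (fderiv ℝ w) x (unitDir z) (unitDir z) := by
    conv_lhs => rw [← norm_smul_unitDir z]
    simp only [map_smul, smul_apply, smul_smul]
  have hsplit : bondStrain w (x + z) x - bondStrain w (x + -z) x
      - ‖z‖ * strainGradient w x (unitDir z) = inner ℝ (unitDir z)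
        (w (x + z) + w (x - z) - (2 : ℝ) • w x - fderiv ℝ (fderiv ℝ w) x z z) / ‖z‖ := by
    rw [hH, bondStrain_add, bondStrain_add, unitDir_neg, norm_neg, ← sub_eq_add_neg,
      strainGradient, real_inner_comm _ (unitDir z)]
    simp only [inner_sub_left, inner_add_left, inner_smul_left, inner_neg_right, conj_trivial]
    field_simp
    ring
  rw [hsplit, abs_div, abs_norm, div_le_iff₀ hn]
  refine (abs_inner_unitDir_le _ _).trans
    ((norm_secondDifference_sub_le hw.nonneg hw.contDiff hw.lipschitz x z).trans_eq ?_)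
  ring

lemma mul_sq_mem_Icc_of_abs_le {A r s : ℝ} (hr : 0 ≤ r) (hA : r * B ^ 2 ≤ A) (hs : |s| ≤ B) :
    r * s ^ 2 ∈ Icc 0 A :=
  ⟨by positivity, (mul_le_mul_of_nonneg_left (sq_le_sq' (abs_le.1 hs).1 (abs_le.1 hs).2)
    hr).trans hA⟩

lemma abs_apply_mul_sq_mul_sub_sub_le {φ : ℝ → ℝ} {L r S S' A : ℝ}
    (hφ : ∀ a ∈ Icc 0 A, ∀ b ∈ Icc 0 A, |φ a - φ b| ≤ L * |a - b|) (hL : 0 ≤ L)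
    (hr : 0 ≤ r) (hA : r * B ^ 2 ≤ A) (hS : |S| ≤ B) (hS' : |S'| ≤ B) :
    |φ (r * S ^ 2) * S - φ (r * S' ^ 2) * S' - φ 0 * (S - S')| ≤ 3 * L * r * B ^ 2 * |S - S'| := by
  have hB : 0 ≤ B := (abs_nonneg _).trans hS
  have hmem := mul_sq_mem_Icc_of_abs_le hr hA hS
  have hzero : |φ (r * S ^ 2) - φ 0| ≤ L * (r * B ^ 2) := by
    refine (hφ _ hmem 0 ⟨le_rfl, hmem.1.trans hmem.2⟩).trans ?_
    rw [sub_zero, abs_of_nonneg hmem.1]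
    exact mul_le_mul_of_nonneg_left (mul_sq_mem_Icc_of_abs_le hr le_rfl hS).2 hL
  have hdiff : |φ (r * S ^ 2) - φ (r * S' ^ 2)| ≤ L * (r * (|S - S'| * (2 * B))) := by
    have hfactor : r * S ^ 2 - r * S' ^ 2 = r * ((S - S') * (S + S')) := by ring
    have hsum : |S + S'| ≤ 2 * B := (abs_add_le _ _).trans (by linarith)
    refine (hφ _ hmem _ (mul_sq_mem_Icc_of_abs_le hr hA hS')).trans ?_
    rw [hfactor, abs_mul, abs_mul, abs_of_nonneg hr]
    gcongr
  calc |φ (r * S ^ 2) * S - φ (r * S' ^ 2) * S' - φ 0 * (S - S')|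
      = |(φ (r * S ^ 2) - φ 0) * (S - S') + (φ (r * S ^ 2) - φ (r * S' ^ 2)) * S'| := by ring_nf
    _ ≤ |φ (r * S ^ 2) - φ 0| * |S - S'| + |φ (r * S ^ 2) - φ (r * S' ^ 2)| * |S'| := by
        rw [← abs_mul, ← abs_mul]; exact abs_add_le _ _
    _ ≤ L * (r * B ^ 2) * |S - S'| + L * (r * (|S - S'| * (2 * B))) * B := by gcongr
    _ = 3 * L * r * B ^ 2 * |S - S'| := by ring

lemma measurable_bondStrain (hw : Continuous w) (ε : ℝ) (x : Vec d) :
    Measurable fun ξ : Vec d => bondStrain w (x + ε • ξ) x := by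
  have hsmul : Continuous fun ξ : Vec d => ε • ξ := by fun_prop
  have hdiff : Continuous fun ξ : Vec d => w (x + ε • ξ) - w x := by fun_prop
  simp only [bondStrain_add]
  exact (hdiff.measurable.inner (measurable_unitDir.comp hsmul.measurable)).div
    hsmul.measurable.norm

lemma HasBoundedDerivs.integrableOn_bondForce (hw : HasBoundedDerivs B w)
    (hf : ContDiffOn ℝ 2 f (Ici 0)) (hJ : IsInfluence J) (hε : 0 ≤ ε) (x : Vec d) :
    IntegrableOn (bondForce f J ε w x) (Metric.ball 0 1) := by
  have hB := hw.nonneg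
  have hcont := (contDiffOn_halfLineDeriv hf).continuousOn
  obtain ⟨C, hC⟩ := (isCompact_Icc (a := (0 : ℝ)) (b := ε * B ^ 2)).exists_bound_of_continuousOn
    (hcont.mono Icc_subset_Ici_self)
  have hC0 : 0 ≤ C := (norm_nonneg _).trans (hC 0 ⟨le_rfl, by positivity⟩)
  -- The derivative of `f` is controlled on `[0, ∞)` only, so its argument is truncated at `0`.
  have hmax : Continuous fun r => halfLineDeriv f (max r 0) :=
    hcont.comp_continuous (by fun_prop) fun r => mem_Ici.2 (le_max_right _ _)
  have hnonneg : ∀ ξ : Vec d, 0 ≤ ε * ‖ξ‖ * bondStrain w (x + ε • ξ) x ^ 2 := fun ξ => by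
    positivity
  have hstrain := measurable_bondStrain hw.contDiff.continuous ε x
  have heq : bondForce f J ε w x = fun ξ => J ‖ξ‖ •
      ((halfLineDeriv f (max (ε * ‖ξ‖ * bondStrain w (x + ε • ξ) x ^ 2) 0) *
        bondStrain w (x + ε • ξ) x) • unitDir ξ) := by
    ext1 ξ
    rw [bondForce, max_eq_left (hnonneg ξ), smul_smul, mul_assoc]
  rw [heq]
  refine hJ.integrableOn_smul (C := C * B * 1) (Measurable.aestronglyMeasurable
    (((hmax.measurable.comp ((measurable_norm.const_mul ε).mul (hstrain.pow_const 2))).mul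
      hstrain).smul measurable_unitDir)) fun ξ hξ => ?_
  have hstrain_le := hw.abs_bondStrain_le x (ε • ξ)
  have hmem : ε * ‖ξ‖ * bondStrain w (x + ε • ξ) x ^ 2 ∈ Icc 0 (ε * B ^ 2) :=
    mul_sq_mem_Icc_of_abs_le (by positivity) (mul_le_mul_of_nonneg_right
      (mul_le_of_le_one_right hε (mem_ball_zero_iff.1 hξ).le) (sq_nonneg B)) hstrain_le
  rw [max_eq_left (hnonneg ξ), norm_smul, norm_mul]
  exact mul_le_mul (mul_le_mul (hC _ hmem) hstrain_le (abs_nonneg _) hC0) (norm_unitDir_le ξ)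
    (norm_nonneg _) (by positivity)

lemma bondForce_add_bondForce_neg_sub (hε : 0 < ε) (w : Vec d → Vec d) (x ξ : Vec d) (c h : ℝ) :
    bondForce f J ε w x ξ + bondForce f J ε w x (-ξ) - (c * ε) • J ‖ξ‖ • (‖ξ‖ * h) • unitDir ξ
      = (J ‖ξ‖ * (halfLineDeriv f (‖ε • ξ‖ * bondStrain w (x + ε • ξ) x ^ 2)
            * bondStrain w (x + ε • ξ) x
          - halfLineDeriv f (‖ε • ξ‖ * bondStrain w (x + -(ε • ξ)) x ^ 2)
            * bondStrain w (x + -(ε • ξ)) x - c * (‖ε • ξ‖ * h))) • unitDir ξ := by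
  have hnorm : ‖ε • ξ‖ = ε * ‖ξ‖ := by rw [norm_smul, Real.norm_of_nonneg hε.le]
  simp only [bondForce, hnorm, norm_neg, unitDir_neg, smul_neg, smul_smul]
  rw [← sub_eq_add_neg, ← sub_smul, ← sub_smul]
  congr 1
  ring

lemma HasBoundedDerivs.abs_pairedForce_sub_le (hw : HasBoundedDerivs B w) {φ : ℝ → ℝ} {L R : ℝ}
    (hL : 0 ≤ L)
    (hφ : ∀ a ∈ Icc 0 (R * B ^ 2), ∀ b ∈ Icc 0 (R * B ^ 2), |φ a - φ b| ≤ L * |a - b|)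
    (x : Vec d) {z : Vec d} (hz : z ≠ 0) (hzR : ‖z‖ ≤ R) :
    |φ (‖z‖ * bondStrain w (x + z) x ^ 2) * bondStrain w (x + z) x
        - φ (‖z‖ * bondStrain w (x + -z) x ^ 2) * bondStrain w (x + -z) x
        - φ 0 * (‖z‖ * strainGradient w x (unitDir z))|
      ≤ (3 * L * B ^ 2 * (B + 2 * B * R) + |φ 0| * (2 * B)) * ‖z‖ ^ 2 := by
  have hB := hw.nonneg
  have hlinear := hw.abs_bondStrain_sub_sub_le x hz
  have hnonlinear := abs_apply_mul_sq_mul_sub_sub_le hφ hL (norm_nonneg z)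
    (mul_le_mul_of_nonneg_right hzR (sq_nonneg B)) (hw.abs_bondStrain_le x z)
    (hw.abs_bondStrain_le x (-z))
  set S := bondStrain w (x + z) x
  set S' := bondStrain w (x + -z) x
  set h := strainGradient w x (unitDir z)
  have hdiff : |S - S'| ≤ ‖z‖ * (B + 2 * B * R) := by
    calc |S - S'| = |(S - S' - ‖z‖ * h) + ‖z‖ * h| := by rw [sub_add_cancel]
      _ ≤ |S - S' - ‖z‖ * h| + ‖z‖ * |h| := by
          simpa only [abs_mul, abs_norm] using abs_add_le (S - S' - ‖z‖ * h) (‖z‖ * h)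
      _ ≤ 2 * B * (‖z‖ * R) + ‖z‖ * B := by
          refine add_le_add (hlinear.trans ?_)
            (mul_le_mul_of_nonneg_left (hw.abs_strainGradient_le x z) (norm_nonneg z))
          rw [sq]; gcongr
      _ = ‖z‖ * (B + 2 * B * R) := by ring
  calc |φ (‖z‖ * S ^ 2) * S - φ (‖z‖ * S' ^ 2) * S' - φ 0 * (‖z‖ * h)|
      = |(φ (‖z‖ * S ^ 2) * S - φ (‖z‖ * S' ^ 2) * S' - φ 0 * (S - S'))
          + φ 0 * (S - S' - ‖z‖ * h)| := by ring_nf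
    _ ≤ 3 * L * ‖z‖ * B ^ 2 * |S - S'| + |φ 0| * |S - S' - ‖z‖ * h| := by
        rw [← abs_mul]; exact (abs_add_le _ _).trans (add_le_add hnonlinear (by rfl))
    _ ≤ 3 * L * ‖z‖ * B ^ 2 * (‖z‖ * (B + 2 * B * R)) + |φ 0| * (2 * B * ‖z‖ ^ 2) := by gcongr
    _ = (3 * L * B ^ 2 * (B + 2 * B * R) + |φ 0| * (2 * B)) * ‖z‖ ^ 2 := by ring

lemma HasBoundedDerivs.exists_norm_bondForce_sub_le (d : ℕ) (hf : ContDiffOn ℝ 2 f (Ici 0))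
    (hJ : IsInfluence J) (hB : 0 ≤ B) {R : ℝ} (hR : 0 ≤ R) :
    ∃ K, 0 ≤ K ∧ ∀ ε, 0 < ε → ε ≤ R → ∀ w : Vec d → Vec d, HasBoundedDerivs B w → ∀ x,
      ∀ ξ ∈ Metric.ball (0 : Vec d) 1, ‖bondForce f J ε w x ξ + bondForce f J ε w x (-ξ)
        - (halfLineDeriv f 0 * ε) • J ‖ξ‖ • (‖ξ‖ * strainGradient w x (unitDir ξ)) • unitDir ξ‖
        ≤ K * ε ^ 2 := by
  obtain ⟨M, hM0, hM⟩ := hJ.exists_bound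
  obtain ⟨L, hL0, hL⟩ := exists_lipschitz_halfLineDeriv hf (R * B ^ 2)
  let K := 3 * L * B ^ 2 * (B + 2 * B * R) + |halfLineDeriv f 0| * (2 * B)
  have hK : 0 ≤ K := by positivity
  refine ⟨M * K, mul_nonneg hM0 hK, fun ε hε hεR w hw x ξ hξ => ?_⟩
  rcases eq_or_ne ξ 0 with rfl | hξ0
  · simpa [bondForce, unitDir] using by positivity
  have hεξ : ‖ε • ξ‖ ≤ ε := by
    rw [norm_smul, Real.norm_of_nonneg hε.le]
    exact mul_le_of_le_one_right hε.le (mem_ball_zero_iff.1 hξ).le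
  have hpair := hw.abs_pairedForce_sub_le hL0 hL x (smul_ne_zero hε.ne' hξ0) (hεξ.trans hεR)
  rw [unitDir_smul hε] at hpair
  obtain ⟨hJ0, hJM⟩ := hM ‖ξ‖ (norm_nonneg _)
  rw [bondForce_add_bondForce_neg_sub hε, norm_smul, norm_mul, Real.norm_of_nonneg hJ0]
  calc _ ≤ M * (K * ‖ε • ξ‖ ^ 2) * 1 :=
        mul_le_mul (mul_le_mul hJM hpair (abs_nonneg _) hM0) (norm_unitDir_le ξ)
          (norm_nonneg _) (by positivity)
    _ ≤ M * (K * ε ^ 2) * 1 := by gcongr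
    _ = M * K * ε ^ 2 := by ring

lemma measurePreserving_neg_restrict_ball (r : ℝ) :
    MeasurePreserving (fun ξ : Vec d => -ξ) (volume.restrict (Metric.ball 0 r))
      (volume.restrict (Metric.ball 0 r)) := by
  simpa using (Measure.measurePreserving_neg (volume : Measure (Vec d))).restrict_preimage
    (measurableSet_ball (x := 0) (ε := r))

lemma nonlocalForce_sub_elasticForce_eq_integral (hε : 0 < ε) (hJ : IsInfluence J) {x : Vec d}
    (hw : ContDiffAt ℝ 2 w x) (hbond : IntegrableOn (bondForce f J ε w x) (Metric.ball 0 1)) :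
    nonlocalForce f J ε w x - elasticForce f J w x = (2 / (ε * unitBallVolume d)) •
      ∫ ξ in Metric.ball (0 : Vec d) 1, (bondForce f J ε w x ξ + bondForce f J ε w x (-ξ)
          - (halfLineDeriv f 0 * ε) •
            J ‖ξ‖ • (‖ξ‖ * strainGradient w x (unitDir ξ)) • unitDir ξ) := by
  have hneg := measurePreserving_neg_restrict_ball (d := d) 1
  have hemb : MeasurableEmbedding fun ξ : Vec d => -ξ :=
    (MeasurableEquiv.neg (Vec d)).measurableEmbedding
  have hω := unitBallVolume_pos d
  have hbond' : IntegrableOn (fun ξ => bondForce f J ε w x (-ξ)) (Metric.ball 0 1) :=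
    (hneg.integrable_comp_emb hemb).2 hbond
  have hpair : IntegrableOn (fun ξ => bondForce f J ε w x ξ + bondForce f J ε w x (-ξ))
    (Metric.ball 0 1) := hbond.add hbond'
  have hlocal : IntegrableOn (fun ξ : Vec d => (halfLineDeriv f 0 * ε) •
      J ‖ξ‖ • (‖ξ‖ * strainGradient w x (unitDir ξ)) • unitDir ξ) (Metric.ball 0 1) :=
    (hJ.integrableOn_smul_strainGradient w x).smul (halfLineDeriv f 0 * ε)
  rw [integral_sub hpair hlocal, integral_add hbond hbond',
    hneg.integral_comp hemb (bondForce f J ε w x), integral_smul,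
    nonlocalForce_eq_integral_bondForce f J hε, elasticForce_eq_integral f hJ hw,
    ← two_smul ℝ (∫ ξ in Metric.ball (0 : Vec d) 1, bondForce f J ε w x ξ), smul_sub, smul_smul,
    smul_smul]
  congr 2
  · ring
  · field_simp

/-- Opposite bonds are paired: the zeroth-order terms of their forces cancel, and what remains is,
up to an error of second order, `ε` times the integrand of the elastic force. -/
theorem exists_norm_nonlocalForce_sub_elasticForce_le (d : ℕ) (hf : ContDiffOn ℝ 2 f (Ici 0))
    (hJ : IsInfluence J) (hB : 0 ≤ B) (R : ℝ) :
    ∃ K, 0 ≤ K ∧ ∀ ε, 0 < ε → ε ≤ R → ∀ w : Vec d → Vec d, HasBoundedDerivs B w → ∀ x,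
      ‖nonlocalForce f J ε w x - elasticForce f J w x‖ ≤ K * ε := by
  rcases lt_or_ge R 0 with hR | hR
  · exact ⟨0, le_rfl, fun ε hε hεR => absurd (hε.le.trans hεR) (not_le.2 hR)⟩
  obtain ⟨K, hK, hpair⟩ := HasBoundedDerivs.exists_norm_bondForce_sub_le d hf hJ hB hR
  refine ⟨2 * K, by positivity, fun ε hε hεR w hw x => ?_⟩
  have hω := unitBallVolume_pos d
  rw [nonlocalForce_sub_elasticForce_eq_integral hε hJ hw.contDiff.contDiffAt
    (hw.integrableOn_bondForce hf hJ hε.le x), norm_smul, Real.norm_of_nonneg (by positivity)]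
  calc _ ≤ 2 / (ε * unitBallVolume d) * (K * ε ^ 2 * unitBallVolume d) := by
        gcongr
        exact norm_setIntegral_le_of_norm_le_const measure_ball_lt_top (hpair ε hε hεR w hw x)
    _ = 2 * K * ε := by field_simp

end BondForce

section CollarField

variable {d : ℕ} {D : Set (Vec d)} {C ε : ℝ} {g : Vec d → Vec d}

lemma exists_frontier_infDist_eq (hd : 0 < d) (hDb : Bornology.IsBounded D) {x : Vec d}
    (hx : x ∈ D) : ∃ p ∈ frontier D, Metric.infDist x (frontier D) = ‖x - p‖ := by
  have : Nonempty (Fin d) := ⟨⟨0, hd⟩⟩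
  have hne : (frontier D).Nonempty := nonempty_frontier_iff.2
    ⟨⟨x, hx⟩, fun h => NormedSpace.unbounded_univ ℝ (Vec d) (h ▸ hDb)⟩
  have hcompact : IsCompact (frontier D) :=
    hDb.isCompact_closure.of_isClosed_subset isClosed_frontier frontier_subset_closure
  obtain ⟨p, hp, he⟩ := hcompact.exists_infDist_eq_dist hne x
  exact ⟨p, hp, by rw [he, dist_eq_norm]⟩

lemma indicator_eventuallyEq_of_isOpen {X Y : Type*} [TopologicalSpace X] [Zero Y] {U : Set X}
    (hU : IsOpen U) (h : X → Y) {x : X} (hx : x ∈ U) : U.indicator h =ᶠ[𝓝 x] h := by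
  filter_upwards [hU.mem_nhds hx] with y hy
  rw [indicator_of_mem hy]

/-- Fields that are `C⁴` in `D` with fourth derivative bounded by `C` and that vanish on the
`ε`-neighbourhood of the boundary. -/
structure IsCollarField (D : Set (Vec d)) (C ε : ℝ) (g : Vec d → Vec d) : Prop where
  contDiffOn : ContDiffOn ℝ 4 g D
  bound : ∀ x ∈ D, ‖iteratedFDeriv ℝ 4 g x‖ ≤ C
  collar : ∀ x, Metric.infDist x (frontier D) ≤ ε → g x = 0

namespace IsCollarField

lemma eventuallyEq_zero (hg : IsCollarField D C ε g) (hD : IsOpen D) (hε : 0 < ε) {x : Vec d}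
    (hx : x ∉ D) : D.indicator g =ᶠ[𝓝 x] fun _ => 0 := by
  by_cases hxc : x ∈ closure D
  · have hxf : x ∈ frontier D := ⟨hxc, by rwa [hD.interior_eq]⟩
    have hnear : ∀ᶠ y in 𝓝 x, Metric.infDist y (frontier D) < ε :=
      (Metric.continuous_infDist_pt (frontier D)).continuousAt.eventually_lt_const
        (by simpa only [Metric.infDist_zero_of_mem hxf] using hε)
    filter_upwards [hnear] with y hy
    exact indicator_apply_eq_zero.2 fun _ => hg.collar y hy.le
  · filter_upwards [isClosed_closure.isOpen_compl.mem_nhds hxc] with y hy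
    exact indicator_of_notMem (fun h => hy (subset_closure h)) g

lemma contDiff (hg : IsCollarField D C ε g) (hD : IsOpen D) (hε : 0 < ε) :
    ContDiff ℝ 4 (D.indicator g) := by
  refine contDiff_iff_contDiffAt.2 fun x => ?_
  by_cases hx : x ∈ D
  · exact (hg.contDiffOn.contDiffAt (hD.mem_nhds hx)).congr_of_eventuallyEq
      (indicator_eventuallyEq_of_isOpen hD g hx)
  · exact contDiffAt_const.congr_of_eventuallyEq (hg.eventuallyEq_zero hD hε hx)

lemma iteratedFDeriv_eq_zero (hg : IsCollarField D C ε g) (hD : IsOpen D) (hε : 0 < ε)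
    {x : Vec d} (hx : x ∉ D) (k : ℕ) : iteratedFDeriv ℝ k (D.indicator g) x = 0 :=
  ((hg.eventuallyEq_zero hD hε hx).iteratedFDeriv ℝ k).eq_of_nhds.trans
    (congrFun iteratedFDeriv_fun_zero x)

lemma norm_iteratedFDeriv_le (hg : IsCollarField D C ε g) (hD : IsOpen D) (hε : 0 < ε)
    {p : Vec d} (hp : p ∈ frontier D) {m k : ℕ} (hmk : m + k = 4) (x : Vec d) :
    ‖iteratedFDeriv ℝ k (D.indicator g) x‖ ≤ |C| * ‖x - p‖ ^ m := by
  have hpD : p ∉ D := fun h => (hD.frontier_eq ▸ hp).2 h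
  induction m generalizing k x with
  | zero =>
    obtain rfl : k = 4 := by omega
    rw [pow_zero, mul_one]
    by_cases hx : x ∈ D
    · rw [((indicator_eventuallyEq_of_isOpen hD g hx).iteratedFDeriv ℝ 4).eq_of_nhds]
      exact (hg.bound x hx).trans (le_abs_self C)
    · rw [hg.iteratedFDeriv_eq_zero hD hε hx, norm_zero]
      exact abs_nonneg C
  | succ m ih =>
    have hdiff : Differentiable ℝ (iteratedFDeriv ℝ k (D.indicator g)) :=
      (hg.contDiff hD hε).differentiable_iteratedFDeriv (by exact_mod_cast (by omega : k < 4))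
    have hderiv : ∀ y ∈ Metric.closedBall p ‖x - p‖,
        ‖fderiv ℝ (iteratedFDeriv ℝ k (D.indicator g)) y‖ ≤ |C| * ‖x - p‖ ^ m := fun y hy => by
      rw [norm_fderiv_iteratedFDeriv]
      refine (ih (by omega) y).trans ?_
      gcongr
      exact mem_closedBall_iff_norm.1 hy
    have h := (convex_closedBall p ‖x - p‖).norm_image_sub_le_of_norm_fderiv_le
      (fun y _ => hdiff y) hderiv (Metric.mem_closedBall_self (norm_nonneg _))
      (mem_closedBall_iff_norm.2 le_rfl)
    rwa [hg.iteratedFDeriv_eq_zero hD hε hpD, sub_zero, mul_assoc, ← pow_succ] at h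

lemma norm_le (hg : IsCollarField D C ε g) (hD : IsOpen D) (hε : 0 < ε) {p : Vec d}
    (hp : p ∈ frontier D) (x : Vec d) : ‖D.indicator g x‖ ≤ |C| * ‖x - p‖ ^ 4 := by
  simpa only [norm_iteratedFDeriv_zero] using
    hg.norm_iteratedFDeriv_le hD hε hp (m := 4) (k := 0) rfl x

lemma norm_fderiv_le (hg : IsCollarField D C ε g) (hD : IsOpen D) (hε : 0 < ε) {p : Vec d}
    (hp : p ∈ frontier D) (x : Vec d) : ‖fderiv ℝ (D.indicator g) x‖ ≤ |C| * ‖x - p‖ ^ 3 := by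
  simpa only [norm_iteratedFDeriv_one] using
    hg.norm_iteratedFDeriv_le hD hε hp (m := 3) (k := 1) rfl x

end IsCollarField

lemma norm_fderiv_fderiv_sub_le {E F : Type*} [NormedAddCommGroup E] [NormedSpace ℝ E]
    [NormedAddCommGroup F] [NormedSpace ℝ F] {w : E → F} {B : ℝ} (hw : ContDiff ℝ 3 w)
    (hB : ∀ x, ‖iteratedFDeriv ℝ 3 w x‖ ≤ B) (y y' : E) :
    ‖fderiv ℝ (fderiv ℝ w) y - fderiv ℝ (fderiv ℝ w) y'‖ ≤ B * ‖y - y'‖ := by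
  have hdiff : Differentiable ℝ (fderiv ℝ (fderiv ℝ w)) :=
    ((hw.fderiv_right (m := 2) (by norm_num)).fderiv_right (m := 1)
      (by norm_num)).differentiable one_ne_zero
  refine convex_univ.norm_image_sub_le_of_norm_fderiv_le (𝕜 := ℝ)
    (f := fderiv ℝ (fderiv ℝ w)) (fun z _ => hdiff z)
    (fun z _ => ?_) (mem_univ _) (mem_univ _)
  rw [← norm_iteratedFDeriv_one, norm_iteratedFDeriv_fderiv, norm_iteratedFDeriv_fderiv]
  exact hB z

/-- A bound for all the derivatives of fields with fourth derivative bounded by `C` that vanish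
near the boundary of a set all of whose points are within `R` of its boundary. -/
noncomputable def collarBound (C R : ℝ) : ℝ := |C| * R ^ 4 + |C| * R ^ 3 + |C| * R ^ 2 + |C| * R

lemma mul_pow_le_collarBound (C : ℝ) {R : ℝ} (hR : 0 ≤ R) {m : ℕ} (hm : m ∈ Icc 1 4) :
    |C| * R ^ m ≤ collarBound C R := by
  have h₁ : 0 ≤ |C| * R := by positivity
  have h₂ : 0 ≤ |C| * R ^ 2 := by positivity
  have h₃ : 0 ≤ |C| * R ^ 3 := by positivity
  have h₄ : 0 ≤ |C| * R ^ 4 := by positivity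
  obtain ⟨hm₁, hm₄⟩ := hm
  interval_cases m <;> simp only [collarBound, pow_one] <;> linarith

namespace IsCollarField

lemma norm_iteratedFDeriv_le_collarBound (hd : 0 < d) (hg : IsCollarField D C ε g)
    (hD : IsOpen D) (hDb : Bornology.IsBounded D) (hε : 0 < ε) {R : ℝ} (hR0 : 0 ≤ R)
    (hR : ∀ x ∈ D, ∀ p ∈ frontier D, ‖x - p‖ ≤ R) {k : ℕ} (hk : k < 4) (x : Vec d) :
    ‖iteratedFDeriv ℝ k (D.indicator g) x‖ ≤ collarBound C R := by
  refine le_trans ?_ (mul_pow_le_collarBound C hR0 (m := 4 - k) ⟨by omega, by omega⟩)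
  by_cases hx : x ∈ D
  · obtain ⟨p, hp, -⟩ := exists_frontier_infDist_eq hd hDb hx
    refine (hg.norm_iteratedFDeriv_le hD hε hp (m := 4 - k) (by omega) x).trans ?_
    gcongr
    exact hR x hx p hp
  · rw [hg.iteratedFDeriv_eq_zero hD hε hx, norm_zero]
    positivity

lemma hasBoundedDerivs (hd : 0 < d) (hg : IsCollarField D C ε g) (hD : IsOpen D)
    (hDb : Bornology.IsBounded D) (hε : 0 < ε) {R : ℝ} (hR0 : 0 ≤ R)
    (hR : ∀ x ∈ D, ∀ p ∈ frontier D, ‖x - p‖ ≤ R) :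
    HasBoundedDerivs (collarBound C R) (D.indicator g) where
  contDiff := (hg.contDiff hD hε).of_le (by norm_num)
  fderiv_le x := by
    rw [← norm_iteratedFDeriv_one]
    exact hg.norm_iteratedFDeriv_le_collarBound hd hD hDb hε hR0 hR (by norm_num) x
  fderiv_fderiv_le x := by
    rw [← norm_iteratedFDeriv_one, norm_iteratedFDeriv_fderiv]
    exact hg.norm_iteratedFDeriv_le_collarBound hd hD hDb hε hR0 hR (by norm_num) x
  lipschitz := norm_fderiv_fderiv_sub_le ((hg.contDiff hD hε).of_le (by norm_num)) fun x =>
    hg.norm_iteratedFDeriv_le_collarBound hd hD hDb hε hR0 hR (by norm_num) x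

end IsCollarField

end CollarField

section SpaceTime

variable {E F : Type*} [NormedAddCommGroup E] [NormedSpace ℝ E]
  [NormedAddCommGroup F] [NormedSpace ℝ F]

lemma exists_eventually_norm_iteratedFDerivWithin_le {U : E → F} {K S : Set E} {m : ℕ} {z : E}
    (hz : z ∈ K) (hSK : S ⊆ K) (hS : UniqueDiffOn ℝ S) (hU : ContDiffWithinAt ℝ m U K z) :
    ∃ M, ∀ᶠ y in 𝓝[K] z, y ∈ S → ‖iteratedFDerivWithin ℝ m U S y‖ ≤ M := by
  obtain ⟨u, hu, p, hp⟩ := contDiffWithinAt_nat.1 hU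
  rw [insert_eq_of_mem hz] at hu
  have hcont : ContinuousWithinAt (fun y => p y m) u z :=
    hp.cont m le_rfl z (mem_of_mem_nhdsWithin hz hu)
  have hle : ∀ᶠ y in 𝓝[K] z, ‖p y m‖ < ‖p z m‖ + 1 :=
    nhdsWithin_le_of_mem hu (hcont.norm.eventually_lt_const (lt_add_one _))
  obtain ⟨V, hVo, hzV, hV⟩ := mem_nhdsWithin.1 (hle.and hu)
  refine ⟨‖p z m‖ + 1, ?_⟩
  filter_upwards [mem_nhdsWithin_of_mem_nhds (hVo.mem_nhds hzV), self_mem_nhdsWithin]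
    with y hyV hyK hyS
  have hpV : HasFTaylorSeriesUpToOn m U p (S ∩ V) := hp.mono fun y hy => (hV ⟨hy.2, hSK hy.1⟩).2
  have heq : p y m = iteratedFDerivWithin ℝ m U S y := by
    rw [hpV.eq_iteratedFDerivWithin_of_uniqueDiffOn le_rfl (hS.inter hVo) ⟨hyS, hyV⟩,
      iteratedFDerivWithin_inter_open hVo hyV]
  rw [← heq]
  exact (hV ⟨hyV, hyK⟩).1.le

lemma exists_norm_iteratedFDerivWithin_le {U : E → F} {K S : Set E} {m : ℕ} (hK : IsCompact K)
    (hSK : S ⊆ K) (hS : UniqueDiffOn ℝ S) (hU : ContDiffOn ℝ m U K) :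
    ∃ M, 0 ≤ M ∧ ∀ z ∈ S, ‖iteratedFDerivWithin ℝ m U S z‖ ≤ M := by
  suffices h : ∃ M, 0 ≤ M ∧ ∀ z ∈ K, z ∈ S → ‖iteratedFDerivWithin ℝ m U S z‖ ≤ M by
    obtain ⟨M, hM0, hM⟩ := h
    exact ⟨M, hM0, fun z hz => hM z (hSK hz) hz⟩
  refine hK.induction_on
    (p := fun A => ∃ M, 0 ≤ M ∧ ∀ z ∈ A, z ∈ S → ‖iteratedFDerivWithin ℝ m U S z‖ ≤ M)
    ⟨0, le_rfl, fun z hz => absurd hz (notMem_empty z)⟩ ?_ ?_ ?_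
  · rintro A B hAB ⟨M, hM0, hM⟩
    exact ⟨M, hM0, fun z hz => hM z (hAB hz)⟩
  · rintro A B ⟨M, hM0, hM⟩ ⟨N, hN0, hN⟩
    refine ⟨M + N, add_nonneg hM0 hN0, ?_⟩
    rintro z (hz | hz) hzS
    · exact (hM z hz hzS).trans (le_add_of_nonneg_right hN0)
    · exact (hN z hz hzS).trans (le_add_of_nonneg_left hM0)
  · intro z hz
    obtain ⟨M, hM⟩ := exists_eventually_norm_iteratedFDerivWithin_le hz hSK hS (hU z hz)
    exact ⟨_, hM, |M|, abs_nonneg M, fun y hy hyS => (hy hyS).trans (le_abs_self M)⟩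

variable {U : ℝ × E → F} {A : ℝ × E →L[ℝ] F} {I : Set ℝ} {D : Set E} {t : ℝ} {x : E}

lemma hasFDerivAt_space (hD : IsOpen D) (ht : t ∈ I) (hx : x ∈ D)
    (hU : HasFDerivWithinAt U A (I ×ˢ D) (t, x)) :
    HasFDerivAt (fun y => U (t, y)) (A.comp (ContinuousLinearMap.inr ℝ ℝ E)) x :=
  (hU.comp x (hasFDerivAt_prodMk_right t x).hasFDerivWithinAt (s := D)
    fun _ hy => ⟨ht, hy⟩).hasFDerivAt (hD.mem_nhds hx)

lemma hasDerivWithinAt_time (hx : x ∈ D) (hU : HasFDerivWithinAt U A (I ×ˢ D) (t, x)) :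
    HasDerivWithinAt (fun s => U (s, x)) (A (1, 0)) I t :=
  hU.comp_hasDerivWithinAt t
    ((hasDerivAt_id t).prodMk (hasDerivAt_const t x)).hasDerivWithinAt
    (show MapsTo (fun s => (s, x)) I (I ×ˢ D) from fun _ hs => ⟨hs, hx⟩)

end SpaceTime

section RegularMotion

variable {d : ℕ} {D : Set (Vec d)} {T : ℝ}

/-- Motions on `[0, T] × D` with all second derivatives in time and in space bounded by `M`, with
spatial second derivatives continuous in time, and vanishing continuously on the boundary. -/
structure IsRegularMotion (D : Set (Vec d)) (T M : ℝ) (u : ℝ → Vec d → Vec d) : Prop where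
  continuous : ∀ t ∈ Icc 0 T, Continuous (D.indicator (u t))
  contDiffOn : ∀ t ∈ Icc 0 T, ContDiffOn ℝ 2 (u t) D
  norm_le : ∀ t ∈ Icc 0 T, ∀ x ∈ D, ‖u t x‖ ≤ M
  fderiv_le : ∀ t ∈ Icc 0 T, ∀ x ∈ D, ‖fderiv ℝ (u t) x‖ ≤ M
  fderiv_fderiv_le : ∀ t ∈ Icc 0 T, ∀ x ∈ D, ‖fderiv ℝ (fderiv ℝ (u t)) x‖ ≤ M
  hasDerivWithinAt : ∀ t ∈ Icc 0 T, ∀ x ∈ D,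
    HasDerivWithinAt (fun s => u s x) (velocity T u t x) (Icc 0 T) t
  hasDerivWithinAt_velocity : ∀ t ∈ Icc 0 T, ∀ x ∈ D,
    HasDerivWithinAt (fun s => velocity T u s x) (acceleration T u t x) (Icc 0 T) t
  velocity_le : ∀ t ∈ Icc 0 T, ∀ x ∈ D, ‖velocity T u t x‖ ≤ M
  acceleration_le : ∀ t ∈ Icc 0 T, ∀ x ∈ D, ‖acceleration T u t x‖ ≤ M
  continuousOn_secondPartial : ∀ x ∈ D, ∀ a b k : Fin d,
    ContinuousOn (fun t => secondPartial a b (u t) x k) (Icc 0 T)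

section ContDiffOn

variable {u : ℝ → Vec d → Vec d} {t : ℝ} {x : Vec d}

/-- The derivative of a motion in space-time, relative to `[0, T] × D`. -/
noncomputable def spaceTimeFDeriv (D : Set (Vec d)) (T : ℝ) (u : ℝ → Vec d → Vec d) :
    ℝ × Vec d → ℝ × Vec d →L[ℝ] Vec d :=
  fderivWithin ℝ (Function.uncurry u) (Icc 0 T ×ˢ D)

/-- The second derivative of a motion in space-time, relative to `[0, T] × D`. -/
noncomputable def spaceTimeFDerivTwo (D : Set (Vec d)) (T : ℝ) (u : ℝ → Vec d → Vec d) :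
    ℝ × Vec d → ℝ × Vec d →L[ℝ] ℝ × Vec d →L[ℝ] Vec d :=
  fderivWithin ℝ (spaceTimeFDeriv D T u) (Icc 0 T ×ˢ D)

lemma contDiffOn_spaceTimeFDeriv (hD : IsOpen D) (hT : 0 < T)
    (hu : ContDiffOn ℝ 2 (Function.uncurry u) (Icc 0 T ×ˢ D)) :
    ContDiffOn ℝ 1 (spaceTimeFDeriv D T u) (Icc 0 T ×ˢ D) :=
  hu.fderivWithin ((uniqueDiffOn_Icc hT).prod hD.uniqueDiffOn) (by norm_num)

lemma hasFDerivWithinAt_uncurry (hu : ContDiffOn ℝ 2 (Function.uncurry u) (Icc 0 T ×ˢ D))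
    (ht : t ∈ Icc 0 T) (hx : x ∈ D) :
    HasFDerivWithinAt (Function.uncurry u) (spaceTimeFDeriv D T u (t, x)) (Icc 0 T ×ˢ D) (t, x) :=
  (hu.differentiableOn two_ne_zero (t, x) ⟨ht, hx⟩).hasFDerivWithinAt

lemma hasFDerivWithinAt_spaceTimeFDeriv (hD : IsOpen D) (hT : 0 < T)
    (hu : ContDiffOn ℝ 2 (Function.uncurry u) (Icc 0 T ×ˢ D)) (ht : t ∈ Icc 0 T) (hx : x ∈ D) :
    HasFDerivWithinAt (spaceTimeFDeriv D T u) (spaceTimeFDerivTwo D T u (t, x)) (Icc 0 T ×ˢ D)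
      (t, x) :=
  ((contDiffOn_spaceTimeFDeriv hD hT hu).differentiableOn one_ne_zero (t, x)
    ⟨ht, hx⟩).hasFDerivWithinAt

lemma hasFDerivAt_of_contDiffOn (hD : IsOpen D)
    (hu : ContDiffOn ℝ 2 (Function.uncurry u) (Icc 0 T ×ˢ D)) (ht : t ∈ Icc 0 T) (hx : x ∈ D) :
    HasFDerivAt (u t)
      ((spaceTimeFDeriv D T u (t, x)).comp (ContinuousLinearMap.inr ℝ ℝ (Vec d))) x :=
  hasFDerivAt_space hD ht hx (hasFDerivWithinAt_uncurry hu ht hx)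

lemma fderiv_fderiv_of_contDiffOn (hD : IsOpen D) (hT : 0 < T)
    (hu : ContDiffOn ℝ 2 (Function.uncurry u) (Icc 0 T ×ˢ D)) (ht : t ∈ Icc 0 T) (hx : x ∈ D)
    (v w : Vec d) :
    fderiv ℝ (fderiv ℝ (u t)) x v w = spaceTimeFDerivTwo D T u (t, x) (0, v) (0, w) := by
  have hDU := hasFDerivAt_space hD ht hx (hasFDerivWithinAt_spaceTimeFDeriv hD hT hu ht hx)
  let restrictSpace :=
    (ContinuousLinearMap.compL ℝ (Vec d) (ℝ × Vec d) (Vec d)).flip (.inr ℝ ℝ (Vec d))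
  have hcomp : fderiv ℝ (u t) =ᶠ[𝓝 x] fun y => restrictSpace (spaceTimeFDeriv D T u (t, y)) := by
    filter_upwards [hD.mem_nhds hx] with y hy
    exact (hasFDerivAt_of_contDiffOn hD hu ht hy).fderiv
  rw [((restrictSpace.hasFDerivAt.comp x hDU).congr_of_eventuallyEq hcomp).fderiv]
  rfl

lemma hasDerivWithinAt_of_contDiffOn (hT : 0 < T)
    (hu : ContDiffOn ℝ 2 (Function.uncurry u) (Icc 0 T ×ˢ D)) (ht : t ∈ Icc 0 T) (hx : x ∈ D) :
    HasDerivWithinAt (fun s => u s x) (velocity T u t x) (Icc 0 T) t ∧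
      velocity T u t x = spaceTimeFDeriv D T u (t, x) (1, 0) := by
  have h : HasDerivWithinAt (fun s => u s x) (spaceTimeFDeriv D T u (t, x) (1, 0)) (Icc 0 T) t :=
    hasDerivWithinAt_time hx (hasFDerivWithinAt_uncurry hu ht hx)
  have hvel : velocity T u t x = spaceTimeFDeriv D T u (t, x) (1, 0) :=
    h.derivWithin (uniqueDiffOn_Icc hT t ht)
  exact ⟨hvel ▸ h, hvel⟩

lemma hasDerivWithinAt_velocity_of_contDiffOn (hD : IsOpen D) (hT : 0 < T)
    (hu : ContDiffOn ℝ 2 (Function.uncurry u) (Icc 0 T ×ˢ D)) (ht : t ∈ Icc 0 T) (hx : x ∈ D) :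
    HasDerivWithinAt (fun s => velocity T u s x) (acceleration T u t x) (Icc 0 T) t ∧
      acceleration T u t x = spaceTimeFDerivTwo D T u (t, x) (1, 0) (1, 0) := by
  have hDU := hasDerivWithinAt_time hx (hasFDerivWithinAt_spaceTimeFDeriv hD hT hu ht hx)
  have hvel : ∀ s ∈ Icc 0 T, velocity T u s x = spaceTimeFDeriv D T u (s, x) (1, 0) := fun s hs =>
    (hasDerivWithinAt_of_contDiffOn hT hu hs hx).2
  have h : HasDerivWithinAt (fun s => velocity T u s x)
      (spaceTimeFDerivTwo D T u (t, x) (1, 0) (1, 0)) (Icc 0 T) t := by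
    simpa using (hDU.clm_apply (hasDerivWithinAt_const t (Icc 0 T) ((1 : ℝ), (0 : Vec d)))).congr
      hvel (hvel t ht)
  have hacc : acceleration T u t x = spaceTimeFDerivTwo D T u (t, x) (1, 0) (1, 0) :=
    h.derivWithin (uniqueDiffOn_Icc hT t ht)
  exact ⟨hacc ▸ h, hacc⟩

lemma exists_norm_fderivWithin_le (hD : IsOpen D) (hDb : Bornology.IsBounded D) (hT : 0 < T)
    (hu : ContDiffOn ℝ 2 (Function.uncurry u) (Icc 0 T ×ˢ closure D)) :
    ∃ M, 0 ≤ M ∧ ∀ t ∈ Icc 0 T, ∀ x ∈ D,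
      ‖u t x‖ ≤ M ∧ ‖spaceTimeFDeriv D T u (t, x)‖ ≤ M ∧ ‖spaceTimeFDerivTwo D T u (t, x)‖ ≤ M := by
  have hK : IsCompact (Icc 0 T ×ˢ closure D) := isCompact_Icc.prod hDb.isCompact_closure
  have hSK : Icc 0 T ×ˢ D ⊆ Icc 0 T ×ˢ closure D := prod_mono le_rfl subset_closure
  have hS : UniqueDiffOn ℝ (Icc 0 T ×ˢ D) := (uniqueDiffOn_Icc hT).prod hD.uniqueDiffOn
  obtain ⟨M₀, hM₀, h₀⟩ :=
    exists_norm_iteratedFDerivWithin_le (m := 0) hK hSK hS (hu.of_le (by norm_num))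
  obtain ⟨M₁, hM₁, h₁⟩ :=
    exists_norm_iteratedFDerivWithin_le (m := 1) hK hSK hS (hu.of_le (by norm_num))
  obtain ⟨M₂, hM₂, h₂⟩ :=
    exists_norm_iteratedFDerivWithin_le (m := 2) hK hSK hS (hu.of_le (by norm_num))
  refine ⟨M₀ + M₁ + M₂, by positivity, fun t ht x hx => ?_⟩
  have hz : (t, x) ∈ Icc 0 T ×ˢ D := ⟨ht, hx⟩
  have b₀ := h₀ (t, x) hz
  have b₁ := h₁ (t, x) hz
  have b₂ := h₂ (t, x) hz
  rw [norm_iteratedFDerivWithin_zero] at b₀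
  rw [norm_iteratedFDerivWithin_one _ (hS _ hz)] at b₁
  rw [← norm_iteratedFDerivWithin_fderivWithin hS hz,
    norm_iteratedFDerivWithin_one _ (hS _ hz)] at b₂
  exact ⟨b₀.trans (by linarith), b₁.trans (by linarith), b₂.trans (by linarith)⟩

theorem exists_isRegularMotion_of_contDiffOn (hD : IsOpen D) (hDb : Bornology.IsBounded D)
    (hT : 0 < T) (hu : ContDiffOn ℝ 2 (Function.uncurry u) (Icc 0 T ×ˢ closure D))
    (hbdry : ∀ t ∈ Icc 0 T, ∀ x ∈ frontier D, u t x = 0) :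
    ∃ M, 0 ≤ M ∧ IsRegularMotion D T M u := by
  obtain ⟨M, hM0, hM⟩ := exists_norm_fderivWithin_le hD hDb hT hu
  have hS : UniqueDiffOn ℝ (Icc 0 T ×ˢ D) := (uniqueDiffOn_Icc hT).prod hD.uniqueDiffOn
  have huS : ContDiffOn ℝ 2 (Function.uncurry u) (Icc 0 T ×ˢ D) :=
    hu.mono (prod_mono le_rfl subset_closure)
  have hD2U : ContinuousOn (spaceTimeFDerivTwo D T u) (Icc 0 T ×ˢ D) :=
    (contDiffOn_spaceTimeFDeriv hD hT huS).continuousOn_fderivWithin hS le_rfl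
  have h10 : ‖((1 : ℝ), (0 : Vec d))‖ ≤ 1 := by simp [Prod.norm_def]
  have hslice : ∀ t : ℝ, Continuous fun y : Vec d => (t, y) := fun t => by fun_prop
  refine ⟨M, hM0, ?_⟩
  exact {
    continuous := fun t ht => continuous_indicator (hbdry t ht)
      (hu.continuousOn.comp (hslice t).continuousOn fun y hy => ⟨ht, hy⟩)
    contDiffOn := fun t ht =>
      huS.comp (contDiff_prodMk_right t).contDiffOn fun y hy => ⟨ht, hy⟩
    norm_le := fun t ht x hx => (hM t ht x hx).1
    fderiv_le := fun t ht x hx => by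
      rw [(hasFDerivAt_of_contDiffOn hD huS ht hx).fderiv]
      refine ContinuousLinearMap.opNorm_le_bound _ hM0 fun v => ?_
      simpa [Prod.norm_def] using
        (spaceTimeFDeriv D T u (t, x)).le_of_opNorm_le (hM t ht x hx).2.1 ((0 : ℝ), v)
    fderiv_fderiv_le := fun t ht x hx => by
      refine ContinuousLinearMap.opNorm_le_bound₂ _ hM0 fun v w => ?_
      rw [fderiv_fderiv_of_contDiffOn hD hT huS ht hx]
      simpa [Prod.norm_def] using (spaceTimeFDerivTwo D T u (t, x)).le_of_opNorm₂_le_of_le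
        (hM t ht x hx).2.2 (le_refl ‖((0 : ℝ), v)‖) (le_refl ‖((0 : ℝ), w)‖)
    hasDerivWithinAt := fun t ht x hx => (hasDerivWithinAt_of_contDiffOn hT huS ht hx).1
    hasDerivWithinAt_velocity := fun t ht x hx =>
      (hasDerivWithinAt_velocity_of_contDiffOn hD hT huS ht hx).1
    velocity_le := fun t ht x hx => by
      rw [(hasDerivWithinAt_of_contDiffOn hT huS ht hx).2]
      exact (spaceTimeFDeriv D T u (t, x)).unit_le_opNorm _ h10 |>.trans (hM t ht x hx).2.1
    acceleration_le := fun t ht x hx => by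
      rw [(hasDerivWithinAt_velocity_of_contDiffOn hD hT huS ht hx).2]
      exact ((spaceTimeFDerivTwo D T u (t, x) (1, 0)).unit_le_opNorm _ h10).trans
        (((spaceTimeFDerivTwo D T u (t, x)).unit_le_opNorm _ h10).trans (hM t ht x hx).2.2)
    continuousOn_secondPartial := fun x hx a b k => by
      have hcont : ContinuousOn (fun t => spaceTimeFDerivTwo D T u (t, x)) (Icc 0 T) :=
        hD2U.comp (Continuous.prodMk_left x).continuousOn fun t ht => ⟨ht, hx⟩
      exact ((EuclideanSpace.proj k : Vec d →L[ℝ] ℝ).continuous.comp_continuousOn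
        ((hcont.clm_apply continuousOn_const).clm_apply continuousOn_const)).congr fun t ht =>
          congrArg (· k) (fderiv_fderiv_of_contDiffOn hD hT huS ht hx _ _) }

end ContDiffOn

namespace IsRegularMotion

variable {u v : ℝ → Vec d → Vec d} {M N t : ℝ} {x : Vec d}

lemma contDiffAt (hu : IsRegularMotion D T M u) (hD : IsOpen D) (ht : t ∈ Icc 0 T) (hx : x ∈ D) :
    ContDiffAt ℝ 2 (u t) x :=
  (hu.contDiffOn t ht).contDiffAt (hD.mem_nhds hx)

lemma isDirichletField (hu : IsRegularMotion D T M u) (hD : IsOpen D) (ht : t ∈ Icc 0 T) :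
    IsDirichletField D (D.indicator (u t)) := by
  refine ⟨hu.continuous t ht, fun x hx => indicator_of_notMem hx _,
    (hu.contDiffOn t ht).congr fun x hx => indicator_of_mem hx _, M, fun x hx => ?_⟩
  have h := indicator_eventuallyEq_of_isOpen hD (u t) hx
  rw [h.fderiv_eq, h.fderiv.fderiv_eq]
  exact ⟨hu.fderiv_le t ht x hx, hu.fderiv_fderiv_le t ht x hx⟩

lemma hasDerivWithinAt_sub (hu : IsRegularMotion D T M u) (hv : IsRegularMotion D T N v)
    (ht : t ∈ Icc 0 T) (hx : x ∈ D) :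
    HasDerivWithinAt (fun s => (u - v) s x) (velocity T u t x - velocity T v t x) (Icc 0 T) t :=
  (hu.hasDerivWithinAt t ht x hx).sub (hv.hasDerivWithinAt t ht x hx)

lemma velocity_sub (hu : IsRegularMotion D T M u) (hv : IsRegularMotion D T N v) (hT : 0 < T)
    (ht : t ∈ Icc 0 T) (hx : x ∈ D) :
    velocity T (u - v) t x = velocity T u t x - velocity T v t x :=
  (hu.hasDerivWithinAt_sub hv ht hx).derivWithin (uniqueDiffOn_Icc hT t ht)

lemma hasDerivWithinAt_velocity_sub (hu : IsRegularMotion D T M u) (hv : IsRegularMotion D T N v)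
    (hT : 0 < T) (ht : t ∈ Icc 0 T) (hx : x ∈ D) :
    HasDerivWithinAt (fun s => velocity T (u - v) s x)
      (acceleration T u t x - acceleration T v t x) (Icc 0 T) t :=
  ((hu.hasDerivWithinAt_velocity t ht x hx).sub (hv.hasDerivWithinAt_velocity t ht x hx)).congr
    (fun _ hs => hu.velocity_sub hv hT hs hx) (hu.velocity_sub hv hT ht hx)

lemma acceleration_sub (hu : IsRegularMotion D T M u) (hv : IsRegularMotion D T N v) (hT : 0 < T)
    (ht : t ∈ Icc 0 T) (hx : x ∈ D) :
    acceleration T (u - v) t x = acceleration T u t x - acceleration T v t x :=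
  (hu.hasDerivWithinAt_velocity_sub hv hT ht hx).derivWithin (uniqueDiffOn_Icc hT t ht)

end IsRegularMotion

lemma fderiv_fderiv_sub {v w : Vec d → Vec d} {x : Vec d} (hv : ContDiffAt ℝ 2 v x)
    (hw : ContDiffAt ℝ 2 w x) :
    fderiv ℝ (fderiv ℝ (v - w)) x = fderiv ℝ (fderiv ℝ v) x - fderiv ℝ (fderiv ℝ w) x := by
  have h : fderiv ℝ (v - w) =ᶠ[𝓝 x] fderiv ℝ v - fderiv ℝ w := by
    filter_upwards [hv.eventually (by simp), hw.eventually (by simp)] with y hy hy'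
    exact fderiv_sub (hy.differentiableAt two_ne_zero) (hy'.differentiableAt two_ne_zero)
  rw [h.fderiv_eq]
  exact fderiv_sub (differentiableAt_fderiv_of_contDiffAt hv)
    (differentiableAt_fderiv_of_contDiffAt hw)

lemma secondPartial_sub {v w : Vec d → Vec d} {x : Vec d} (hv : ContDiffAt ℝ 2 v x)
    (hw : ContDiffAt ℝ 2 w x) (a b k : Fin d) :
    secondPartial a b (v - w) x k = secondPartial a b v x k - secondPartial a b w x k := by
  simp only [secondPartial, fderiv_fderiv_sub hv hw, sub_apply, PiLp.sub_apply]

lemma elasticForce_sub (f J : ℝ → ℝ) {v w : Vec d → Vec d} {x : Vec d} (hv : ContDiffAt ℝ 2 v x)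
    (hw : ContDiffAt ℝ 2 w x) :
    elasticForce f J (v - w) x = elasticForce f J v x - elasticForce f J w x := by
  ext i
  rw [PiLp.sub_apply, elasticForce_apply f J hv, elasticForce_apply f J hw,
    elasticForce_apply f J (v := v - w) (hv.sub hw)]
  simp only [secondPartial_sub hv hw, mul_sub, Finset.sum_sub_distrib]

lemma IsRegularMotion.sub {u v : ℝ → Vec d → Vec d} {M N : ℝ} (hu : IsRegularMotion D T M u)
    (hv : IsRegularMotion D T N v) (hD : IsOpen D) (hT : 0 < T) :
    IsRegularMotion D T (M + N) (u - v) where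
  continuous t ht := by
    simpa only [Pi.sub_apply, indicator_sub'] using (hu.continuous t ht).sub (hv.continuous t ht)
  contDiffOn t ht := (hu.contDiffOn t ht).sub (hv.contDiffOn t ht)
  norm_le t ht x hx := norm_sub_le_of_le (hu.norm_le t ht x hx) (hv.norm_le t ht x hx)
  fderiv_le t ht x hx := by
    rw [Pi.sub_apply, fderiv_sub ((hu.contDiffAt hD ht hx).differentiableAt two_ne_zero)
      ((hv.contDiffAt hD ht hx).differentiableAt two_ne_zero)]
    exact norm_sub_le_of_le (hu.fderiv_le t ht x hx) (hv.fderiv_le t ht x hx)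
  fderiv_fderiv_le t ht x hx := by
    rw [Pi.sub_apply, fderiv_fderiv_sub (hu.contDiffAt hD ht hx) (hv.contDiffAt hD ht hx)]
    exact (norm_sub_le (fderiv ℝ (fderiv ℝ (u t)) x) (fderiv ℝ (fderiv ℝ (v t)) x)).trans
      (add_le_add (hu.fderiv_fderiv_le t ht x hx) (hv.fderiv_fderiv_le t ht x hx))
  hasDerivWithinAt t ht x hx := by
    rw [hu.velocity_sub hv hT ht hx]
    exact hu.hasDerivWithinAt_sub hv ht hx
  hasDerivWithinAt_velocity t ht x hx := by
    rw [hu.acceleration_sub hv hT ht hx]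
    exact hu.hasDerivWithinAt_velocity_sub hv hT ht hx
  velocity_le t ht x hx := by
    rw [hu.velocity_sub hv hT ht hx]
    exact norm_sub_le_of_le (hu.velocity_le t ht x hx) (hv.velocity_le t ht x hx)
  acceleration_le t ht x hx := by
    rw [hu.acceleration_sub hv hT ht hx]
    exact norm_sub_le_of_le (hu.acceleration_le t ht x hx) (hv.acceleration_le t ht x hx)
  continuousOn_secondPartial x hx a b k :=
    ((hu.continuousOn_secondPartial x hx a b k).sub
      (hv.continuousOn_secondPartial x hx a b k)).congr fun _ ht =>
        secondPartial_sub (hu.contDiffAt hD ht hx) (hv.contDiffAt hD ht hx) a b k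

end RegularMotion

section ElasticForce

variable {d : ℕ} (f J : ℝ → ℝ) {x : Vec d}

lemma norm_le_sum_norm_apply (v : Vec d) : ‖v‖ ≤ ∑ i, ‖v i‖ := by
  have h : v = ∑ i, v i • (EuclideanSpace.single i (1 : ℝ) : Vec d) := by
    ext i
    simp [Pi.single_apply]
  calc ‖v‖ = ‖∑ i, v i • (EuclideanSpace.single i (1 : ℝ) : Vec d)‖ := by rw [← h]
    _ ≤ ∑ i, ‖v i • (EuclideanSpace.single i (1 : ℝ) : Vec d)‖ := norm_sum_le _ _
    _ = ∑ i, ‖v i‖ := by simp [norm_smul]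

lemma exists_norm_elasticForce_le (d : ℕ) :
    ∃ c, 0 ≤ c ∧ ∀ (v : Vec d → Vec d) (x : Vec d), ContDiffAt ℝ 2 v x →
      ‖elasticForce f J v x‖ ≤ c * ‖fderiv ℝ (fderiv ℝ v) x‖ := by
  refine ⟨∑ i, ∑ j, ∑ k, ∑ l, ‖elasticTensor d f J i j k l‖, by positivity, fun v x hv => ?_⟩
  simp only [Finset.sum_mul]
  refine (norm_le_sum_norm_apply _).trans (Finset.sum_le_sum fun i _ => ?_)
  rw [elasticForce_apply f J hv]
  refine norm_sum_le_of_le _ fun j _ => norm_sum_le_of_le _ fun k _ =>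
    norm_sum_le_of_le _ fun l _ => ?_
  rw [norm_mul]
  gcongr
  exact norm_secondPartial_le v x j l k

lemma elasticForce_congr {v w : Vec d → Vec d} (h : v =ᶠ[𝓝 x] w) :
    elasticForce f J v x = elasticForce f J w x := by
  have hstress : ∀ i j,
      (fun z => stress f J v z i j) =ᶠ[𝓝 x] fun z => stress f J w z i j := fun i j => by
    filter_upwards [h.fderiv (𝕜 := ℝ)] with z hz
    simp only [stress, strain, partialDeriv, hz]
  simp only [elasticForce, partialDeriv, (hstress _ _).fderiv_eq]

lemma elasticForce_indicator {D : Set (Vec d)} (hD : IsOpen D) (v : Vec d → Vec d) (hx : x ∈ D) :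
    elasticForce f J (D.indicator v) x = elasticForce f J v x :=
  elasticForce_congr f J (indicator_eventuallyEq_of_isOpen hD v hx)

lemma ball_infDist_frontier_subset {E : Type*} [NormedAddCommGroup E] [NormedSpace ℝ E]
    {D : Set E} (hD : IsOpen D) {x : E} (hx : x ∈ D) :
    Metric.ball x (Metric.infDist x (frontier D)) ⊆ D := by
  rcases (Metric.infDist_nonneg (x := x) (s := frontier D)).eq_or_lt with h | h
  · simp [← h]
  · refine (convex_ball x _).isPreconnected.subset_left_of_subset_union hD
      (isOpen_interior (s := Dᶜ)) (disjoint_compl_right.mono_right interior_subset) ?_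
      ⟨x, Metric.mem_ball_self h, hx⟩
    have hball := Metric.ball_infDist_subset_compl (x := x) (s := frontier D)
    rwa [compl_frontier_eq_union_interior, hD.interior_eq] at hball

lemma nonlocalForce_indicator {D : Set (Vec d)} (hD : IsOpen D) {ε : ℝ} (hx : x ∈ D)
    (h : ε < Metric.infDist x (frontier D)) (g : Vec d → Vec d) :
    nonlocalForce f J ε (D.indicator g) x = nonlocalForce f J ε g x := by
  unfold nonlocalForce
  congr 1
  refine setIntegral_congr_fun measurableSet_ball fun y hy => ?_
  have hyD := ball_infDist_frontier_subset hD hx (Metric.ball_subset_ball h.le hy)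
  simp only [bondStrain, indicator_of_mem hx, indicator_of_mem hyD]

end ElasticForce

section TimeContinuity

variable {d : ℕ} {B : ℝ} {I : Set ℝ} {w : ℝ → Vec d → Vec d}

-- The second difference quotients converge to the Hessian uniformly in time.
lemma continuousOn_fderiv_fderiv_apply_self (hw : ∀ s ∈ I, HasBoundedDerivs B (w s))
    (hc : ∀ y, ContinuousOn (fun s => w s y) I) (x v : Vec d) :
    ContinuousOn (fun s => fderiv ℝ (fderiv ℝ (w s)) x v v) I := by
  let Δ : ℝ → ℝ → Vec d := fun h s =>
    (h ^ 2)⁻¹ • (w s (x + h • v) + w s (x - h • v) - (2 : ℝ) • w s x)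
  have hΔ : ∀ h, ContinuousOn (Δ h) I := fun h =>
    (((hc (x + h • v)).add (hc (x - h • v))).sub ((hc x).const_smul (2 : ℝ))).const_smul (h ^ 2)⁻¹
  have hdist : ∀ h > 0, ∀ s ∈ I,
      dist (fderiv ℝ (fderiv ℝ (w s)) x v v) (Δ h s) ≤ 2 * B * ‖v‖ ^ 3 * h := by
    intro h hh s hs
    have hsecond := norm_secondDifference_sub_le (hw s hs).nonneg (hw s hs).contDiff
      (hw s hs).lipschitz x (h • v)
    rw [map_smul, map_smul, smul_apply, smul_smul, ← sq, norm_smul,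
      Real.norm_of_nonneg hh.le] at hsecond
    have hscale : Δ h s - fderiv ℝ (fderiv ℝ (w s)) x v v = (h ^ 2)⁻¹ •
        (w s (x + h • v) + w s (x - h • v) - (2 : ℝ) • w s x
          - h ^ 2 • fderiv ℝ (fderiv ℝ (w s)) x v v) := by
      rw [smul_sub _ _ (h ^ 2 • _), inv_smul_smul₀ (by positivity)]
    rw [dist_comm, dist_eq_norm, hscale, norm_smul, Real.norm_of_nonneg (by positivity),
      inv_mul_le_iff₀ (by positivity)]
    exact hsecond.trans_eq (by ring)
  have hunif : TendstoUniformlyOn Δ (fun s => fderiv ℝ (fderiv ℝ (w s)) x v v) (𝓝[>] 0) I := by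
    refine Metric.tendstoUniformlyOn_iff.2 fun η hη => ?_
    have hlim : Tendsto (fun h : ℝ => 2 * B * ‖v‖ ^ 3 * h) (𝓝[>] 0) (𝓝 0) :=
      ((continuous_const.mul continuous_id).tendsto' 0 0 (mul_zero _)).mono_left
        nhdsWithin_le_nhds
    filter_upwards [hlim.eventually_lt_const hη, self_mem_nhdsWithin] with h hhη hh s hs
    exact (hdist h hh s hs).trans_lt hhη
  exact hunif.continuousOn (Eventually.of_forall hΔ).frequently

lemma continuousOn_secondPartial_of_hasBoundedDerivs (hw : ∀ s ∈ I, HasBoundedDerivs B (w s))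
    (hc : ∀ y, ContinuousOn (fun s => w s y) I) (x : Vec d) (a b k : Fin d) :
    ContinuousOn (fun s => secondPartial a b (w s) x k) I := by
  let p : Vec d := EuclideanSpace.single a 1 + EuclideanSpace.single b 1
  let m : Vec d := EuclideanSpace.single a 1 - EuclideanSpace.single b 1
  have hpolar : ∀ s ∈ I, secondPartial a b (w s) x k = ((4 : ℝ)⁻¹ •
      (fderiv ℝ (fderiv ℝ (w s)) x p p - fderiv ℝ (fderiv ℝ (w s)) x m m)) k := fun s hs => by
    have hsymm := ((hw s hs).contDiff.contDiffAt (x := x)).isSymmSndFDerivAt (by simp)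
      (EuclideanSpace.single b 1) (EuclideanSpace.single a 1)
    simp only [secondPartial, p, m, map_add, map_sub, add_apply, sub_apply, hsymm,
      PiLp.smul_apply, PiLp.sub_apply, PiLp.add_apply, smul_eq_mul]
    ring
  exact ((EuclideanSpace.proj k : Vec d →L[ℝ] ℝ).continuous.comp_continuousOn
    (((continuousOn_fderiv_fderiv_apply_self hw hc x p).sub
      (continuousOn_fderiv_fderiv_apply_self hw hc x m)).const_smul (4 : ℝ)⁻¹)).congr hpolar

lemma norm_le_of_hasDerivWithinAt_Icc {E : Type*} [NormedAddCommGroup E] [NormedSpace ℝ E]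
    {F F' : ℝ → E} {A M T t : ℝ} (hF : ∀ s ∈ Icc 0 T, HasDerivWithinAt F (F' s) (Icc 0 T) s)
    (hA : ∀ s ∈ Icc 0 T, ‖F' s‖ ≤ A) (hM : ‖F 0‖ ≤ M) (ht : t ∈ Icc 0 T) :
    ‖F t‖ ≤ M + A * T := by
  have h0 : (0 : ℝ) ∈ Icc 0 T := ⟨le_rfl, ht.1.trans ht.2⟩
  have hA0 : 0 ≤ A := (norm_nonneg _).trans (hA 0 h0)
  have hsub : ‖F t - F 0‖ ≤ A * T := by
    refine ((convex_Icc 0 T).norm_image_sub_le_of_norm_hasDerivWithin_le hF hA h0 ht).trans ?_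
    rw [sub_zero, Real.norm_of_nonneg ht.1]
    exact mul_le_mul_of_nonneg_left ht.2 hA0
  calc ‖F t‖ = ‖F 0 + (F t - F 0)‖ := by rw [add_sub_cancel]
    _ ≤ M + A * T := norm_add_le_of_le hM hsub

end TimeContinuity

section Peridynamic

variable {d : ℕ} {D : Set (Vec d)} {T ρ C ε R : ℝ} {f J : ℝ → ℝ} {b : ℝ → Vec d → Vec d}
  {u₀ v₀ : Vec d → Vec d} {u w : ℝ → Vec d → Vec d} {t : ℝ} {x : Vec d}

lemma exists_norm_sub_frontier_le (hDb : Bornology.IsBounded D) :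
    ∃ R, 0 ≤ R ∧ ∀ x ∈ D, ∀ p ∈ frontier D, ‖x - p‖ ≤ R :=
  ⟨Metric.diam (closure D), Metric.diam_nonneg, fun x hx p hp => by
    rw [← dist_eq_norm]
    exact Metric.dist_le_diam_of_mem hDb.closure (subset_closure hx) (frontier_subset_closure hp)⟩

lemma le_of_lt_infDist_frontier (hd : 0 < d) (hDb : Bornology.IsBounded D)
    (hR : ∀ x ∈ D, ∀ p ∈ frontier D, ‖x - p‖ ≤ R) (hx : x ∈ D)
    (h : ε < Metric.infDist x (frontier D)) : ε ≤ R := by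
  obtain ⟨p, hp, hdist⟩ := exists_frontier_infDist_eq hd hDb hx
  exact (hdist ▸ h.le).trans (hR x hx p hp)

lemma exists_norm_nonlocalForce_sub_elasticForce_le_of_isCollarField (hd : 0 < d)
    (hf : ContDiffOn ℝ 2 f (Ici 0)) (hJ : IsInfluence J) (hD : IsOpen D)
    (hDb : Bornology.IsBounded D) (C : ℝ) :
    ∃ K, 0 ≤ K ∧ ∀ ε, 0 < ε → ∀ g, IsCollarField D C ε g → ∀ x ∈ D,
      ε < Metric.infDist x (frontier D) →
        ‖nonlocalForce f J ε g x - elasticForce f J g x‖ ≤ K * ε := by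
  obtain ⟨R, hR0, hR⟩ := exists_norm_sub_frontier_le hDb
  have hB : 0 ≤ collarBound C R := by
    unfold collarBound
    positivity
  obtain ⟨K, hK, hcons⟩ := exists_norm_nonlocalForce_sub_elasticForce_le d hf hJ hB R
  refine ⟨K, hK, fun ε hε g hg x hx h => ?_⟩
  rw [← nonlocalForce_indicator f J hD hx h, ← elasticForce_indicator f J hD g hx]
  exact hcons ε hε (le_of_lt_infDist_frontier hd hDb hR hx h) _
    (hg.hasBoundedDerivs hd hD hDb hε hR0 hR) x

lemma exists_norm_nonlocalForce_le_of_isCollarField (hd : 0 < d)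
    (hf : ContDiffOn ℝ 2 f (Ici 0)) (hJ : IsInfluence J) (hD : IsOpen D)
    (hDb : Bornology.IsBounded D) (C : ℝ) :
    ∃ F, 0 ≤ F ∧ ∀ ε, 0 < ε → ∀ g, IsCollarField D C ε g → ∀ x ∈ D,
      ε < Metric.infDist x (frontier D) → ‖nonlocalForce f J ε g x‖ ≤ F := by
  obtain ⟨R, hR0, hR⟩ := exists_norm_sub_frontier_le hDb
  obtain ⟨K, hK, hcons⟩ :=
    exists_norm_nonlocalForce_sub_elasticForce_le_of_isCollarField hd hf hJ hD hDb C
  obtain ⟨c, hc, hforce⟩ := exists_norm_elasticForce_le f J d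
  have hB : 0 ≤ collarBound C R := by
    unfold collarBound
    positivity
  refine ⟨c * collarBound C R + K * R, by positivity, fun ε hε g hg x hx h => ?_⟩
  have hbd := hg.hasBoundedDerivs hd hD hDb hε hR0 hR
  have helastic : ‖elasticForce f J g x‖ ≤ c * collarBound C R := by
    rw [← elasticForce_indicator f J hD g hx]
    exact (hforce _ x hbd.contDiff.contDiffAt).trans
      (mul_le_mul_of_nonneg_left (hbd.fderiv_fderiv_le x) hc)
  have hdiff : ‖nonlocalForce f J ε g x - elasticForce f J g x‖ ≤ K * R :=
    (hcons ε hε g hg x hx h).trans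
      (mul_le_mul_of_nonneg_left (le_of_lt_infDist_frontier hd hDb hR hx h) hK)
  simpa only [add_sub_cancel] using norm_add_le_of_le helastic hdiff

lemma IsElastodynamicSolution.norm_bodyForce_le {c M : ℝ} (hc : 0 ≤ c)
    (hforce : ∀ (v : Vec d → Vec d) (x : Vec d), ContDiffAt ℝ 2 v x →
      ‖elasticForce f J v x‖ ≤ c * ‖fderiv ℝ (fderiv ℝ v) x‖)
    (hsol : IsElastodynamicSolution f J D T ρ b u₀ v₀ u) (hu : IsRegularMotion D T M u)
    (hD : IsOpen D) (hρ : 0 ≤ ρ) (ht : t ∈ Icc 0 T) (hx : x ∈ D) :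
    ‖b t x‖ ≤ ρ * M + c * M := by
  rw [eq_sub_of_add_eq' (hsol.equation t ht x hx).symm]
  refine norm_sub_le_of_le ?_ ?_
  · rw [norm_smul, Real.norm_of_nonneg hρ]
    exact mul_le_mul_of_nonneg_left (hu.acceleration_le t ht x hx) hρ
  · exact (hforce _ x (hu.contDiffAt hD ht hx)).trans
      (mul_le_mul_of_nonneg_left (hu.fderiv_fderiv_le t ht x hx) hc)

namespace IsPeridynamicSolution

lemma velocity_eq_zero (hw : IsPeridynamicSolution f J D T ρ ε b u₀ v₀ w)
    (h : Metric.infDist x (frontier D) ≤ ε) (ht : t ∈ Icc 0 T) : velocity T w t x = 0 :=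
  (derivWithin_congr (fun s hs => hw.boundary s hs x h) (hw.boundary t ht x h)).trans
    (by simp)

lemma acceleration_eq_zero (hw : IsPeridynamicSolution f J D T ρ ε b u₀ v₀ w)
    (h : Metric.infDist x (frontier D) ≤ ε) (ht : t ∈ Icc 0 T) : acceleration T w t x = 0 :=
  (derivWithin_congr (fun _ hs => hw.velocity_eq_zero h hs) (hw.velocity_eq_zero h ht)).trans
    (by simp)

lemma norm_acceleration_le (hw : IsPeridynamicSolution f J D T ρ ε b u₀ v₀ w) (hρ : 0 < ρ)
    {F G : ℝ} (hF : ‖nonlocalForce f J ε (w t) x‖ ≤ F) (hG : ‖b t x‖ ≤ G) (ht : t ∈ Icc 0 T)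
    (hx : x ∈ D) (h : ε < Metric.infDist x (frontier D)) :
    ‖acceleration T w t x‖ ≤ ρ⁻¹ * (F + G) := by
  rw [le_inv_mul_iff₀ hρ]
  calc ρ * ‖acceleration T w t x‖ = ‖ρ • acceleration T w t x‖ := by
        rw [norm_smul, Real.norm_of_nonneg hρ.le]
    _ ≤ F + G := by
        rw [hw.equation t ht x hx h]
        exact norm_add_le_of_le hF hG

lemma hasDerivWithinAt (hw : IsPeridynamicSolution f J D T ρ ε b u₀ v₀ w) (ht : t ∈ Icc 0 T)
    (hx : x ∈ D) : HasDerivWithinAt (fun s => w s x) (velocity T w t x) (Icc 0 T) t :=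
  ((hw.regular x hx).differentiableOn two_ne_zero t ht).hasDerivWithinAt

lemma hasDerivWithinAt_velocity (hw : IsPeridynamicSolution f J D T ρ ε b u₀ v₀ w) (hT : 0 < T)
    (ht : t ∈ Icc 0 T) (hx : x ∈ D) :
    HasDerivWithinAt (fun s => velocity T w s x) (acceleration T w t x) (Icc 0 T) t :=
  (((hw.regular x hx).derivWithin (uniqueDiffOn_Icc hT) (m := 1) (by norm_num)).differentiableOn
    one_ne_zero t ht).hasDerivWithinAt

lemma isRegularMotion (hw : IsPeridynamicSolution f J D T ρ ε b u₀ v₀ w)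
    (hcol : ∀ t ∈ Icc 0 T, IsCollarField D C ε (w t)) (hd : 0 < d) (hD : IsOpen D)
    (hDb : Bornology.IsBounded D) (hT : 0 < T) (hε : 0 < ε) (hR0 : 0 ≤ R)
    (hR : ∀ x ∈ D, ∀ p ∈ frontier D, ‖x - p‖ ≤ R) {A M N : ℝ}
    (hA : ∀ t ∈ Icc 0 T, ∀ x ∈ D, ‖acceleration T w t x‖ ≤ A)
    (hM : ∀ x ∈ D, ‖velocity T w 0 x‖ ≤ M) (hBN : collarBound C R ≤ N) (hAN : A ≤ N)
    (hMN : M + A * T ≤ N) : IsRegularMotion D T N w := by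
  have hbd := fun t ht => (hcol t ht).hasBoundedDerivs hd hD hDb hε hR0 hR
  have hloc := fun t x (hx : x ∈ D) => indicator_eventuallyEq_of_isOpen hD (w t) hx
  have hcont : ∀ y, ContinuousOn (fun s => D.indicator (w s) y) (Icc 0 T) := fun y => by
    by_cases hy : y ∈ D
    · simpa only [indicator_of_mem hy] using (hw.regular y hy).continuousOn
    · simpa only [indicator_of_notMem hy] using continuousOn_const
  exact {
    continuous := fun t ht => (hbd t ht).contDiff.continuous
    contDiffOn := fun t ht => (hcol t ht).contDiffOn.of_le (by norm_num)
    norm_le := fun t ht x hx => by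
      rw [← (hloc t x hx).eq_of_nhds, ← norm_iteratedFDeriv_zero (𝕜 := ℝ)]
      exact ((hcol t ht).norm_iteratedFDeriv_le_collarBound hd hD hDb hε hR0 hR
        (by norm_num) x).trans hBN
    fderiv_le := fun t ht x hx => by
      rw [← (hloc t x hx).fderiv_eq]
      exact ((hbd t ht).fderiv_le x).trans hBN
    fderiv_fderiv_le := fun t ht x hx => by
      rw [← (hloc t x hx).fderiv.fderiv_eq]
      exact ((hbd t ht).fderiv_fderiv_le x).trans hBN
    hasDerivWithinAt := fun t ht x hx => hw.hasDerivWithinAt ht hx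
    hasDerivWithinAt_velocity := fun t ht x hx => hw.hasDerivWithinAt_velocity hT ht hx
    velocity_le := fun t ht x hx =>
      (norm_le_of_hasDerivWithinAt_Icc (fun s hs => hw.hasDerivWithinAt_velocity hT hs hx)
        (fun s hs => hA s hs x hx) (hM x hx) ht).trans hMN
    acceleration_le := fun t ht x hx => (hA t ht x hx).trans hAN
    continuousOn_secondPartial := fun x hx a b k =>
      (continuousOn_secondPartial_of_hasBoundedDerivs hbd hcont x a b k).congr fun s _ => by
        simp only [secondPartial, (hloc s x hx).fderiv.fderiv_eq] }

end IsPeridynamicSolution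

/-- Peridynamic solutions of horizon `ε` with bounded fourth spatial derivatives, together with
the two bounds that hold uniformly in `ε`: they are regular motions with constant `N`, and off the
collar the nonlocal force differs from the elastic force by at most `K ε`. -/
structure IsRegularApproximation (f J : ℝ → ℝ) (D : Set (Vec d)) (T ρ : ℝ)
    (b : ℝ → Vec d → Vec d) (u₀ v₀ : Vec d → Vec d) (C N K ε : ℝ) (w : ℝ → Vec d → Vec d) : Prop
    extends IsPeridynamicSolution f J D T ρ ε b u₀ v₀ w, IsRegularMotion D T N w where
  pos : 0 < ε
  isCollarField : ∀ t ∈ Icc 0 T, IsCollarField D C ε (w t)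
  consistency : ∀ t ∈ Icc 0 T, ∀ x ∈ D, ε < Metric.infDist x (frontier D) →
    ‖nonlocalForce f J ε (w t) x - elasticForce f J (w t) x‖ ≤ K * ε

theorem exists_isRegularApproximation (hd : 0 < d) (hf : ContDiffOn ℝ 2 f (Ici 0))
    (hJ : IsInfluence J) (hD : IsOpen D) (hDb : Bornology.IsBounded D) (hT : 0 < T) (hρ : 0 < ρ)
    {M : ℝ} (hM : 0 ≤ M) (hu : IsRegularMotion D T M u)
    (hsol : IsElastodynamicSolution f J D T ρ b u₀ v₀ u) (C : ℝ) :
    ∃ N K, 0 ≤ N ∧ 0 ≤ K ∧ ∀ ε, 0 < ε → ∀ w, IsPeridynamicSolution f J D T ρ ε b u₀ v₀ w →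
      (∀ t ∈ Icc 0 T, IsCollarField D C ε (w t)) →
      IsRegularApproximation f J D T ρ b u₀ v₀ C N K ε w := by
  obtain ⟨R, hR0, hR⟩ := exists_norm_sub_frontier_le hDb
  obtain ⟨K, hK, hcons⟩ :=
    exists_norm_nonlocalForce_sub_elasticForce_le_of_isCollarField hd hf hJ hD hDb C
  obtain ⟨F, hF0, hF⟩ := exists_norm_nonlocalForce_le_of_isCollarField hd hf hJ hD hDb C
  obtain ⟨c, hc, hforce⟩ := exists_norm_elasticForce_le f J d
  set B := collarBound C R
  have hB : 0 ≤ B := by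
    simp only [B, collarBound]
    positivity
  set A := ρ⁻¹ * (F + (ρ * M + c * M))
  have hA0 : 0 ≤ A := by positivity
  have hAT : 0 ≤ A * T := by positivity
  refine ⟨B + (M + A * T) + A, K, by positivity, hK, fun ε hε w hw hcol => ?_⟩
  have hA : ∀ t ∈ Icc 0 T, ∀ x ∈ D, ‖acceleration T w t x‖ ≤ A := fun t ht x hx => by
    rcases lt_or_ge ε (Metric.infDist x (frontier D)) with h | h
    · exact hw.norm_acceleration_le hρ (hF ε hε _ (hcol t ht) x hx h)
        (hsol.norm_bodyForce_le hc hforce hu hD hρ.le ht hx) ht hx h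
    · rwa [hw.acceleration_eq_zero h ht, norm_zero]
  have hv₀ : ∀ x ∈ D, ‖velocity T w 0 x‖ ≤ M := fun x hx => by
    rw [hw.initial_velocity x hx, ← hsol.initial_velocity x hx]
    exact hu.velocity_le 0 ⟨le_rfl, hT.le⟩ x hx
  exact {
    toIsPeridynamicSolution := hw
    toIsRegularMotion := hw.isRegularMotion hcol hd hD hDb hT hε hR0 hR hA hv₀
      (by linarith) (by linarith) (by linarith)
    pos := hε
    isCollarField := hcol
    consistency := fun t ht x hx h => hcons ε hε _ (hcol t ht) x hx h }

end Peridynamic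

section DerivIntegral

variable {X E : Type*} [NormedAddCommGroup E] [NormedSpace ℝ E] {T t : ℝ}

lemma nhdsWithin_Icc_diff_neBot (hT : 0 < T) (ht : t ∈ Icc 0 T) : (𝓝[Icc 0 T \ {t}] t).NeBot :=
  accPt_principal_iff_nhdsWithin.1 (uniqueDiffOn_Icc hT t ht).accPt

lemma norm_slope_le_of_hasDerivWithinAt {F F' : ℝ → E} {C s : ℝ}
    (hF : ∀ r ∈ Icc 0 T, HasDerivWithinAt F (F' r) (Icc 0 T) r) (hC : ∀ r ∈ Icc 0 T, ‖F' r‖ ≤ C)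
    (hs : s ∈ Icc 0 T) (ht : t ∈ Icc 0 T) : ‖slope F t s‖ ≤ C := by
  rcases eq_or_ne s t with rfl | hst
  · simpa using (norm_nonneg _).trans (hC s hs)
  · rw [slope_def_module, norm_smul, norm_inv,
      inv_mul_le_iff₀ (norm_pos_iff.2 (sub_ne_zero.2 hst)), mul_comm]
    exact (convex_Icc 0 T).norm_image_sub_le_of_norm_hasDerivWithin_le hF hC ht hs

variable [MeasurableSpace X] {μ : Measure X} {D : Set X}

lemma aestronglyMeasurable_slope {F : ℝ → X → E} {s : ℝ}
    (hs : AEStronglyMeasurable (F s) (μ.restrict D))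
    (ht : AEStronglyMeasurable (F t) (μ.restrict D)) :
    AEStronglyMeasurable (fun x => slope (fun r => F r x) t s) (μ.restrict D) :=
  (hs.sub ht).const_smul (s - t)⁻¹

lemma aestronglyMeasurable_of_hasDerivWithinAt (hD : MeasurableSet D) (hT : 0 < T)
    {F : ℝ → X → E} {F' : X → E} (ht : t ∈ Icc 0 T)
    (hF : ∀ s ∈ Icc 0 T, AEStronglyMeasurable (F s) (μ.restrict D))
    (hF' : ∀ x ∈ D, HasDerivWithinAt (fun s => F s x) (F' x) (Icc 0 T) t) :
    AEStronglyMeasurable F' (μ.restrict D) := by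
  have := nhdsWithin_Icc_diff_neBot hT ht
  refine aestronglyMeasurable_of_tendsto_ae (𝓝[Icc 0 T \ {t}] t)
    (f := fun s x => slope (fun r => F r x) t (projIcc 0 T hT.le s))
    (fun s => aestronglyMeasurable_slope (hF _ (projIcc 0 T hT.le s).2) (hF t ht))
    (ae_restrict_of_forall_mem hD fun x hx => ?_)
  refine (hasDerivWithinAt_iff_tendsto_slope.1 (hF' x hx)).congr' ?_
  filter_upwards [self_mem_nhdsWithin] with s hs
  rw [projIcc_of_mem hT.le hs.1]

lemma hasDerivWithinAt_setIntegral (hD : MeasurableSet D) (hμ : μ D ≠ ⊤) {g g' : ℝ → X → E}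
    {C : ℝ} (hg : ∀ s ∈ Icc 0 T, IntegrableOn (g s) D μ)
    (hg' : ∀ s ∈ Icc 0 T, ∀ x ∈ D, HasDerivWithinAt (fun r => g r x) (g' s x) (Icc 0 T) s)
    (hC : ∀ s ∈ Icc 0 T, ∀ x ∈ D, ‖g' s x‖ ≤ C) (ht : t ∈ Icc 0 T) :
    HasDerivWithinAt (fun s => ∫ x in D, g s x ∂μ) (∫ x in D, g' t x ∂μ) (Icc 0 T) t := by
  have : IsFiniteMeasure (μ.restrict D) := isFiniteMeasure_restrict.2 hμ
  have hslope : ∀ᶠ s in 𝓝[Icc 0 T \ {t}] t, ∫ x in D, slope (fun r => g r x) t s ∂μ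
      = slope (fun r => ∫ x in D, g r x ∂μ) t s := by
    filter_upwards [self_mem_nhdsWithin] with s hs
    simp only [slope_def_module]
    rw [integral_smul, integral_sub (hg s hs.1) (hg t ht)]
  rw [hasDerivWithinAt_iff_tendsto_slope]
  refine Tendsto.congr' hslope (tendsto_integral_filter_of_norm_le_const ?_ ⟨C, ?_⟩ ?_)
  · filter_upwards [self_mem_nhdsWithin] with s hs
    exact aestronglyMeasurable_slope (hg s hs.1).aestronglyMeasurable
      (hg t ht).aestronglyMeasurable
  · filter_upwards [self_mem_nhdsWithin] with s hs
    exact ae_restrict_of_forall_mem hD fun x hx =>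
      norm_slope_le_of_hasDerivWithinAt (fun r hr => hg' r hr x hx) (fun r hr => hC r hr x hx)
        hs.1 ht
  · exact ae_restrict_of_forall_mem hD fun x hx =>
      hasDerivWithinAt_iff_tendsto_slope.1 (hg' t ht x hx)

lemma le_mul_exp_of_hasDerivWithinAt_le {G G' : ℝ → ℝ} {c k : ℝ} (hc : 0 ≤ c) (hk : 0 < k)
    (hG : ∀ s ∈ Icc 0 T, HasDerivWithinAt G (G' s) (Icc 0 T) s) (h0 : G 0 ≤ 0)
    (hG' : ∀ s ∈ Icc 0 T, G' s ≤ k * G s + c) (ht : t ∈ Icc 0 T) :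
    G t ≤ c / k * Real.exp (k * T) := by
  have hgronwall := le_gronwallBound_of_liminf_deriv_right_le
    (fun s hs => (hG s hs).continuousWithinAt)
    (fun s hs r hr => ((hG s (Ico_subset_Icc_self hs)).mono_of_mem_nhdsWithin
      (Icc_mem_nhdsGE_of_mem hs)).liminf_right_slope_le hr) h0
    (fun s hs => hG' s (Ico_subset_Icc_self hs)) t ht
  simp only [gronwallBound_of_K_ne_0 hk.ne', zero_mul, zero_add, sub_zero] at hgronwall
  refine hgronwall.trans (mul_le_mul_of_nonneg_left ?_ (by positivity))
  have hexp : Real.exp (k * t) ≤ Real.exp (k * T) :=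
    Real.exp_le_exp.2 (mul_le_mul_of_nonneg_left ht.2 hk.le)
  linarith

end DerivIntegral

section Energy

variable {d : ℕ} {D : Set (Vec d)} {T M β ρ s t : ℝ} {f J : ℝ → ℝ} {e : ℝ → Vec d → Vec d}

lemma continuousOn_elasticForce_of_secondPartial (f J : ℝ → ℝ) {Y : Type*} [TopologicalSpace Y]
    {S : Set Y} {v : Y → Vec d → Vec d} {x : Y → Vec d}
    (hv : ∀ y ∈ S, ContDiffAt ℝ 2 (v y) (x y))
    (hc : ∀ a b k, ContinuousOn (fun y => secondPartial a b (v y) (x y) k) S) :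
    ContinuousOn (fun y => elasticForce f J (v y) (x y)) S := by
  have h : ContinuousOn (fun y => WithLp.toLp 2 fun i => ∑ j, ∑ k, ∑ l,
      elasticTensor d f J i j k l * secondPartial j l (v y) (x y) k) S :=
    (PiLp.continuous_toLp 2 fun _ : Fin d => ℝ).comp_continuousOn <|
      continuousOn_pi.2 fun i => continuousOn_finsetSum _ fun j _ =>
        continuousOn_finsetSum _ fun k _ => continuousOn_finsetSum _ fun l _ =>
          continuousOn_const.mul (hc j l k)
  refine h.congr fun y hy => ?_
  ext i
  exact elasticForce_apply f J (hv y hy) i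

lemma energyPairing_indicator (hD : IsOpen D) (v w : Vec d → Vec d) {x : Vec d} (hx : x ∈ D) :
    energyPairing (D.indicator v) (D.indicator w) x = energyPairing v w x := by
  simp only [energyPairing, partialDeriv, (indicator_eventuallyEq_of_isOpen hD v hx).fderiv_eq,
    (indicator_eventuallyEq_of_isOpen hD w hx).fderiv_eq]

lemma integrableOn_inner_of_forall_norm_le (hD : IsOpen D) (hDb : Bornology.IsBounded D)
    {F G : Vec d → Vec d} {A B : ℝ} (hF : AEStronglyMeasurable F (volume.restrict D))
    (hG : AEStronglyMeasurable G (volume.restrict D)) (hA : ∀ x ∈ D, ‖F x‖ ≤ A)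
    (hB : ∀ x ∈ D, ‖G x‖ ≤ B) : IntegrableOn (fun x => inner ℝ (F x) (G x)) D :=
  integrableOn_of_forall_norm_le (M := A * B) hD hDb (hF.inner hG) fun x hx =>
    (norm_inner_le_norm _ _).trans
      (mul_le_mul (hA x hx) (hB x hx) (norm_nonneg _) ((norm_nonneg _).trans (hA x hx)))

lemma integrableOn_norm_sq_of_forall_norm_le (hD : IsOpen D) (hDb : Bornology.IsBounded D)
    {F : Vec d → Vec d} {A : ℝ} (hF : AEStronglyMeasurable F (volume.restrict D))
    (hA : ∀ x ∈ D, ‖F x‖ ≤ A) : IntegrableOn (fun x => ‖F x‖ ^ 2) D := by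
  simpa only [real_inner_self_eq_norm_sq]
    using integrableOn_inner_of_forall_norm_le hD hDb hF hF hA hA

lemma hasDerivWithinAt_integral_norm_sq (hD : IsOpen D) (hDb : Bornology.IsBounded D)
    {F F' : ℝ → Vec d → Vec d} {A : ℝ}
    (hF : ∀ r ∈ Icc 0 T, AEStronglyMeasurable (F r) (volume.restrict D))
    (hF' : ∀ r ∈ Icc 0 T, ∀ x ∈ D, HasDerivWithinAt (fun q => F q x) (F' r x) (Icc 0 T) r)
    (hA : ∀ r ∈ Icc 0 T, ∀ x ∈ D, ‖F r x‖ ≤ A) (hA' : ∀ r ∈ Icc 0 T, ∀ x ∈ D, ‖F' r x‖ ≤ A)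
    (ht : t ∈ Icc 0 T) :
    HasDerivWithinAt (fun r => ∫ x in D, ‖F r x‖ ^ 2) (∫ x in D, 2 * inner ℝ (F t x) (F' t x))
      (Icc 0 T) t := by
  refine hasDerivWithinAt_setIntegral (C := 2 * (A * A)) hD.measurableSet hDb.measure_lt_top.ne
    (fun r hr => integrableOn_norm_sq_of_forall_norm_le hD hDb (hF r hr) (hA r hr))
    (fun r hr x hx => (hF' r hr x hx).norm_sq) (fun r hr x hx => ?_) ht
  rw [norm_mul, Real.norm_two]
  refine mul_le_mul_of_nonneg_left ((norm_inner_le_norm _ _).trans ?_) two_pos.le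
  exact mul_le_mul (hA r hr x hx) (hA' r hr x hx) (norm_nonneg _)
    ((norm_nonneg _).trans (hA r hr x hx))

/-- The total energy of a motion, augmented by its mean square displacement; `β` is the Lamé
constant. -/
noncomputable def energy (D : Set (Vec d)) (T ρ β : ℝ) (e : ℝ → Vec d → Vec d) (t : ℝ) : ℝ :=
  ρ * ((∫ x in D, ‖e t x‖ ^ 2) + ∫ x in D, ‖velocity T e t x‖ ^ 2)
    + β * ∫ x in D, energyPairing (e t) (e t) x

namespace IsRegularMotion

lemma aestronglyMeasurable (he : IsRegularMotion D T M e) (hD : IsOpen D) (ht : t ∈ Icc 0 T) :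
    AEStronglyMeasurable (e t) (volume.restrict D) :=
  (he.contDiffOn t ht).continuousOn.aestronglyMeasurable hD.measurableSet

lemma aestronglyMeasurable_velocity (he : IsRegularMotion D T M e) (hD : IsOpen D) (hT : 0 < T)
    (ht : t ∈ Icc 0 T) : AEStronglyMeasurable (velocity T e t) (volume.restrict D) :=
  aestronglyMeasurable_of_hasDerivWithinAt hD.measurableSet hT ht
    (fun _ hs => he.aestronglyMeasurable hD hs) (he.hasDerivWithinAt t ht)

lemma aestronglyMeasurable_acceleration (he : IsRegularMotion D T M e) (hD : IsOpen D)
    (hT : 0 < T) (ht : t ∈ Icc 0 T) :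
    AEStronglyMeasurable (acceleration T e t) (volume.restrict D) :=
  aestronglyMeasurable_of_hasDerivWithinAt hD.measurableSet hT ht
    (fun _ hs => he.aestronglyMeasurable_velocity hD hT hs) (he.hasDerivWithinAt_velocity t ht)

lemma aestronglyMeasurable_elasticForce (he : IsRegularMotion D T M e) (f J : ℝ → ℝ)
    (hD : IsOpen D) (ht : t ∈ Icc 0 T) :
    AEStronglyMeasurable (elasticForce f J (e t)) (volume.restrict D) :=
  (continuousOn_elasticForce_of_secondPartial f J (v := fun _ => e t) (x := id)
    (fun _ hx => he.contDiffAt hD ht hx)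
    (Peridynamics.continuousOn_secondPartial hD (he.contDiffOn t ht))).aestronglyMeasurable
    hD.measurableSet

lemma continuousOn_elasticForce (he : IsRegularMotion D T M e) (f J : ℝ → ℝ) (hD : IsOpen D)
    {x : Vec d} (hx : x ∈ D) : ContinuousOn (fun r => elasticForce f J (e r) x) (Icc 0 T) :=
  continuousOn_elasticForce_of_secondPartial f J (fun _ hr => he.contDiffAt hD hr hx)
    (he.continuousOn_secondPartial x hx)

lemma exists_norm_elasticForce_le (he : IsRegularMotion D T M e) (f J : ℝ → ℝ) (hD : IsOpen D) :
    ∃ A, ∀ r ∈ Icc 0 T, ∀ x ∈ D, ‖elasticForce f J (e r) x‖ ≤ A := by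
  obtain ⟨c, hc, hforce⟩ := Peridynamics.exists_norm_elasticForce_le f J d
  exact ⟨c * M, fun r hr x hx => (hforce _ x (he.contDiffAt hD hr hx)).trans
    (mul_le_mul_of_nonneg_left (he.fderiv_fderiv_le r hr x hx) hc)⟩

lemma integrableOn_inner_elasticForce (he : IsRegularMotion D T M e) (f J : ℝ → ℝ)
    (hD : IsOpen D) (hDb : Bornology.IsBounded D) (hs : s ∈ Icc 0 T) (ht : t ∈ Icc 0 T) :
    IntegrableOn (fun x => inner ℝ (elasticForce f J (e s) x) (e t x)) D := by
  obtain ⟨A, hA⟩ := he.exists_norm_elasticForce_le f J hD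
  exact integrableOn_inner_of_forall_norm_le hD hDb (he.aestronglyMeasurable_elasticForce f J hD hs)
    (he.aestronglyMeasurable hD ht) (hA s hs) (he.norm_le t ht)

lemma integrableOn_norm_sq (he : IsRegularMotion D T M e) (hD : IsOpen D)
    (hDb : Bornology.IsBounded D) (ht : t ∈ Icc 0 T) : IntegrableOn (fun x => ‖e t x‖ ^ 2) D :=
  integrableOn_norm_sq_of_forall_norm_le hD hDb (he.aestronglyMeasurable hD ht) (he.norm_le t ht)

lemma integrableOn_norm_velocity_sq (he : IsRegularMotion D T M e) (hD : IsOpen D)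
    (hDb : Bornology.IsBounded D) (hT : 0 < T) (ht : t ∈ Icc 0 T) :
    IntegrableOn (fun x => ‖velocity T e t x‖ ^ 2) D :=
  integrableOn_norm_sq_of_forall_norm_le hD hDb (he.aestronglyMeasurable_velocity hD hT ht)
    (he.velocity_le t ht)

lemma integrableOn_energyPairing (he : IsRegularMotion D T M e) (hD : IsOpen D)
    (hDb : Bornology.IsBounded D) (ht : t ∈ Icc 0 T) :
    IntegrableOn (energyPairing (e t) (e t)) D :=
  (Peridynamics.integrableOn_energyPairing hD hDb (he.isDirichletField hD ht)
    (he.isDirichletField hD ht)).congr_fun (fun _ hx => energyPairing_indicator hD _ _ hx)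
    hD.measurableSet

lemma mul_integral_energyPairing (he : IsRegularMotion D T M e) (hC : IsIsotropic d f J β)
    (hD : IsOpen D) (hDb : Bornology.IsBounded D) (hs : s ∈ Icc 0 T) (ht : t ∈ Icc 0 T) :
    β * ∫ x in D, energyPairing (e s) (e t) x
      = -∫ x in D, inner ℝ (elasticForce f J (e s) x) (e t x) := by
  rw [setIntegral_congr_fun hD.measurableSet
    fun x hx => (energyPairing_indicator hD (e s) (e t) hx).symm,
    hC.mul_integral_energyPairing hD hDb (he.isDirichletField hD hs) (he.isDirichletField hD ht)]
  congr 1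
  refine setIntegral_congr_fun hD.measurableSet fun x hx => ?_
  simp only [elasticForce_indicator f J hD (e s) hx, indicator_of_mem hx]

lemma mul_integral_energyPairing_sub (he : IsRegularMotion D T M e) (hC : IsIsotropic d f J β)
    (hD : IsOpen D) (hDb : Bornology.IsBounded D) (hs : s ∈ Icc 0 T) (ht : t ∈ Icc 0 T) :
    β * (∫ x in D, energyPairing (e s) (e s) x) - β * ∫ x in D, energyPairing (e t) (e t) x =
      -∫ x in D, inner ℝ (elasticForce f J (e s) x + elasticForce f J (e t) x)
        (e s x - e t x) := by
  have hI := fun {r q : ℝ} (hr : r ∈ Icc 0 T) (hq : q ∈ Icc 0 T) =>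
    he.integrableOn_inner_elasticForce f J hD hDb hr hq
  have hsymm : ∫ x in D, inner ℝ (elasticForce f J (e s) x) (e t x)
      = ∫ x in D, inner ℝ (elasticForce f J (e t) x) (e s x) := by
    rw [← neg_inj, ← he.mul_integral_energyPairing hC hD hDb hs ht,
      ← he.mul_integral_energyPairing hC hD hDb ht hs]
    simp only [energyPairing_comm (e s)]
  have hIs : IntegrableOn (fun x => inner ℝ (elasticForce f J (e s) x) (e s x)
      + inner ℝ (elasticForce f J (e t) x) (e s x)) D := (hI hs hs).add (hI ht hs)
  have hIt : IntegrableOn (fun x => inner ℝ (elasticForce f J (e s) x) (e t x)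
      + inner ℝ (elasticForce f J (e t) x) (e t x)) D := (hI hs ht).add (hI ht ht)
  simp only [inner_sub_right, inner_add_left]
  rw [integral_sub hIs hIt, integral_add (hI hs hs) (hI ht hs), integral_add (hI hs ht) (hI ht ht),
    hsymm, he.mul_integral_energyPairing hC hD hDb hs hs,
    he.mul_integral_energyPairing hC hD hDb ht ht]
  ring

lemma tendsto_integral_inner_slope (he : IsRegularMotion D T M e) (f J : ℝ → ℝ) (hD : IsOpen D)
    (hDb : Bornology.IsBounded D) (ht : t ∈ Icc 0 T) :
    Tendsto (fun r => ∫ x in D, inner ℝ (elasticForce f J (e r) x + elasticForce f J (e t) x)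
        (slope (fun q => e q x) t r)) (𝓝[Icc 0 T \ {t}] t)
      (𝓝 (∫ x in D, inner ℝ (elasticForce f J (e t) x + elasticForce f J (e t) x)
        (velocity T e t x))) := by
  have : IsFiniteMeasure (volume.restrict D) :=
    isFiniteMeasure_restrict.2 hDb.measure_lt_top.ne
  obtain ⟨A, hA⟩ := he.exists_norm_elasticForce_le f J hD
  refine tendsto_integral_filter_of_norm_le_const ?_ ⟨(A + A) * M, ?_⟩ ?_
  · filter_upwards [self_mem_nhdsWithin] with r hr
    exact ((he.aestronglyMeasurable_elasticForce f J hD hr.1).add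
      (he.aestronglyMeasurable_elasticForce f J hD ht)).inner
      (aestronglyMeasurable_slope (he.aestronglyMeasurable hD hr.1) (he.aestronglyMeasurable hD ht))
  · filter_upwards [self_mem_nhdsWithin] with r hr
    refine ae_restrict_of_forall_mem hD.measurableSet fun x hx => ?_
    have hforce := norm_add_le_of_le (hA r hr.1 x hx) (hA t ht x hx)
    exact (norm_inner_le_norm _ _).trans (mul_le_mul hforce
      (norm_slope_le_of_hasDerivWithinAt (fun q hq => he.hasDerivWithinAt q hq x hx)
        (fun q hq => he.velocity_le q hq x hx) hr.1 ht) (norm_nonneg _)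
      ((norm_nonneg _).trans hforce))
  · refine ae_restrict_of_forall_mem hD.measurableSet fun x hx => ?_
    exact (((he.continuousOn_elasticForce f J hD hx t ht).mono_left
      (nhdsWithin_mono _ sdiff_subset)).add tendsto_const_nhds).inner
      (hasDerivWithinAt_iff_tendsto_slope.1 (he.hasDerivWithinAt t ht x hx))

lemma hasDerivWithinAt_integral_energyPairing (he : IsRegularMotion D T M e)
    (hC : IsIsotropic d f J β) (hD : IsOpen D) (hDb : Bornology.IsBounded D) (ht : t ∈ Icc 0 T) :
    HasDerivWithinAt (fun r => β * ∫ x in D, energyPairing (e r) (e r) x)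
      (-(2 * ∫ x in D, inner ℝ (elasticForce f J (e t) x) (velocity T e t x))) (Icc 0 T) t := by
  rw [hasDerivWithinAt_iff_tendsto_slope]
  have hslope : ∀ᶠ r in 𝓝[Icc 0 T \ {t}] t,
      -∫ x in D, inner ℝ (elasticForce f J (e r) x + elasticForce f J (e t) x)
        (slope (fun q => e q x) t r)
      = slope (fun r => β * ∫ x in D, energyPairing (e r) (e r) x) t r := by
    filter_upwards [self_mem_nhdsWithin] with r hr
    simp only [slope_def_module, inner_smul_right, integral_const_mul]
    rw [he.mul_integral_energyPairing_sub hC hD hDb hr.1 ht, smul_neg, smul_eq_mul]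
  have hlim := (he.tendsto_integral_inner_slope f J hD hDb ht).neg.congr' hslope
  simpa only [← two_smul ℝ (elasticForce f J (e t) _), inner_smul_left, conj_trivial,
    integral_const_mul] using hlim

lemma integrableOn_inner_velocity (he : IsRegularMotion D T M e) (hD : IsOpen D)
    (hDb : Bornology.IsBounded D) (hT : 0 < T) (ht : t ∈ Icc 0 T) :
    IntegrableOn (fun x => inner ℝ (e t x) (velocity T e t x)) D :=
  integrableOn_inner_of_forall_norm_le hD hDb (he.aestronglyMeasurable hD ht)
    (he.aestronglyMeasurable_velocity hD hT ht) (he.norm_le t ht) (he.velocity_le t ht)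

lemma integrableOn_inner_acceleration_velocity (he : IsRegularMotion D T M e) (hD : IsOpen D)
    (hDb : Bornology.IsBounded D) (hT : 0 < T) (ht : t ∈ Icc 0 T) :
    IntegrableOn (fun x => inner ℝ (acceleration T e t x) (velocity T e t x)) D :=
  integrableOn_inner_of_forall_norm_le hD hDb (he.aestronglyMeasurable_acceleration hD hT ht)
    (he.aestronglyMeasurable_velocity hD hT ht) (he.acceleration_le t ht) (he.velocity_le t ht)

lemma integrableOn_inner_elasticForce_velocity (he : IsRegularMotion D T M e) (f J : ℝ → ℝ)
    (hD : IsOpen D) (hDb : Bornology.IsBounded D) (hT : 0 < T) (ht : t ∈ Icc 0 T) :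
    IntegrableOn (fun x => inner ℝ (elasticForce f J (e t) x) (velocity T e t x)) D := by
  obtain ⟨A, hA⟩ := he.exists_norm_elasticForce_le f J hD
  exact integrableOn_inner_of_forall_norm_le hD hDb (he.aestronglyMeasurable_elasticForce f J hD ht)
    (he.aestronglyMeasurable_velocity hD hT ht) (hA t ht) (he.velocity_le t ht)

lemma integrableOn_residualPower (he : IsRegularMotion D T M e) (f J : ℝ → ℝ) (hD : IsOpen D)
    (hDb : Bornology.IsBounded D) (hT : 0 < T) (ρ : ℝ) (ht : t ∈ Icc 0 T) :
    IntegrableOn (fun x => inner ℝ (ρ • acceleration T e t x - elasticForce f J (e t) x)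
      (velocity T e t x)) D := by
  simp only [inner_sub_left, inner_smul_left, conj_trivial]
  exact ((he.integrableOn_inner_acceleration_velocity hD hDb hT ht).const_mul ρ).sub
    (he.integrableOn_inner_elasticForce_velocity f J hD hDb hT ht)

lemma hasDerivWithinAt_energy (he : IsRegularMotion D T M e) (hC : IsIsotropic d f J β)
    (hD : IsOpen D) (hDb : Bornology.IsBounded D) (hT : 0 < T) (ρ : ℝ) (ht : t ∈ Icc 0 T) :
    HasDerivWithinAt (energy D T ρ β e)
      (2 * ρ * (∫ x in D, inner ℝ (e t x) (velocity T e t x))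
        + 2 * ∫ x in D, inner ℝ (ρ • acceleration T e t x - elasticForce f J (e t) x)
          (velocity T e t x)) (Icc 0 T) t := by
  have hderiv := (((hasDerivWithinAt_integral_norm_sq hD hDb
      (fun r hr => he.aestronglyMeasurable hD hr) he.hasDerivWithinAt he.norm_le he.velocity_le
      ht).add (hasDerivWithinAt_integral_norm_sq hD hDb
      (fun r hr => he.aestronglyMeasurable_velocity hD hT hr) he.hasDerivWithinAt_velocity
      he.velocity_le he.acceleration_le ht)).const_mul ρ).add
    (he.hasDerivWithinAt_integral_energyPairing hC hD hDb ht)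
  refine hderiv.congr_deriv ?_
  simp only [inner_sub_left, inner_smul_left, conj_trivial,
    real_inner_comm (acceleration T e t _) (velocity T e t _)]
  rw [integral_sub ((he.integrableOn_inner_acceleration_velocity hD hDb hT ht).const_mul ρ)
    (he.integrableOn_inner_elasticForce_velocity f J hD hDb hT ht)]
  simp only [integral_const_mul]
  ring

lemma energy_zero (hD : IsOpen D) (ρ β : ℝ) (h0 : ∀ x ∈ D, e 0 x = 0)
    (hv0 : ∀ x ∈ D, velocity T e 0 x = 0) : energy D T ρ β e 0 = 0 := by
  have hpair : ∀ x ∈ D, energyPairing (e 0) (e 0) x = 0 := fun x hx => by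
    have hzero : e 0 =ᶠ[𝓝 x] fun _ => 0 := by
      filter_upwards [hD.mem_nhds hx] with y hy using h0 y hy
    simp [energyPairing, partialDeriv, hzero.fderiv_eq]
  rw [energy, setIntegral_eq_zero_of_forall_eq_zero hpair,
    setIntegral_eq_zero_of_forall_eq_zero fun x hx => by simp [h0 x hx],
    setIntegral_eq_zero_of_forall_eq_zero fun x hx => by simp [hv0 x hx]]
  ring

lemma integral_power_le (he : IsRegularMotion D T M e) (hβ : 0 ≤ β) (hD : IsOpen D)
    (hDb : Bornology.IsBounded D) (hT : 0 < T) (hρ : 0 ≤ ρ) {δ : ℝ} (ht : t ∈ Icc 0 T)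
    (hres : ∀ x ∈ D, 2 * inner ℝ (ρ • acceleration T e t x - elasticForce f J (e t) x)
      (velocity T e t x) ≤ ρ * ‖velocity T e t x‖ ^ 2 + δ) :
    2 * ρ * (∫ x in D, inner ℝ (e t x) (velocity T e t x))
        + 2 * (∫ x in D, inner ℝ (ρ • acceleration T e t x - elasticForce f J (e t) x)
          (velocity T e t x))
      ≤ 2 * energy D T ρ β e t + δ * volume.real D := by
  have hIe := he.integrableOn_norm_sq hD hDb ht
  have hIv := he.integrableOn_norm_velocity_sq hD hDb hT ht
  have hIδ : IntegrableOn (fun _ => δ) D := integrableOn_const hDb.measure_lt_top.ne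
  have hcross : 2 * (∫ x in D, inner ℝ (e t x) (velocity T e t x))
      ≤ (∫ x in D, ‖e t x‖ ^ 2) + ∫ x in D, ‖velocity T e t x‖ ^ 2 := by
    rw [← integral_const_mul, ← integral_add hIe hIv]
    refine setIntegral_mono_on ((he.integrableOn_inner_velocity hD hDb hT ht).const_mul 2)
      (hIe.add hIv) hD.measurableSet fun x _ => ?_
    nlinarith [real_inner_le_norm (e t x) (velocity T e t x),
      sq_nonneg (‖e t x‖ - ‖velocity T e t x‖)]
  have hpower : 2 * (∫ x in D, inner ℝ (ρ • acceleration T e t x - elasticForce f J (e t) x)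
      (velocity T e t x)) ≤ ρ * (∫ x in D, ‖velocity T e t x‖ ^ 2) + δ * volume.real D := by
    have hconst : δ * volume.real D = ∫ _ in D, δ := by
      rw [setIntegral_const, smul_eq_mul, mul_comm]
    rw [hconst, ← integral_const_mul, ← integral_const_mul, ← integral_add (hIv.const_mul ρ) hIδ]
    exact setIntegral_mono_on ((he.integrableOn_residualPower f J hD hDb hT ρ ht).const_mul 2)
      ((hIv.const_mul ρ).add hIδ) hD.measurableSet hres
  have helastic : 0 ≤ β * ∫ x in D, energyPairing (e t) (e t) x :=
    mul_nonneg hβ (integral_nonneg fun x => energyPairing_self_nonneg (e t) x)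
  have hdispl : 0 ≤ ρ * ∫ x in D, ‖e t x‖ ^ 2 :=
    mul_nonneg hρ (integral_nonneg fun _ => sq_nonneg _)
  rw [energy]
  linarith [mul_le_mul_of_nonneg_left hcross hρ]

lemma energy_le (he : IsRegularMotion D T M e) (hC : IsIsotropic d f J β) (hβ : 0 ≤ β)
    (hD : IsOpen D) (hDb : Bornology.IsBounded D) (hT : 0 < T) (hρ : 0 ≤ ρ) {δ : ℝ} (hδ : 0 ≤ δ)
    (h0 : ∀ x ∈ D, e 0 x = 0) (hv0 : ∀ x ∈ D, velocity T e 0 x = 0)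
    (hres : ∀ r ∈ Icc 0 T, ∀ x ∈ D, 2 * inner ℝ (ρ • acceleration T e r x
      - elasticForce f J (e r) x) (velocity T e r x) ≤ ρ * ‖velocity T e r x‖ ^ 2 + δ)
    (ht : t ∈ Icc 0 T) :
    energy D T ρ β e t ≤ δ * volume.real D / 2 * Real.exp (2 * T) :=
  le_mul_exp_of_hasDerivWithinAt_le (by positivity) two_pos
    (fun _ hs => he.hasDerivWithinAt_energy hC hD hDb hT ρ hs)
    (energy_zero hD ρ β h0 hv0).le
    (fun s hs => he.integral_power_le hβ hD hDb hT hρ hs (hres s hs)) ht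

end IsRegularMotion

end Energy

section Interpolation

variable {E F : Type*} [NormedAddCommGroup F]

lemma norm_le_of_norm_sub_sub_le {a b w : F} {h η M : ℝ} (ha : ‖a‖ ≤ η) (hb : ‖b‖ ≤ η)
    (hw : ‖b - a - w‖ ≤ M * h * h) : ‖w‖ ≤ 2 * η + M * h * h := by
  have hsplit : w = b - a - (b - a - w) := by abel
  calc ‖w‖ = ‖b - a - (b - a - w)‖ := by rw [← hsplit]
    _ ≤ η + η + M * h * h := norm_sub_le_of_le (norm_sub_le_of_le hb ha) hw
    _ = 2 * η + M * h * h := by ring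

variable [NormedAddCommGroup E] [NormedSpace ℝ E] [NormedSpace ℝ F]

-- Landau's inequality: a step of length `h ≤ T / 2` from any `t` fits into `[0, T]`.
lemma norm_deriv_le_of_norm_le {G G' G'' : ℝ → F} {T M η h t : ℝ}
    (hG : ∀ s ∈ Icc 0 T, HasDerivWithinAt G (G' s) (Icc 0 T) s)
    (hG' : ∀ s ∈ Icc 0 T, HasDerivWithinAt G' (G'' s) (Icc 0 T) s)
    (hη : ∀ s ∈ Icc 0 T, ‖G s‖ ≤ η) (hM : ∀ s ∈ Icc 0 T, ‖G'' s‖ ≤ M) (hh : 0 < h)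
    (hhT : h ≤ T / 2) (ht : t ∈ Icc 0 T) : ‖G' t‖ ≤ 2 * η / h + M * h := by
  have hM0 : 0 ≤ M := (norm_nonneg _).trans (hM t ht)
  obtain ⟨s, hs, hst⟩ : ∃ s ∈ Icc 0 T, |s - t| = h := by
    rcases le_total t (T / 2) with hmid | hmid
    · exact ⟨t + h, ⟨by linarith [ht.1], by linarith⟩, by
        rw [add_sub_cancel_left, abs_of_pos hh]⟩
    · exact ⟨t - h, ⟨by linarith, by linarith [ht.2]⟩, by
        rw [sub_sub_cancel_left, abs_neg, abs_of_pos hh]⟩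
  have hsub : uIcc t s ⊆ Icc 0 T := uIcc_subset_Icc ht hs
  have hderiv : ∀ r ∈ uIcc t s,
      HasDerivWithinAt (fun r => G r - r • G' t) (G' r - G' t) (uIcc t s) r := fun r hr => by
    have hlin := (hasDerivWithinAt_id r (uIcc t s)).smul_const (G' t)
    rw [one_smul] at hlin
    exact ((hG r (hsub hr)).mono hsub).sub hlin
  have hbound : ∀ r ∈ uIcc t s, ‖G' r - G' t‖ ≤ M * h := fun r hr =>
    ((convex_Icc 0 T).norm_image_sub_le_of_norm_hasDerivWithin_le hG' hM ht (hsub hr)).trans <|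
      mul_le_mul_of_nonneg_left (hst ▸ abs_sub_left_of_mem_uIcc hr) hM0
  have hrem := (convex_uIcc t s).norm_image_sub_le_of_norm_hasDerivWithin_le hderiv hbound
    left_mem_uIcc right_mem_uIcc
  have hTaylor : G s - s • G' t - (G t - t • G' t) = G s - G t - (s - t) • G' t := by
    rw [sub_smul]
    abel
  rw [hTaylor, Real.norm_eq_abs, hst] at hrem
  have hmul := norm_le_of_norm_sub_sub_le (hη t ht) (hη s hs) hrem
  rw [norm_smul, Real.norm_eq_abs, hst] at hmul
  rw [div_add' _ _ _ hh.ne', le_div_iff₀ hh]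
  linarith

lemma norm_fderiv_le_of_norm_le {v : E → F} {x : E} {M η h : ℝ} (hh : 0 < h)
    (hv : ∀ y ∈ Metric.closedBall x h, ContDiffAt ℝ 2 v y)
    (hη : ∀ y ∈ Metric.closedBall x h, ‖v y‖ ≤ η)
    (hM : ∀ y ∈ Metric.closedBall x h, ‖fderiv ℝ (fderiv ℝ v) y‖ ≤ M) :
    ‖fderiv ℝ v x‖ ≤ 2 * η / h + M * h := by
  have hx := Metric.mem_closedBall_self (x := x) hh.le
  have hη0 : 0 ≤ η := (norm_nonneg _).trans (hη x hx)
  have hM0 : 0 ≤ M := (norm_nonneg (fderiv ℝ (fderiv ℝ v) x)).trans (hM x hx)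
  have hbound : ∀ y ∈ Metric.closedBall x h, ‖fderiv ℝ v y - fderiv ℝ v x‖ ≤ M * h :=
    fun y hy => ((convex_closedBall x h).norm_image_sub_le_of_norm_fderiv_le (𝕜 := ℝ)
      (fun z hz => differentiableAt_fderiv_of_contDiffAt (hv z hz)) hM hx hy).trans <|
      mul_le_mul_of_nonneg_left (mem_closedBall_iff_norm.1 hy) hM0
  refine ContinuousLinearMap.opNorm_le_of_unit_norm (by positivity) fun z hz => ?_
  have hmem : x + h • z ∈ Metric.closedBall x h := by
    simp [norm_smul, hz, abs_of_pos hh]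
  have hrem := (convex_closedBall x h).norm_image_sub_le_of_norm_fderiv_le' (𝕜 := ℝ)
    (fun y hy => (hv y hy).differentiableAt two_ne_zero) hbound hx hmem
  rw [add_sub_cancel_left, norm_smul, hz, mul_one, Real.norm_of_nonneg hh.le] at hrem
  have hmul := norm_le_of_norm_sub_sub_le (hη x hx) (hη _ hmem) hrem
  rw [map_smul, norm_smul, Real.norm_of_nonneg hh.le] at hmul
  rw [div_add' _ _ _ hh.ne', le_div_iff₀ hh]
  linarith

lemma two_mul_inner_le {E : Type*} [NormedAddCommGroup E] [InnerProductSpace ℝ E] {r v : E}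
    {ρ k : ℝ} (hρ : 0 < ρ) (hr : ‖r‖ ≤ k) : 2 * inner ℝ r v ≤ ρ * ‖v‖ ^ 2 + k ^ 2 / ρ := by
  have hinner : inner ℝ r v ≤ k * ‖v‖ :=
    (real_inner_le_norm _ _).trans (mul_le_mul_of_nonneg_right hr (norm_nonneg _))
  have hsq : ρ * ‖v‖ ^ 2 - 2 * (k * ‖v‖) + k ^ 2 / ρ = (ρ * ‖v‖ - k) ^ 2 / ρ := by
    field_simp
    ring
  have hnonneg : 0 ≤ (ρ * ‖v‖ - k) ^ 2 / ρ := by positivity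
  linarith

end Interpolation

section BoundaryDistance

variable {d : ℕ} {D : Set (Vec d)} {T M C ε t : ℝ} {u : ℝ → Vec d → Vec d} {g : Vec d → Vec d}
  {x : Vec d}

lemma infDist_frontier_pos (hd : 0 < d) (hD : IsOpen D) (hDb : Bornology.IsBounded D)
    (hx : x ∈ D) : 0 < Metric.infDist x (frontier D) := by
  obtain ⟨p, hp, hdist⟩ := exists_frontier_infDist_eq hd hDb hx
  rw [hdist, norm_pos_iff, sub_ne_zero]
  rintro rfl
  exact (hD.frontier_eq ▸ hp).2 hx

lemma IsCollarField.norm_le_infDist_pow (hg : IsCollarField D C ε g) (hd : 0 < d) (hD : IsOpen D)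
    (hDb : Bornology.IsBounded D) (hε : 0 < ε) (hx : x ∈ D) :
    ‖g x‖ ≤ |C| * Metric.infDist x (frontier D) ^ 4 := by
  obtain ⟨p, hp, hdist⟩ := exists_frontier_infDist_eq hd hDb hx
  simpa only [indicator_of_mem hx, hdist] using hg.norm_le hD hε hp x

lemma IsCollarField.norm_fderiv_le_infDist_pow (hg : IsCollarField D C ε g) (hd : 0 < d)
    (hD : IsOpen D) (hDb : Bornology.IsBounded D) (hε : 0 < ε) (hx : x ∈ D) :
    ‖fderiv ℝ g x‖ ≤ |C| * Metric.infDist x (frontier D) ^ 3 := by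
  obtain ⟨p, hp, hdist⟩ := exists_frontier_infDist_eq hd hDb hx
  simpa only [(indicator_eventuallyEq_of_isOpen hD g hx).fderiv_eq, hdist]
    using hg.norm_fderiv_le hD hε hp x

lemma IsRegularMotion.norm_le_infDist (hu : IsRegularMotion D T M u) (hd : 0 < d) (hD : IsOpen D)
    (hDb : Bornology.IsBounded D) (ht : t ∈ Icc 0 T) (hx : x ∈ D) :
    ‖u t x‖ ≤ M * Metric.infDist x (frontier D) := by
  obtain ⟨p, hp, hdist⟩ := exists_frontier_infDist_eq hd hDb hx
  have hu' := hu.isDirichletField hD ht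
  have hbound : ∀ y ∈ D, ‖fderiv ℝ (D.indicator (u t)) y‖ ≤ M := fun y hy => by
    rw [(indicator_eventuallyEq_of_isOpen hD (u t) hy).fderiv_eq]
    exact hu.fderiv_le t ht y hy
  have h := norm_le_mul_norm_sub_of_eq_zero_off hD hu'.continuous hu'.zero_off
    (hu'.contDiffOn.differentiableOn two_ne_zero) hbound hx
    (fun h => (hD.frontier_eq ▸ hp).2 h)
  rwa [indicator_of_mem hx, norm_sub_rev, ← hdist] at h

end BoundaryDistance

section EnergyOfError

variable {d : ℕ} {D : Set (Vec d)} {T ρ β C M N K ε c l t : ℝ} {f J : ℝ → ℝ}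
  {b : ℝ → Vec d → Vec d} {u₀ v₀ : Vec d → Vec d} {u w : ℝ → Vec d → Vec d} {x : Vec d}

namespace IsRegularApproximation

lemma sub_eq_zero_zero (hw : IsRegularApproximation f J D T ρ b u₀ v₀ C N K ε w)
    (hsol : IsElastodynamicSolution f J D T ρ b u₀ v₀ u) (hx : x ∈ D) : (w - u) 0 x = 0 := by
  rw [Pi.sub_apply, Pi.sub_apply, hw.initial x hx, hsol.initial x hx, sub_self]

lemma velocity_sub_eq_zero_zero (hw : IsRegularApproximation f J D T ρ b u₀ v₀ C N K ε w)
    (hsol : IsElastodynamicSolution f J D T ρ b u₀ v₀ u) (hu : IsRegularMotion D T M u)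
    (hT : 0 < T) (hx : x ∈ D) : velocity T (w - u) 0 x = 0 := by
  rw [hw.toIsRegularMotion.velocity_sub hu hT ⟨le_rfl, hT.le⟩ hx, hw.initial_velocity x hx,
    hsol.initial_velocity x hx, sub_self]

lemma residual_eq (hw : IsRegularApproximation f J D T ρ b u₀ v₀ C N K ε w)
    (hsol : IsElastodynamicSolution f J D T ρ b u₀ v₀ u) (hu : IsRegularMotion D T M u)
    (hD : IsOpen D) (hT : 0 < T) (ht : t ∈ Icc 0 T) (hx : x ∈ D) :
    ρ • acceleration T (w - u) t x - elasticForce f J ((w - u) t) x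
      = ρ • acceleration T w t x - elasticForce f J (w t) x - b t x := by
  rw [hw.toIsRegularMotion.acceleration_sub hu hT ht hx, Pi.sub_apply,
    elasticForce_sub f J (hw.contDiffAt hD ht hx) (hu.contDiffAt hD ht hx), smul_sub,
    hsol.equation t ht x hx]
  abel

lemma norm_residual_le (hw : IsRegularApproximation f J D T ρ b u₀ v₀ C N K ε w)
    (hsol : IsElastodynamicSolution f J D T ρ b u₀ v₀ u) (hu : IsRegularMotion D T M u)
    (hD : IsOpen D) (hT : 0 < T) (ht : t ∈ Icc 0 T) (hx : x ∈ D)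
    (h : ε < Metric.infDist x (frontier D)) :
    ‖ρ • acceleration T (w - u) t x - elasticForce f J ((w - u) t) x‖ ≤ K * ε := by
  rw [hw.residual_eq hsol hu hD hT ht hx, hw.equation t ht x hx h, sub_right_comm,
    add_sub_cancel_right]
  exact hw.consistency t ht x hx h

lemma norm_residual_le_of_infDist_le
    (hw : IsRegularApproximation f J D T ρ b u₀ v₀ C N K ε w)
    (hsol : IsElastodynamicSolution f J D T ρ b u₀ v₀ u) (hu : IsRegularMotion D T M u)
    (hc : 0 ≤ c) (hforce : ∀ (v : Vec d → Vec d) (x : Vec d), ContDiffAt ℝ 2 v x →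
      ‖elasticForce f J v x‖ ≤ c * ‖fderiv ℝ (fderiv ℝ v) x‖)
    (hD : IsOpen D) (hT : 0 < T) (hρ : 0 ≤ ρ) (ht : t ∈ Icc 0 T) (hx : x ∈ D)
    (h : Metric.infDist x (frontier D) ≤ ε) :
    ‖ρ • acceleration T (w - u) t x - elasticForce f J ((w - u) t) x‖
      ≤ c * N + (ρ * M + c * M) := by
  rw [hw.residual_eq hsol hu hD hT ht hx,
    hw.toIsPeridynamicSolution.acceleration_eq_zero h ht, smul_zero, zero_sub]
  refine norm_sub_le_of_le ?_ (hsol.norm_bodyForce_le hc hforce hu hD hρ ht hx)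
  rw [norm_neg]
  exact (hforce _ x (hw.contDiffAt hD ht hx)).trans
    (mul_le_mul_of_nonneg_left (hw.fderiv_fderiv_le t ht x hx) hc)

-- In the collar the residual is only bounded, but the velocity of `w` vanishes there.
lemma residualPower_le (hw : IsRegularApproximation f J D T ρ b u₀ v₀ C N K ε w)
    (hsol : IsElastodynamicSolution f J D T ρ b u₀ v₀ u) (hu : IsRegularMotion D T M u)
    {A : ℝ} (hA0 : 0 ≤ A) (hA : ∀ t ∈ Icc 0 T, ∀ x ∈ D, Metric.infDist x (frontier D) ≤ ε →
      ‖ρ • acceleration T (w - u) t x - elasticForce f J ((w - u) t) x‖ ≤ A)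
    (hD : IsOpen D) (hT : 0 < T) (hρ : 0 < ρ) (hl : 0 ≤ l)
    (hcollar : ∀ t ∈ Icc 0 T, ∀ x ∈ D, Metric.infDist x (frontier D) ≤ ε →
      ‖velocity T u t x‖ ≤ l) (ht : t ∈ Icc 0 T) (hx : x ∈ D) :
    2 * inner ℝ (ρ • acceleration T (w - u) t x - elasticForce f J ((w - u) t) x)
        (velocity T (w - u) t x)
      ≤ ρ * ‖velocity T (w - u) t x‖ ^ 2 + (K ^ 2 / ρ + 2 * A) * (ε ^ 2 + l) := by
  have hKl : 0 ≤ K ^ 2 / ρ * l := by positivity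
  have hAε : 0 ≤ 2 * A * ε ^ 2 := by positivity
  rcases lt_or_ge ε (Metric.infDist x (frontier D)) with h | h
  · have hAl : 0 ≤ 2 * A * l := by positivity
    have hinner := two_mul_inner_le (v := velocity T (w - u) t x) hρ
      (hw.norm_residual_le hsol hu hD hT ht hx h)
    rw [mul_pow, mul_div_right_comm] at hinner
    linarith
  · have hv : ‖velocity T (w - u) t x‖ ≤ l := by
      rw [hw.toIsRegularMotion.velocity_sub hu hT ht hx,
        hw.toIsPeridynamicSolution.velocity_eq_zero h ht, zero_sub, norm_neg]
      exact hcollar t ht x hx h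
    have hinner := (real_inner_le_norm _ _).trans
      (mul_le_mul (hA t ht x hx h) hv (norm_nonneg _) hA0)
    have hKε : 0 ≤ K ^ 2 / ρ * ε ^ 2 := by positivity
    have hkin : 0 ≤ ρ * ‖velocity T (w - u) t x‖ ^ 2 := by positivity
    linarith

end IsRegularApproximation

lemma exists_energy_sub_le (hC : IsIsotropic d f J β) (hβ : 0 ≤ β) (hD : IsOpen D)
    (hDb : Bornology.IsBounded D) (hT : 0 < T) (hρ : 0 < ρ) (hM : 0 ≤ M) (hN : 0 ≤ N)
    (hu : IsRegularMotion D T M u) (hsol : IsElastodynamicSolution f J D T ρ b u₀ v₀ u)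
    (C K : ℝ) :
    ∃ Q, 0 ≤ Q ∧ ∀ ε w, IsRegularApproximation f J D T ρ b u₀ v₀ C N K ε w → ∀ l, 0 ≤ l →
      (∀ t ∈ Icc 0 T, ∀ x ∈ D, Metric.infDist x (frontier D) ≤ ε → ‖velocity T u t x‖ ≤ l) →
      ∀ t ∈ Icc 0 T, energy D T ρ β (w - u) t ≤ Q * (ε ^ 2 + l) := by
  obtain ⟨c, hc, hforce⟩ := exists_norm_elasticForce_le f J d
  set A := c * N + (ρ * M + c * M)
  have hA : 0 ≤ A := by positivity
  refine ⟨(K ^ 2 / ρ + 2 * A) * volume.real D / 2 * Real.exp (2 * T), by positivity,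
    fun ε w hw l hl hcollar t ht => ?_⟩
  refine ((hw.toIsRegularMotion.sub hu hD hT).energy_le hC hβ hD hDb hT hρ.le
    (δ := (K ^ 2 / ρ + 2 * A) * (ε ^ 2 + l)) (by positivity)
    (fun x hx => hw.sub_eq_zero_zero hsol hx)
    (fun x hx => hw.velocity_sub_eq_zero_zero hsol hu hT hx)
    (fun r hr x hx => hw.residualPower_le hsol hu hA (fun s hs y hy =>
      hw.norm_residual_le_of_infDist_le hsol hu hc hforce hD hT hρ.le hs hy)
      hD hT hρ hl hcollar hr hx) ht).trans_eq (by ring)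

end EnergyOfError

section EnergyBounds

variable {d : ℕ} {D : Set (Vec d)} {T M β ρ η t : ℝ} {e : ℝ → Vec d → Vec d}

lemma mul_integral_norm_sq_le_energy (T : ℝ) (hβ : 0 ≤ β) (hρ : 0 ≤ ρ) :
    ρ * ∫ x in D, ‖e t x‖ ^ 2 ≤ energy D T ρ β e t := by
  have hel : 0 ≤ ∫ x in D, energyPairing (e t) (e t) x :=
    integral_nonneg fun x => energyPairing_self_nonneg (e t) x
  rw [energy, mul_add, add_assoc]
  exact le_add_of_nonneg_right (by positivity)

lemma mul_integral_energyPairing_le_energy (T β : ℝ) (hρ : 0 ≤ ρ) :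
    β * ∫ x in D, energyPairing (e t) (e t) x ≤ energy D T ρ β e t :=
  le_add_of_nonneg_left (by positivity)

lemma IsIsotropic.integral_norm_velocity_sq_add_integral_elasticDensity_le_energy {f J : ℝ → ℝ}
    (hC : IsIsotropic d f J β) (hρ : 0 ≤ ρ) :
    (∫ x in D, ρ * ‖velocity T e t x‖ ^ 2) + ∫ x in D, elasticDensity f J (e t) x
      ≤ energy D T ρ β e t := by
  simp only [hC.elasticDensity_eq, integral_const_mul]
  exact add_le_add_left (mul_le_mul_of_nonneg_left (le_add_of_nonneg_left (by positivity)) hρ) _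

lemma IsRegularMotion.mul_volume_le_energy (he : IsRegularMotion D T M e) (hβ : 0 ≤ β)
    (hρ : 0 ≤ ρ) (hD : IsOpen D) (hDb : Bornology.IsBounded D) (ht : t ∈ Icc 0 T)
    {S : Set (Vec d)} (hS : MeasurableSet S) (hSD : S ⊆ D) (hη : 0 ≤ η)
    (hηe : ∀ x ∈ S, η ≤ ‖e t x‖) : ρ * (η ^ 2 * volume.real S) ≤ energy D T ρ β e t := by
  have hint := he.integrableOn_norm_sq hD hDb ht
  refine (mul_le_mul_of_nonneg_left ?_ hρ).trans (mul_integral_norm_sq_le_energy T hβ hρ)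
  calc η ^ 2 * volume.real S ≤ ∫ x in S, ‖e t x‖ ^ 2 :=
        setIntegral_ge_of_const_le_real hS ((measure_mono hSD).trans_lt hDb.measure_lt_top).ne
          (fun x hx => pow_le_pow_left₀ hη (hηe x hx) 2) (hint.mono_set hSD)
    _ ≤ ∫ x in D, ‖e t x‖ ^ 2 :=
        setIntegral_mono_set hint (Eventually.of_forall fun x => by positivity)
          (Eventually.of_forall hSD)

end EnergyBounds

section CollarDecay

variable {d : ℕ} {D : Set (Vec d)} {T ρ β C M N K ε c t : ℝ} {f J : ℝ → ℝ}
  {b : ℝ → Vec d → Vec d} {u₀ v₀ : Vec d → Vec d} {u w : ℝ → Vec d → Vec d} {x : Vec d}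

lemma IsRegularMotion.norm_velocity_le_sqrt (hu : IsRegularMotion D T M u) (hd : 0 < d)
    (hD : IsOpen D) (hDb : Bornology.IsBounded D) (hM : 0 ≤ M) (hε : 0 < ε) (hεT : √ε ≤ T / 2)
    (ht : t ∈ Icc 0 T) (hx : x ∈ D) (hxε : Metric.infDist x (frontier D) ≤ ε) :
    ‖velocity T u t x‖ ≤ 3 * M * √ε := by
  have hLandau := norm_deriv_le_of_norm_le (η := M * ε)
    (fun s hs => hu.hasDerivWithinAt s hs x hx)
    (fun s hs => hu.hasDerivWithinAt_velocity s hs x hx)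
    (fun s hs => (hu.norm_le_infDist hd hD hDb hs hx).trans (mul_le_mul_of_nonneg_left hxε hM))
    (fun s hs => hu.acceleration_le s hs x hx) (Real.sqrt_pos.2 hε) hεT ht
  rw [← mul_assoc, mul_div_assoc, Real.div_sqrt] at hLandau
  linarith

lemma IsRegularMotion.norm_velocity_le_of_norm_le_pow_four (hu : IsRegularMotion D T M u)
    (hc : 0 ≤ c) (hdecay : ∀ t ∈ Icc 0 T, ∀ x ∈ D, ‖u t x‖ ≤ c * Metric.infDist x (frontier D) ^ 4)
    (hε : 0 < ε) (hεT : ε ^ 2 ≤ T / 2) (ht : t ∈ Icc 0 T) (hx : x ∈ D)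
    (hxε : Metric.infDist x (frontier D) ≤ ε) : ‖velocity T u t x‖ ≤ (2 * c + M) * ε ^ 2 := by
  have hpow : Metric.infDist x (frontier D) ^ 4 ≤ ε ^ 4 :=
    pow_le_pow_left₀ Metric.infDist_nonneg hxε 4
  have hLandau := norm_deriv_le_of_norm_le (η := c * ε ^ 4)
    (fun s hs => hu.hasDerivWithinAt s hs x hx)
    (fun s hs => hu.hasDerivWithinAt_velocity s hs x hx)
    (fun s hs => (hdecay s hs x hx).trans (mul_le_mul_of_nonneg_left hpow hc))
    (fun s hs => hu.acceleration_le s hs x hx) (by positivity : 0 < ε ^ 2) hεT ht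
  exact hLandau.trans_eq (by field_simp)

lemma norm_fderiv_le_of_norm_le_pow_four {v : Vec d → Vec d} (hD : IsOpen D)
    (hv : ContDiffOn ℝ 2 v D) (hc : 0 ≤ c)
    (hM : ∀ y ∈ D, ‖fderiv ℝ (fderiv ℝ v) y‖ ≤ M)
    (hdecay : ∀ y ∈ D, ‖v y‖ ≤ c * Metric.infDist y (frontier D) ^ 4) (hx : x ∈ D)
    (hpos : 0 < Metric.infDist x (frontier D)) :
    ‖fderiv ℝ v x‖
      ≤ 64 * c * Metric.infDist x (frontier D) ^ 3 + M * Metric.infDist x (frontier D) := by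
  have hM0 : 0 ≤ M := (norm_nonneg (fderiv ℝ (fderiv ℝ v) x)).trans (hM x hx)
  set δ := Metric.infDist x (frontier D)
  have hsub : Metric.closedBall x (δ / 2) ⊆ D :=
    (Metric.closedBall_subset_ball (half_lt_self hpos)).trans (ball_infDist_frontier_subset hD hx)
  have hη : ∀ y ∈ Metric.closedBall x (δ / 2), ‖v y‖ ≤ c * (2 * δ) ^ 4 := fun y hy => by
    have hdist : Metric.infDist y (frontier D) ≤ 2 * δ := by
      have htri := Metric.infDist_le_infDist_add_dist (s := frontier D) (x := y) (y := x)
      linarith [Metric.mem_closedBall.1 hy]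
    exact (hdecay y (hsub hy)).trans
      (mul_le_mul_of_nonneg_left (pow_le_pow_left₀ Metric.infDist_nonneg hdist 4) hc)
  have hLandau := norm_fderiv_le_of_norm_le (half_pos hpos)
    (fun y hy => hv.contDiffAt (hD.mem_nhds (hsub hy))) hη fun y hy => hM y (hsub hy)
  have hexpand : 2 * (c * (2 * δ) ^ 4) / (δ / 2) = 64 * c * δ ^ 3 := by
    field_simp
    ring
  have hMδ : 0 ≤ M * δ := by positivity
  linarith

/- The error is at least `‖u‖ - |C| dist ^ 4`, so a point where the asserted bound fails keeps the
energy of the error away from `0`. -/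
lemma norm_le_infDist_pow_four (hd : 0 < d) (hC : IsIsotropic d f J β) (hβ : 0 ≤ β)
    (hD : IsOpen D) (hDb : Bornology.IsBounded D) (hT : 0 < T) (hρ : 0 < ρ) (hM : 0 ≤ M)
    (hN : 0 ≤ N) (hu : IsRegularMotion D T M u)
    (hsol : IsElastodynamicSolution f J D T ρ b u₀ v₀ u)
    (hsmall : ∀ ε₀ > 0, ∃ ε < ε₀, ∃ w, IsRegularApproximation f J D T ρ b u₀ v₀ C N K ε w)
    (ht : t ∈ Icc 0 T) (hx : x ∈ D) :
    ‖u t x‖ ≤ |C| * Metric.infDist x (frontier D) ^ 4 := by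
  by_contra! hcon
  obtain ⟨Q, -, hQ⟩ := exists_energy_sub_le hC hβ hD hDb hT hρ hM hN hu hsol C K
  have hcont : ContinuousAt (fun y => ‖u t y‖ - |C| * Metric.infDist y (frontier D) ^ 4) x :=
    (hu.contDiffAt hD ht hx).continuousAt.norm.sub
      (((Metric.continuous_infDist_pt _).pow 4).const_mul _).continuousAt
  obtain ⟨η, hη, hηx⟩ := exists_between (sub_pos.2 hcon)
  obtain ⟨r, hr, hball⟩ := Metric.eventually_nhds_iff_ball.1
    ((hcont.eventually_const_lt hηx).and (hD.mem_nhds hx))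
  have hvol : 0 < volume.real (Metric.ball x r) :=
    ENNReal.toReal_pos (Metric.measure_ball_pos volume x hr).ne' measure_ball_lt_top.ne
  have hlow : ∀ ε w, IsRegularApproximation f J D T ρ b u₀ v₀ C N K ε w →
      ρ * (η ^ 2 * volume.real (Metric.ball x r)) ≤ energy D T ρ β (w - u) t := fun ε w hw =>
    (hw.toIsRegularMotion.sub hu hD hT).mul_volume_le_energy hβ hρ.le hD hDb ht measurableSet_ball
      (fun y hy => (hball y hy).2) hη.le fun y hy => by
        have hwy := (hw.isCollarField t ht).norm_le_infDist_pow hd hD hDb hw.pos (hball y hy).2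
        have htri := norm_sub_norm_le (u t y) (w t y)
        rw [norm_sub_rev] at htri
        exact (hball y hy).1.le.trans ((sub_le_sub_left hwy _).trans htri)
  have hlim : Tendsto (fun ε : ℝ => Q * (ε ^ 2 + 3 * M * √ε)) (𝓝 0) (𝓝 0) :=
    Continuous.tendsto' (by fun_prop) 0 0 (by simp)
  have hsqrt : Tendsto (fun ε : ℝ => √ε) (𝓝 0) (𝓝 0) :=
    Continuous.tendsto' Real.continuous_sqrt 0 0 Real.sqrt_zero
  have hpos : 0 < ρ * (η ^ 2 * volume.real (Metric.ball x r)) := by positivity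
  obtain ⟨ε₀, hε₀, hnear⟩ := Metric.eventually_nhds_iff_ball.1
    ((hlim.eventually_lt_const hpos).and (hsqrt.eventually_le_const (half_pos hT)))
  obtain ⟨ε, hε, w, hw⟩ := hsmall ε₀ hε₀
  obtain ⟨hlt, hεT⟩ := hnear ε (by rwa [mem_ball_zero_iff, Real.norm_of_nonneg hw.pos.le])
  exact ((hlow ε w hw).trans (hQ ε w hw (3 * M * √ε) (by positivity)
    (fun s hs y hy => hu.norm_velocity_le_sqrt hd hD hDb hM hw.pos hεT hs hy) t ht)).not_gt hlt

lemma exists_collar_decay_of_lt (hd : 0 < d) (hC : IsIsotropic d f J β) (hβ : 0 ≤ β)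
    (hD : IsOpen D) (hDb : Bornology.IsBounded D) (hT : 0 < T) (hρ : 0 < ρ) (hM : 0 ≤ M)
    (hN : 0 ≤ N) (hu : IsRegularMotion D T M u)
    (hsol : IsElastodynamicSolution f J D T ρ b u₀ v₀ u) (C K : ℝ) :
    ∃ ε₀ > 0, ∃ Λ, 0 ≤ Λ ∧ ∀ ε < ε₀, ∀ w, IsRegularApproximation f J D T ρ b u₀ v₀ C N K ε w →
      ∀ t ∈ Icc 0 T, ∀ x ∈ D, Metric.infDist x (frontier D) ≤ ε →
        ‖velocity T u t x‖ ≤ Λ * ε ^ 2 ∧ ‖fderiv ℝ (u t) x‖ ≤ Λ * ε := by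
  by_cases hsmall : ∀ ε₀ > 0, ∃ ε < ε₀, ∃ w, IsRegularApproximation f J D T ρ b u₀ v₀ C N K ε w
  · have hdecay : ∀ t ∈ Icc 0 T, ∀ x ∈ D, ‖u t x‖ ≤ |C| * Metric.infDist x (frontier D) ^ 4 :=
      fun t ht x hx => norm_le_infDist_pow_four hd hC hβ hD hDb hT hρ hM hN hu hsol hsmall ht hx
    refine ⟨min 1 (T / 2), by positivity, 64 * |C| + M, by positivity,
      fun ε hε w hw t ht x hx hxε => ?_⟩
    obtain ⟨hε1, hεT⟩ := lt_min_iff.1 hε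
    have hpow : ∀ n ≠ 0, ε ^ n ≤ ε := fun n => pow_le_of_le_one hw.pos.le hε1.le
    have hδ := infDist_frontier_pos hd hD hDb hx
    constructor
    · refine (hu.norm_velocity_le_of_norm_le_pow_four (abs_nonneg C) hdecay hw.pos
        ((hpow 2 two_ne_zero).trans hεT.le) ht hx hxε).trans ?_
      gcongr
      norm_num
    · calc ‖fderiv ℝ (u t) x‖ ≤ 64 * |C| * Metric.infDist x (frontier D) ^ 3
            + M * Metric.infDist x (frontier D) :=
          norm_fderiv_le_of_norm_le_pow_four hD (hu.contDiffOn t ht) (abs_nonneg C)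
            (hu.fderiv_fderiv_le t ht) (hdecay t ht) hx hδ
        _ ≤ 64 * |C| * ε + M * ε := by
          gcongr
          exact (pow_le_pow_left₀ hδ.le hxε 3).trans (hpow 3 three_ne_zero)
        _ = (64 * |C| + M) * ε := by ring
  · push Not at hsmall
    obtain ⟨ε₀, hε₀, hnone⟩ := hsmall
    exact ⟨ε₀, hε₀, 0, le_rfl, fun ε hε w hw => absurd hw (hnone ε hε w)⟩

lemma exists_collar_decay (hd : 0 < d) (hC : IsIsotropic d f J β) (hβ : 0 ≤ β)
    (hD : IsOpen D) (hDb : Bornology.IsBounded D) (hT : 0 < T) (hρ : 0 < ρ) (hM : 0 ≤ M)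
    (hN : 0 ≤ N) (hu : IsRegularMotion D T M u)
    (hsol : IsElastodynamicSolution f J D T ρ b u₀ v₀ u) (C K : ℝ) :
    ∃ Λ, 0 ≤ Λ ∧ ∀ ε w, IsRegularApproximation f J D T ρ b u₀ v₀ C N K ε w →
      ∀ t ∈ Icc 0 T, ∀ x ∈ D, Metric.infDist x (frontier D) ≤ ε →
        ‖velocity T u t x‖ ≤ Λ * ε ^ 2 ∧ ‖fderiv ℝ (u t) x‖ ≤ Λ * ε := by
  obtain ⟨ε₀, hε₀, Λ, hΛ, hdecay⟩ :=
    exists_collar_decay_of_lt hd hC hβ hD hDb hT hρ hM hN hu hsol C K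
  refine ⟨Λ + (M / ε₀ ^ 2 + M / ε₀), by positivity, fun ε w hw t ht x hx hxε => ?_⟩
  have hε := hw.pos
  rcases lt_or_ge ε ε₀ with hlt | hge
  · have hle : Λ ≤ Λ + (M / ε₀ ^ 2 + M / ε₀) := le_add_of_nonneg_right (by positivity)
    obtain ⟨hvel, hgrad⟩ := hdecay ε hlt w hw t ht x hx hxε
    exact ⟨hvel.trans (by gcongr), hgrad.trans (by gcongr)⟩
  · have hpow : ∀ n, M ≤ M / ε₀ ^ n * ε ^ n := fun n => by
      rw [div_mul_eq_mul_div, le_div_iff₀ (by positivity)]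
      gcongr
    have hvel := (hu.velocity_le t ht x hx).trans (hpow 2)
    have hgrad := (hu.fderiv_le t ht x hx).trans (hpow 1)
    rw [pow_one, pow_one] at hgrad
    refine ⟨hvel.trans ?_, hgrad.trans ?_⟩
    · gcongr
      linarith [div_nonneg hM hε₀.le]
    · gcongr
      linarith [div_nonneg hM (sq_nonneg ε₀)]

lemma exists_energy_sub_le_sq (hC : IsIsotropic d f J β) (hβ : 0 ≤ β) (hD : IsOpen D)
    (hDb : Bornology.IsBounded D) (hT : 0 < T) (hρ : 0 < ρ) (hM : 0 ≤ M) (hN : 0 ≤ N)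
    (hu : IsRegularMotion D T M u) (hsol : IsElastodynamicSolution f J D T ρ b u₀ v₀ u)
    {Λ : ℝ} (hΛ : 0 ≤ Λ)
    (hdecay : ∀ ε w, IsRegularApproximation f J D T ρ b u₀ v₀ C N K ε w →
      ∀ t ∈ Icc 0 T, ∀ x ∈ D, Metric.infDist x (frontier D) ≤ ε →
        ‖velocity T u t x‖ ≤ Λ * ε ^ 2) :
    ∃ P, 0 ≤ P ∧ ∀ ε w, IsRegularApproximation f J D T ρ b u₀ v₀ C N K ε w →
      ∀ t ∈ Icc 0 T, energy D T ρ β (w - u) t ≤ P * ε ^ 2 := by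
  obtain ⟨Q, hQ0, hQ⟩ := exists_energy_sub_le hC hβ hD hDb hT hρ hM hN hu hsol C K
  refine ⟨Q * (1 + Λ), by positivity, fun ε w hw t ht => ?_⟩
  exact (hQ ε w hw (Λ * ε ^ 2) (by positivity) (hdecay ε w hw) t ht).trans_eq (by ring)

end CollarDecay

section Gradient

variable {d : ℕ} {D : Set (Vec d)} {T M c t : ℝ} {v : Vec d → Vec d} {e : ℝ → Vec d → Vec d}

lemma gradSq_le (v : Vec d → Vec d) (x : Vec d) : gradSq v x ≤ d * ‖fderiv ℝ v x‖ ^ 2 := by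
  have hpartial : ∀ j ∈ Finset.univ, ‖partialDeriv j v x‖ ^ 2 ≤ ‖fderiv ℝ v x‖ ^ 2 := fun j _ =>
    pow_le_pow_left₀ (norm_nonneg _) (norm_apply_single_le (fderiv ℝ v x) j) 2
  simpa only [gradSq, Finset.card_univ, Fintype.card_fin, nsmul_eq_mul] using
    Finset.sum_le_card_nsmul _ _ _ hpartial

lemma gradSq_indicator (hD : IsOpen D) (v : Vec d → Vec d) {x : Vec d} (hx : x ∈ D) :
    gradSq (D.indicator v) x = gradSq v x := by
  simp only [gradSq, partialDeriv, (indicator_eventuallyEq_of_isOpen hD v hx).fderiv_eq]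

namespace IsRegularMotion

lemma integrableOn_gradSq (he : IsRegularMotion D T M e) (hD : IsOpen D)
    (hDb : Bornology.IsBounded D) (ht : t ∈ Icc 0 T) : IntegrableOn (gradSq (e t)) D :=
  (Peridynamics.integrableOn_gradSq hD hDb (he.isDirichletField hD ht)).congr_fun
    (fun _ hx => gradSq_indicator hD _ hx) hD.measurableSet

lemma integral_gradSq_le (he : IsRegularMotion D T M e) (hD : IsOpen D)
    (hDb : Bornology.IsBounded D) (ht : t ∈ Icc 0 T) :
    ∫ x in D, gradSq (e t) x ≤ ∫ x in D, energyPairing (e t) (e t) x := by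
  rw [← setIntegral_congr_fun hD.measurableSet fun x hx => gradSq_indicator hD (e t) hx,
    ← setIntegral_congr_fun hD.measurableSet
      fun x hx => energyPairing_indicator hD (e t) (e t) hx]
  exact Peridynamics.integral_gradSq_le hD hDb (he.isDirichletField hD ht)

lemma integral_gradSq_le_of_norm_fderiv_le (he : IsRegularMotion D T M e) (hD : IsOpen D)
    (hDb : Bornology.IsBounded D) (ht : t ∈ Icc 0 T) (hc : ∀ x ∈ D, ‖fderiv ℝ (e t) x‖ ≤ c) :
    ∫ x in D, gradSq (e t) x ≤ d * c ^ 2 * volume.real D := by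
  have hconst : IntegrableOn (fun _ : Vec d => d * c ^ 2) D :=
    integrableOn_const hDb.measure_lt_top.ne
  have hmono := setIntegral_mono_on (he.integrableOn_gradSq hD hDb ht) hconst hD.measurableSet
    fun x hx => (gradSq_le (e t) x).trans (mul_le_mul_of_nonneg_left
      (pow_le_pow_left₀ (norm_nonneg _) (hc x hx) 2) (Nat.cast_nonneg d))
  rwa [setIntegral_const, smul_eq_mul, mul_comm] at hmono

end IsRegularMotion

end Gradient

section ErrorEstimate

variable {d : ℕ} {D : Set (Vec d)} {T ρ β C M N K Λ R ε t : ℝ} {f J : ℝ → ℝ}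
  {b : ℝ → Vec d → Vec d} {u₀ v₀ : Vec d → Vec d} {u w : ℝ → Vec d → Vec d} {x : Vec d}

namespace IsRegularApproximation

lemma acceleration_sub_eq_zero (hw : IsRegularApproximation f J D T ρ b u₀ v₀ C N K ε w)
    (hC : IsIsotropic d f J 0)
    (hJ : ∀ᵐ ξ : Vec d ∂(volume.restrict (Metric.ball 0 1)), ξ ≠ 0 → J ‖ξ‖ = 0)
    (hsol : IsElastodynamicSolution f J D T ρ b u₀ v₀ u) (hu : IsRegularMotion D T M u)
    (hD : IsOpen D) (hT : 0 < T) (hρ : 0 < ρ) (ht : t ∈ Icc 0 T) (hx : x ∈ D)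
    (hxε : ε < Metric.infDist x (frontier D)) : acceleration T (w - u) t x = 0 := by
  have helastic : elasticForce f J (u t) x = 0 := by
    ext i
    rw [hC.elasticForce_apply (hu.contDiffAt hD ht hx), zero_mul, PiLp.zero_apply]
  have hacc : ρ • acceleration T w t x = ρ • acceleration T u t x := by
    rw [hw.equation t ht x hx hxε, hsol.equation t ht x hx, helastic,
      nonlocalForce_eq_zero f hw.pos hJ]
  rw [hw.toIsRegularMotion.acceleration_sub hu hT ht hx, sub_eq_zero]
  exact smul_right_injective _ hρ.ne' hacc

lemma sub_eq_zero (hw : IsRegularApproximation f J D T ρ b u₀ v₀ C N K ε w)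
    (hC : IsIsotropic d f J 0)
    (hJ : ∀ᵐ ξ : Vec d ∂(volume.restrict (Metric.ball 0 1)), ξ ≠ 0 → J ‖ξ‖ = 0)
    (hsol : IsElastodynamicSolution f J D T ρ b u₀ v₀ u) (hu : IsRegularMotion D T M u)
    (hD : IsOpen D) (hT : 0 < T) (hρ : 0 < ρ) (ht : t ∈ Icc 0 T) (hx : x ∈ D)
    (hxε : ε < Metric.infDist x (frontier D)) : (w - u) t x = 0 := by
  have he := hw.toIsRegularMotion.sub hu hD hT
  have hvel : ∀ s ∈ Icc 0 T, ‖velocity T (w - u) s x‖ ≤ 0 := fun s hs => by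
    simpa only [zero_mul, add_zero] using norm_le_of_hasDerivWithinAt_Icc
      (fun r hr => he.hasDerivWithinAt_velocity r hr x hx)
      (fun r hr =>
        (norm_eq_zero.2 (hw.acceleration_sub_eq_zero hC hJ hsol hu hD hT hρ hr hx hxε)).le)
      (norm_eq_zero.2 (hw.velocity_sub_eq_zero_zero hsol hu hT hx)).le hs
  have hdisp : ‖(w - u) t x‖ ≤ 0 := by
    simpa only [zero_mul, add_zero] using norm_le_of_hasDerivWithinAt_Icc
      (fun r hr => he.hasDerivWithinAt r hr x hx) hvel
      (norm_eq_zero.2 (hw.sub_eq_zero_zero hsol hx)).le ht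
  exact norm_le_zero_iff.1 hdisp

lemma norm_fderiv_sub_le (hw : IsRegularApproximation f J D T ρ b u₀ v₀ C N K ε w) (hd : 0 < d)
    (hC : IsIsotropic d f J 0)
    (hJ : ∀ᵐ ξ : Vec d ∂(volume.restrict (Metric.ball 0 1)), ξ ≠ 0 → J ‖ξ‖ = 0)
    (hsol : IsElastodynamicSolution f J D T ρ b u₀ v₀ u) (hu : IsRegularMotion D T M u)
    (hD : IsOpen D) (hDb : Bornology.IsBounded D) (hT : 0 < T) (hρ : 0 < ρ)
    (hR : ∀ x ∈ D, Metric.infDist x (frontier D) ≤ R) (hΛ : 0 ≤ Λ) (ht : t ∈ Icc 0 T)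
    (hcollar : ∀ x ∈ D, Metric.infDist x (frontier D) ≤ ε → ‖fderiv ℝ (u t) x‖ ≤ Λ * ε)
    (hx : x ∈ D) : ‖fderiv ℝ ((w - u) t) x‖ ≤ (|C| * R ^ 2 + Λ) * ε := by
  have hε := hw.pos
  rcases lt_or_ge ε (Metric.infDist x (frontier D)) with h | h
  · have hzero : (w - u) t =ᶠ[𝓝 x] fun _ => 0 := by
      filter_upwards [hD.mem_nhds hx, (Metric.continuous_infDist_pt
        (frontier D)).continuousAt.eventually_const_lt h] with y hy hyε
      exact hw.sub_eq_zero hC hJ hsol hu hD hT hρ ht hy hyε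
    rw [hzero.fderiv_eq, fderiv_const_apply, norm_zero]
    positivity
  · have hfderiv : fderiv ℝ ((w - u) t) x = fderiv ℝ (w t) x - fderiv ℝ (u t) x :=
      fderiv_sub ((hw.contDiffAt hD ht hx).differentiableAt two_ne_zero)
        ((hu.contDiffAt hD ht hx).differentiableAt two_ne_zero)
    have hwx : ‖fderiv ℝ (w t) x‖ ≤ |C| * R ^ 2 * ε :=
      calc ‖fderiv ℝ (w t) x‖ ≤ |C| * Metric.infDist x (frontier D) ^ 3 :=
            (hw.isCollarField t ht).norm_fderiv_le_infDist_pow hd hD hDb hε hx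
        _ = |C| * Metric.infDist x (frontier D) ^ 2 * Metric.infDist x (frontier D) := by ring
        _ ≤ |C| * R ^ 2 * ε := by
          gcongr
          exacts [Metric.infDist_nonneg, Metric.infDist_nonneg, hR x hx]
    rw [hfderiv, add_mul]
    exact norm_sub_le_of_le hwx (hcollar x hx h)

end IsRegularApproximation

lemma exists_infDist_frontier_le (hd : 0 < d) (hDb : Bornology.IsBounded D) :
    ∃ R, ∀ x ∈ D, Metric.infDist x (frontier D) ≤ R := by
  obtain ⟨R, -, hR⟩ := exists_norm_sub_frontier_le hDb
  refine ⟨R, fun x hx => ?_⟩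
  obtain ⟨p, hp, hdist⟩ := exists_frontier_infDist_eq hd hDb hx
  exact hdist.trans_le (hR x hx p hp)

/- Korn's inequality needs `0 < β`; for `β = 0` nothing moves off the collar, and in the collar the
gradients are small. -/
lemma exists_integral_gradSq_sub_le (hd : 0 < d) (hC : IsIsotropic d f J β) (hβ : 0 ≤ β)
    (hJ : β = 0 → ∀ᵐ ξ : Vec d ∂(volume.restrict (Metric.ball 0 1)), ξ ≠ 0 → J ‖ξ‖ = 0)
    (hD : IsOpen D) (hDb : Bornology.IsBounded D) (hT : 0 < T) (hρ : 0 < ρ)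
    (hu : IsRegularMotion D T M u) (hsol : IsElastodynamicSolution f J D T ρ b u₀ v₀ u)
    {P : ℝ} (hΛ : 0 ≤ Λ)
    (henergy : ∀ ε w, IsRegularApproximation f J D T ρ b u₀ v₀ C N K ε w →
      ∀ t ∈ Icc 0 T, energy D T ρ β (w - u) t ≤ P * ε ^ 2)
    (hcollar : ∀ ε w, IsRegularApproximation f J D T ρ b u₀ v₀ C N K ε w →
      ∀ t ∈ Icc 0 T, ∀ x ∈ D, Metric.infDist x (frontier D) ≤ ε →
        ‖fderiv ℝ (u t) x‖ ≤ Λ * ε) :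
    ∃ G, ∀ ε w, IsRegularApproximation f J D T ρ b u₀ v₀ C N K ε w →
      ∀ t ∈ Icc 0 T, ∫ x in D, gradSq ((w - u) t) x ≤ G * ε ^ 2 := by
  rcases hβ.eq_or_lt with rfl | hβ
  · obtain ⟨R, hR⟩ := exists_infDist_frontier_le hd hDb
    refine ⟨d * (|C| * R ^ 2 + Λ) ^ 2 * volume.real D, fun ε w hw t ht => ?_⟩
    exact ((hw.toIsRegularMotion.sub hu hD hT).integral_gradSq_le_of_norm_fderiv_le hD hDb ht
      fun x hx => hw.norm_fderiv_sub_le hd hC (hJ rfl) hsol hu hD hDb hT hρ hR hΛ ht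
        (hcollar ε w hw t ht) hx).trans_eq (by ring)
  · refine ⟨P / β, fun ε w hw t ht => ?_⟩
    calc ∫ x in D, gradSq ((w - u) t) x ≤ ∫ x in D, energyPairing ((w - u) t) ((w - u) t) x :=
          (hw.toIsRegularMotion.sub hu hD hT).integral_gradSq_le hD hDb ht
      _ ≤ P * ε ^ 2 / β := (le_div_iff₀' hβ).2
          ((mul_integral_energyPairing_le_energy T β hρ.le).trans (henergy ε w hw t ht))
      _ = P / β * ε ^ 2 := by ring

lemma exists_error_estimate (hd : 0 < d) (hC : IsIsotropic d f J β) (hβ : 0 ≤ β)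
    (hJ : β = 0 → ∀ᵐ ξ : Vec d ∂(volume.restrict (Metric.ball 0 1)), ξ ≠ 0 → J ‖ξ‖ = 0)
    (hD : IsOpen D) (hDb : Bornology.IsBounded D) (hT : 0 < T) (hρ : 0 < ρ) (hM : 0 ≤ M)
    (hN : 0 ≤ N) (hu : IsRegularMotion D T M u)
    (hsol : IsElastodynamicSolution f J D T ρ b u₀ v₀ u) (C K : ℝ) :
    ∃ P G, 0 ≤ P ∧ ∀ ε w, IsRegularApproximation f J D T ρ b u₀ v₀ C N K ε w →
      ∀ t ∈ Icc 0 T, energy D T ρ β (w - u) t ≤ P * ε ^ 2 ∧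
        ∫ x in D, gradSq ((w - u) t) x ≤ G * ε ^ 2 := by
  obtain ⟨Λ, hΛ, hdecay⟩ := exists_collar_decay hd hC hβ hD hDb hT hρ hM hN hu hsol C K
  obtain ⟨P, hP, henergy⟩ := exists_energy_sub_le_sq hC hβ hD hDb hT hρ hM hN hu hsol hΛ
    fun ε w hw t ht x hx h => (hdecay ε w hw t ht x hx h).1
  obtain ⟨G, hgrad⟩ := exists_integral_gradSq_sub_le hd hC hβ hJ hD hDb hT hρ hu hsol hΛ
    henergy fun ε w hw t ht x hx h => (hdecay ε w hw t ht x hx h).2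
  exact ⟨P, G, hP, fun ε w hw t ht => ⟨henergy ε w hw t ht, hgrad ε w hw t ht⟩⟩

lemma IsRegularMotion.integrableOn_elasticDensity (hu : IsRegularMotion D T M u)
    (hC : IsIsotropic d f J β) (hD : IsOpen D) (hDb : Bornology.IsBounded D) (ht : t ∈ Icc 0 T) :
    IntegrableOn (elasticDensity f J (u t)) D := by
  rw [funext (hC.elasticDensity_eq (u t))]
  exact (hu.integrableOn_energyPairing hD hDb ht).const_mul β

lemma hOneNorm_le {v : Vec d → Vec d} {a G : ℝ} (hε : 0 ≤ ε)
    (hnorm : ∫ x in D, ‖v x‖ ^ 2 ≤ a * ε ^ 2) (hgrad : ∫ x in D, gradSq v x ≤ G * ε ^ 2) :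
    hOneNorm D v ≤ √(a + G) * ε := by
  rw [← Real.sqrt_sq hε, ← Real.sqrt_mul' _ (sq_nonneg ε)]
  exact Real.sqrt_le_sqrt ((add_le_add hnorm hgrad).trans_eq (by ring))

end ErrorEstimate

end Peridynamics

open Peridynamics in
theorem theorem6p2_general (d : ℕ) (hd : 0 < d) (f J : ℝ → ℝ) (hf : ContDiffOn ℝ 2 f (Ici 0))
    (hf0 : 0 < halfLineDeriv f 0) (hJ : IsInfluence J)
    (D : Set (Vec d)) (hD : IsOpen D) (hDb : Bornology.IsBounded D)
    (T ρ : ℝ) (hT : 0 < T) (hρ : 0 < ρ)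
    (b : ℝ → Vec d → Vec d) (u₀ v₀ : Vec d → Vec d)
    (u : ℝ → Vec d → Vec d) (hu : IsElastodynamicSolution f J D T ρ b u₀ v₀ u) (C₁ : ℝ) :
    ∃ C₂ > 0, ∃ C₃ > 0, ∀ ε : ℝ, 0 < ε →
      ∀ uε : ℝ → Vec d → Vec d, IsPeridynamicSolution f J D T ρ ε b u₀ v₀ uε →
      (∀ t ∈ Icc 0 T, ContDiffOn ℝ 4 (uε t) D) →
      (∀ t ∈ Icc 0 T, ∀ x ∈ D, ‖iteratedFDeriv ℝ 4 (uε t) x‖ ≤ C₁) →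
      ∀ e : ℝ → Vec d → Vec d, (∀ t x, e t x = uε t x - u t x) →
      ∀ t ∈ Icc 0 T,
        (IntegrableOn (fun x => ρ * ‖velocity T e t x‖ ^ 2) D ∧
          IntegrableOn (elasticDensity f J (e t)) D ∧
          (∫ x in D, ρ * ‖velocity T e t x‖ ^ 2) + (∫ x in D, elasticDensity f J (e t) x)
            ≤ C₂ * ε ^ 2) ∧
        (IntegrableOn (fun x => ‖e t x‖ ^ 2) D ∧ IntegrableOn (gradSq (e t)) D ∧
          hOneNorm D (e t) ≤ C₃ * ε) := by
  obtain ⟨β, hβ, hC, hβJ⟩ := exists_isIsotropic hd hf0 hJ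
  obtain ⟨M, hM, hmotion⟩ :=
    exists_isRegularMotion_of_contDiffOn hD hDb hT hu.regular hu.boundary
  obtain ⟨N, K, hN, -, happrox⟩ :=
    exists_isRegularApproximation hd hf hJ hD hDb hT hρ hM hmotion hu C₁
  obtain ⟨P, G, hP, hest⟩ :=
    exists_error_estimate hd hC hβ hβJ hD hDb hT hρ hM hN hmotion hu C₁ K
  refine ⟨P + 1, by positivity, √(P / ρ + G) + 1, by positivity,
    fun ε hε uε huε h4 hbound e he t ht => ?_⟩
  obtain rfl : e = uε - u := funext₂ he
  have hw := happrox ε hε uε huε fun s hs => ⟨h4 s hs, hbound s hs, huε.boundary s hs⟩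
  have hreg := hw.toIsRegularMotion.sub hmotion hD hT
  obtain ⟨henergy, hgrad⟩ := hest ε uε hw t ht
  have hnorm : ∫ x in D, ‖(uε - u) t x‖ ^ 2 ≤ P / ρ * ε ^ 2 := by
    rw [div_mul_eq_mul_div, le_div_iff₀' hρ]
    exact (mul_integral_norm_sq_le_energy T hβ hρ.le).trans henergy
  have hweaken : P * ε ^ 2 ≤ (P + 1) * ε ^ 2 := by gcongr; exact le_add_of_nonneg_right zero_le_one
  exact ⟨⟨(hreg.integrableOn_norm_velocity_sq hD hDb hT ht).const_mul ρ,
      hreg.integrableOn_elasticDensity hC hD hDb ht,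
      (hC.integral_norm_velocity_sq_add_integral_elasticDensity_le_energy hρ.le).trans
        (henergy.trans hweaken)⟩,
    hreg.integrableOn_norm_sq hD hDb ht, hreg.integrableOn_gradSq hD hDb ht,
    (hOneNorm_le hε.le hnorm hgrad).trans (by gcongr; exact le_add_of_nonneg_right zero_le_one)⟩

open Peridynamics in
theorem theorem6p2 (d : ℕ) (hd : d = 2 ∨ d = 3)
    (f J : ℝ → ℝ) (hf : IsPotential f) (hJ : IsInfluence J)
    (D : Set (Vec d)) (hD : IsOpen D) (hDb : Bornology.IsBounded D)
    (T ρ : ℝ) (hT : 0 < T) (hρ : 0 < ρ)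
    (b : ℝ → Vec d → Vec d) (u₀ v₀ : Vec d → Vec d)
    (D' : Set (Vec d)) (hD' : D' ⊆ D) (hdist : 0 < setDist (frontier D') (frontier D))
    (hu₀ : ∀ x, x ∉ D' → u₀ x = 0) (hv₀ : ∀ x, x ∉ D' → v₀ x = 0)
    (u : ℝ → Vec d → Vec d) (hu : IsElastodynamicSolution f J D T ρ b u₀ v₀ u)
    (C₁ : ℝ) :
    ∃ C₂ > 0, ∃ C₃ > 0, ∀ ε : ℝ, 0 < ε →
      ENNReal.ofReal ε < setDist (frontier D') (frontier D) →
      ∀ uε : ℝ → Vec d → Vec d, IsPeridynamicSolution f J D T ρ ε b u₀ v₀ uε →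
      (∀ t ∈ Set.Icc 0 T, ContDiffOn ℝ 4 (uε t) D) →
      (∀ t ∈ Set.Icc 0 T, ∀ x ∈ D, ‖iteratedFDeriv ℝ 4 (uε t) x‖ ≤ C₁) →
      ∀ e : ℝ → Vec d → Vec d, (∀ t x, e t x = uε t x - u t x) →
      ∀ t ∈ Set.Icc 0 T,
        (IntegrableOn (fun x => ρ * ‖velocity T e t x‖ ^ 2) D ∧
          IntegrableOn (elasticDensity f J (e t)) D ∧
          (∫ x in D, ρ * ‖velocity T e t x‖ ^ 2) + (∫ x in D, elasticDensity f J (e t) x)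
            ≤ C₂ * ε ^ 2) ∧
        (IntegrableOn (fun x => ‖e t x‖ ^ 2) D ∧ IntegrableOn (gradSq (e t)) D ∧
          hOneNorm D (e t) ≤ C₃ * ε) := by
  obtain ⟨C₂, hC₂, C₃, hC₃, h⟩ := theorem6p2_general d (by omega) f J
    (hf.smooth.of_le (by norm_cast)) hf.halfLineDeriv_zero_pos hJ D hD hDb T ρ hT hρ b u₀ v₀ u
    hu C₁
  exact ⟨C₂, hC₂, C₃, hC₃, fun ε hε _ => h ε hε⟩
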